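/- Let $\mathbb D$ be the open unit disc and $dA$ the Lebesgue area measure. A weight is a function $\omega:\mathbb D\to(0,\infty)$ that is integrable with respect to $dA$ and bounded below by a positive constant on each compact subset of $\mathbb D$. Let $L^2_\omega=L^2(\mathbb D,\omega\,dA)$, let $A^2_\omega$ be its closed subspace of holomorphic functions, with reproducing kernel $K_z(\zeta)=K(\zeta,z)$, let $P_\omega:L^2_\omega\to A^2_\omega$ be the orthogonal projection, and let $\tau_\omega(z)=\dfrac1{\omega(z)^{1/2}\|K_z\|}$. The weight $\omega$ belongs to $\mathcal W$ if $\|K_z\|\to\infty$ as $|z|\to1^-$; $|K(\zeta,z)|=o(\|K_z\|)$ as $|z|\to1^-$ for every $\zeta\in\mathbb D$; $\tau_\omega(z)=O(1-|z|)$ on $\mathbb D$; and there are constants $\eta,C>0$ such that $C^{-1}\tau_\omega(\zeta)\le\tau_\omega(z)\le C\tau_\omega(\zeta)$ and $\|K_z\|\|K_\zeta\|\le C|K(\zeta,z)|$ for all $z,\zeta\in\mathbb D$ with $|z-\zeta|\le\eta\,\tau_\omega(z)$. Write $\omega=e^{-\varphi}$, $\partial=\frac12(\partial_x-i\partial_y)$,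 $\bar\partial=\frac12(\partial_x+i\partial_y)$ and $\Delta=\partial\bar\partial$. The weight $\omega$ belongs to $\mathcal W^*$ if $\omega\in\mathcal W$, $\varphi\in C^2(\mathbb D)$, and either (i) $\inf_{\mathbb D}\tau_\omega^2\Delta\varphi>0$, or (ii) there are a subharmonic $\psi\in C^2(\mathbb D)$, $\psi\ge0$, and constants $\delta>0$, $t\in(-1,0)$ such that $\tau_\omega^2\Delta\psi\ge\delta$, $\Delta\varphi\ge t\,\Delta\psi$ and $|\partial\psi|^2\le\Delta\psi$ on $\mathbb D$. For $\phi$ holomorphic on $\mathbb D$, the Hankel operator $H_{\bar\phi}f=\bar\phi f-P_\omega(\bar\phi f)$ is considered on the finite linear combinations $f$ of the kernels $K_z$, $z\in\mathbb D$. It is said to be bounded on $A^2_\omega$ if $\bar\phi K_z\in L^2_\omega$ for every $z\in\mathbb D$ (so that it is defined on this dense subspace) and there is a constant $M\ge0$ with $\|H_{\bar\phi}f\|\le M\|f\|$ for all such $f$; $\|H_{\bar\phi}\|$ is the least such $M$. **Theorem.** Let $\omega\in\mathcal W^*$. There are constants $c,C>0$ depending only on $\omega$ such that, for every holomorphic $\phi$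 on $\mathbb D$: $H_{\bar\phi}$ is bounded on $A^2_\omega$ if and only if $\phi\in\mathcal B^\omega$, i.e. $\sup_{z\in\mathbb D}\tau_\omega(z)|\phi'(z)|<\infty$; and in this case $$c\,\sup_{z\in\mathbb D}\tau_\omega(z)|\phi'(z)|\ \le\ \|H_{\bar\phi}\|\ \le\ C\,\sup_{z\in\mathbb D}\tau_\omega(z)|\phi'(z)| .$$ -/

import Mathlib

open MeasureTheory Set Filter Topology
open scoped ENNReal ComplexConjugate

namespace WeightedBergman

/-- The open unit disc. -/
abbrev Disc : Set ℂ := Metric.ball (0 : ℂ) 1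

/-- A weight on the unit disc: a positive function, integrable with respect to the Lebesgue area
measure and bounded below by a positive constant on each compact subset of the disc. Only the values
on the disc matter. -/
structure Weight where
  toFun : ℂ → ℝ
  pos : ∀ z ∈ Disc, 0 < toFun z
  integrableOn : IntegrableOn toFun Disc
  bddBelow : ∀ S : Set ℂ, S ⊆ Disc → IsCompact S → ∃ c : ℝ, 0 < c ∧ ∀ z ∈ S, c ≤ toFun z

noncomputable instance : CoeFun Weight (fun _ => ℂ → ℝ) := ⟨Weight.toFun⟩

/-- The measure `ω dA` on the unit disc. -/
noncomputable def Weight.area (ω : Weight) : Measure ℂ :=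
  (volume.restrict Disc).withDensity (fun z => ENNReal.ofReal (ω z))

/-- The Hilbert space `L²(ω dA)`. -/
noncomputable abbrev L2 (ω : Weight) := Lp ℂ 2 ω.area

/-- The weighted Bergman space: the (classes of) functions in `L²(ω dA)` that are holomorphic on
the unit disc. -/
noncomputable def bergman (ω : Weight) : Submodule ℂ (L2 ω) where
  carrier := {f | ∃ F : ℂ → ℂ, DifferentiableOn ℂ F Disc ∧ f =ᵐ[ω.area] F}
  zero_mem' := ⟨0, differentiableOn_const 0, Lp.coeFn_zero _ _ _⟩
  add_mem' := by
    rintro f g ⟨F, hF, hf⟩ ⟨G, hG, hg⟩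
    exact ⟨F + G, hF.add hG, (Lp.coeFn_add f g).trans (hf.add hg)⟩
  smul_mem' := by
    rintro c f ⟨F, hF, hf⟩
    exact ⟨c • F, hF.const_smul c, (Lp.coeFn_smul c f).trans (hf.const_smul c)⟩

/-- The holomorphic representative of an element of the Bergman space. -/
noncomputable def holo {ω : Weight} (f : bergman ω) : ℂ → ℂ := Classical.choose f.2

theorem holo_differentiableOn {ω : Weight} (f : bergman ω) : DifferentiableOn ℂ (holo f) Disc :=
  (Classical.choose_spec f.2).1

theorem holo_ae {ω : Weight} (f : bergman ω) : (f : L2 ω) =ᵐ[ω.area] holo f :=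
  (Classical.choose_spec f.2).2

/-! Proof that the Bergman space is complete and has continuous point evaluations. -/

theorem Weight.aemeasurable (ω : Weight) :
    AEMeasurable (fun z => ENNReal.ofReal (ω z)) (volume.restrict Disc) :=
  ω.integrableOn.aemeasurable.ennreal_ofReal

theorem Weight.absolutelyContinuous (ω : Weight) : volume.restrict Disc ≪ ω.area := by
  refine withDensity_absolutelyContinuous' ω.aemeasurable ?_
  filter_upwards [ae_restrict_mem measurableSet_ball] with z hz
  simpa using ω.pos z hz

theorem eqOn_disc {ω : Weight} {F G : ℂ → ℂ} (h : F =ᵐ[ω.area] G)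
    (hF : DifferentiableOn ℂ F Disc) (hG : DifferentiableOn ℂ G Disc) : EqOn F G Disc :=
  Measure.eqOn_open_of_ae_eq (ω.absolutelyContinuous.ae_eq h) Metric.isOpen_ball
    hF.continuousOn hG.continuousOn

theorem area_submean {g : ℂ → ℂ} {z : ℂ} {r : ℝ}
    (hg : DifferentiableOn ℂ g (Metric.ball z r)) :
    (∫⁻ ρ in Ioo (0 : ℝ) r, ENNReal.ofReal ρ) * (ENNReal.ofReal (2 * Real.pi) * ‖g z‖ₑ)
      ≤ ∫⁻ w in Metric.ball z r, ‖g w‖ₑ := by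
  classical
  set h : ℂ → ℝ≥0∞ := (Metric.ball z r).indicator (fun w => ‖g w‖ₑ) with hh
  have hmeas : Measurable h := by
    have : Measurable ((Metric.ball z r).piecewise (fun w => ‖g w‖ₑ) (0 : ℂ → ℝ≥0∞)) :=
      ContinuousOn.measurable_piecewise hg.continuousOn.enorm continuousOn_const
        Metric.isOpen_ball.measurableSet
    rwa [Set.piecewise_eq_indicator] at this
  rw [← lintegral_indicator Metric.isOpen_ball.measurableSet, ← hh,
    ← lintegral_add_left_eq_self h z,
    ← Complex.lintegral_comp_polarCoord_symm, polarCoord_target]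
  have hm2 : Measurable fun p : ℝ × ℝ =>
      ENNReal.ofReal p.1 • h (z + Complex.polarCoord.symm p) := by
    refine Measurable.smul (ENNReal.measurable_ofReal.comp measurable_fst) (hmeas.comp ?_)
    simp only [Complex.polarCoord_symm_apply]
    fun_prop
  rw [Measure.volume_eq_prod, ← Measure.prod_restrict, lintegral_prod _ hm2.aemeasurable]
  rw [← lintegral_mul_const _ (f := fun ρ => ENNReal.ofReal ρ) ENNReal.measurable_ofReal]
  refine le_trans ?_ (lintegral_mono_set (Ioo_subset_Ioi_self : Ioo 0 r ⊆ Ioi 0))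
  refine setLIntegral_mono' measurableSet_Ioo (fun ρ hρ => ?_)
  simp only [smul_eq_mul]
  rw [lintegral_const_mul' _ _ ENNReal.ofReal_ne_top]
  gcongr
  have hsub : Metric.closedBall z |ρ| ⊆ Metric.ball z r := by
    rw [abs_of_pos hρ.1]; exact Metric.closedBall_subset_ball hρ.2
  have key : Real.circleAverage g z ρ = g z := by
    apply DiffContOnCl.circleAverage
    apply DifferentiableOn.diffContOnCl
    apply hg.mono
    exact Metric.closure_ball_subset_closedBall.trans hsub
  rw [Real.circleAverage_eq_integral_add (-Real.pi),
    intervalIntegral.integral_comp_add_right (fun θ => g (circleMap z ρ θ))] at key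
  have h2 : (∫ θ in Ioo (-Real.pi) Real.pi, g (circleMap z ρ θ)) = (2 * Real.pi) • g z := by
    rw [← key, smul_smul, mul_inv_cancel₀ (by positivity), one_smul,
      intervalIntegral.integral_of_le (by linarith [Real.pi_pos]), integral_Ioc_eq_integral_Ioo]
    congr 3 <;> ring
  calc ENNReal.ofReal (2 * Real.pi) * ‖g z‖ₑ = ‖(2 * Real.pi) • g z‖ₑ := by
        rw [enorm_smul, Real.enorm_eq_ofReal (by positivity)]
    _ ≤ ∫⁻ θ in Ioo (-Real.pi) Real.pi, ‖g (circleMap z ρ θ)‖ₑ := by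
        rw [← h2]; exact enorm_integral_le_lintegral_enorm _
    _ = _ := by
        refine setLIntegral_congr_fun measurableSet_Ioo (fun θ _ => ?_)
        have e : z + Complex.polarCoord.symm (ρ, θ) = circleMap z ρ θ := by
          simp [circleMap, Complex.exp_mul_I]
        have : circleMap z ρ θ ∈ Metric.ball z r := hsub (by
          rw [abs_of_pos hρ.1]; exact circleMap_mem_closedBall z hρ.1.le θ)
        simp only [e, hh, indicator_of_mem this]

theorem exists_local_bound (ω : Weight) {z₀ : ℂ} (hz₀ : z₀ ∈ Disc) :
    ∃ r > 0, Metric.ball z₀ r ⊆ Disc ∧ ∃ C : ℝ, 0 ≤ C ∧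
      ∀ f : bergman ω, ∀ z ∈ Metric.ball z₀ r, ‖holo f z‖ ≤ C * ‖f‖ := by
  obtain ⟨R, hR, hsub⟩ := Metric.isOpen_iff.1 (Metric.isOpen_ball (x := (0 : ℂ)) (ε := 1)) z₀ hz₀
  set r := R / 3 with hr
  have hr0 : 0 < r := by positivity
  have hK : Metric.closedBall z₀ (2 * r) ⊆ Disc :=
    (Metric.closedBall_subset_ball (by rw [hr]; linarith)).trans hsub
  obtain ⟨c, hc, hcω⟩ := ω.bddBelow _ hK (isCompact_closedBall z₀ (2 * r))
  set A : ℝ≥0∞ := (∫⁻ ρ in Ioo (0 : ℝ) r, ENNReal.ofReal ρ) * ENNReal.ofReal (2 * Real.pi)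
    * ENNReal.ofReal c with hA
  have hA0 : A ≠ 0 := by
    have : (∫⁻ ρ in Ioo (0 : ℝ) r, ENNReal.ofReal ρ) ≠ 0 := by
      rw [Ne, lintegral_eq_zero_iff (by fun_prop)]
      intro h
      have h3 := (ae_restrict_iff' measurableSet_Ioo).1 h
      have : volume (Ioo (0 : ℝ) r) = 0 := by
        refine measure_mono_null (fun x hx => ?_) h3
        simp only [mem_compl_iff, mem_ofPred_eq, Pi.zero_apply, ENNReal.ofReal_eq_zero, not_forall,
          not_le]
        exact ⟨hx, hx.1⟩
      simp at this
      linarith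
    simp only [hA, ne_eq, mul_eq_zero, ENNReal.ofReal_eq_zero, not_or, not_le]
    exact ⟨⟨this, by positivity⟩, hc⟩
  have main : ∀ f : bergman ω, ∀ z ∈ Metric.ball z₀ r, A * ‖holo f z‖ₑ ^ 2 ≤ ‖f‖ₑ ^ 2 := by
    intro f z hz
    have hb : Metric.ball z r ⊆ Metric.closedBall z₀ (2 * r) := by
      intro w hw
      have h1 := dist_triangle w z z₀
      rw [Metric.mem_ball] at hw hz
      rw [Metric.mem_closedBall]
      linarith
    have hd : DifferentiableOn ℂ (fun w => holo f w ^ 2) (Metric.ball z r) :=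
      ((holo_differentiableOn f).mono (hb.trans hK)).pow 2
    have h1 := area_submean hd
    have hn : ‖f‖ₑ ^ 2 = ∫⁻ w in Disc, ENNReal.ofReal (ω w) * ‖holo f w‖ₑ ^ 2 := by
      have e1 : ‖f‖ₑ = eLpNorm (f : L2 ω) 2 ω.area := by
        rw [← Lp.enorm_def]; rfl
      rw [e1, eLpNorm_congr_ae (holo_ae f)]
      have e2 := eLpNorm_nnreal_pow_eq_lintegral (f := holo f) (μ := ω.area) (p := 2) (by simp)
      norm_num at e2
      rw [e2, Weight.area, lintegral_withDensity_eq_lintegral_mul₀' ω.aemeasurable]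
      · rfl
      · exact ((((holo_differentiableOn f).continuousOn.aemeasurable
          measurableSet_ball).enorm.pow_const 2).mono_ac (withDensity_absolutelyContinuous _ _))
    calc A * ‖holo f z‖ₑ ^ 2 = ENNReal.ofReal c * ((∫⁻ ρ in Ioo (0 : ℝ) r, ENNReal.ofReal ρ)
          * (ENNReal.ofReal (2 * Real.pi) * ‖holo f z ^ 2‖ₑ)) := by
          rw [hA, enorm_pow]; ring
      _ ≤ ENNReal.ofReal c * ∫⁻ w in Metric.ball z r, ‖holo f w ^ 2‖ₑ := by gcongr
      _ = ∫⁻ w in Metric.ball z r, ENNReal.ofReal c * ‖holo f w‖ₑ ^ 2 := by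
          rw [lintegral_const_mul' _ _ ENNReal.ofReal_ne_top]
          simp only [enorm_pow]
      _ ≤ ∫⁻ w in Metric.ball z r, ENNReal.ofReal (ω w) * ‖holo f w‖ₑ ^ 2 := by
          refine setLIntegral_mono' measurableSet_ball (fun w hw => ?_)
          gcongr
          exact hcω w (hb hw)
      _ ≤ ‖f‖ₑ ^ 2 := by
          rw [hn]
          exact lintegral_mono_set (hb.trans hK)
  have hAtop : A ≠ ∞ := by
    have h := area_submean (g := fun _ => 1) (z := z₀) (r := r) (differentiableOn_const 1)
    simp only [enorm_one, mul_one, lintegral_const, Measure.restrict_apply, MeasurableSet.univ,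
      univ_inter, one_mul] at h
    exact ENNReal.mul_ne_top (ne_top_of_le_ne_top measure_ball_lt_top.ne h) ENNReal.ofReal_ne_top
  refine ⟨r, hr0, (Metric.ball_subset_closedBall.trans
    (Metric.closedBall_subset_closedBall (by linarith))).trans hK, Real.sqrt (A.toReal)⁻¹,
    Real.sqrt_nonneg _, fun f z hz => ?_⟩
  have h := main f z hz
  have hA1 : 0 < A.toReal := ENNReal.toReal_pos hA0 hAtop
  have h' := ENNReal.toReal_mono (by simp) h
  simp only [ENNReal.toReal_mul, ENNReal.toReal_pow, toReal_enorm] at h'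
  refine (pow_le_pow_iff_left₀ (norm_nonneg _) (by positivity) two_ne_zero).1 ?_
  rw [mul_pow, Real.sq_sqrt (by positivity), ← div_eq_inv_mul, le_div_iff₀ hA1]
  linarith

theorem holo_sub {ω : Weight} (f g : bergman ω) {z : ℂ} (hz : z ∈ Disc) :
    holo (f - g) z = holo f z - holo g z := by
  have : holo (f - g) =ᵐ[ω.area] fun z => holo f z - holo g z := by
    refine (holo_ae (f - g)).symm.trans ?_
    refine (Lp.coeFn_sub (f : L2 ω) (g : L2 ω)).trans ?_
    exact (holo_ae f).sub (holo_ae g)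
  exact eqOn_disc this (holo_differentiableOn _)
    ((holo_differentiableOn f).sub (holo_differentiableOn g)) hz

theorem holo_add {ω : Weight} (f g : bergman ω) {z : ℂ} (hz : z ∈ Disc) :
    holo (f + g) z = holo f z + holo g z := by
  have := holo_sub (f + g) g hz
  rw [add_sub_cancel_right] at this
  rw [this, sub_add_cancel]

theorem holo_smul {ω : Weight} (c : ℂ) (f : bergman ω) {z : ℂ} (hz : z ∈ Disc) :
    holo (c • f) z = c • holo f z := by
  have : holo (c • f) =ᵐ[ω.area] fun z => c • holo f z := by
    refine (holo_ae (c • f)).symm.trans ?_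
    refine (Lp.coeFn_smul c (f : L2 ω)).trans ?_
    exact (holo_ae f).const_smul c
  exact eqOn_disc this (holo_differentiableOn _) ((holo_differentiableOn f).const_smul c) hz

theorem bergman_isClosed (ω : Weight) : IsClosed (bergman ω : Set (L2 ω)) := by
  refine isClosed_of_closure_subset fun f hf => ?_
  obtain ⟨u, hu, hlim⟩ := mem_closure_iff_seq_limit.1 hf
  let v : ℕ → bergman ω := fun n => ⟨u n, hu n⟩
  have hv : CauchySeq v := by
    have := hlim.cauchySeq
    rw [Metric.cauchySeq_iff] at this ⊢
    exact this
  have hunif : ∀ z₀ ∈ Disc, ∃ r > 0, UniformCauchySeqOn (fun n => holo (v n)) atTop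
      (Metric.ball z₀ r) := by
    intro z₀ hz₀
    obtain ⟨r, hr, hsub, C, hC, hb⟩ := exists_local_bound ω hz₀
    refine ⟨r, hr, ?_⟩
    rw [Metric.uniformCauchySeqOn_iff]
    intro ε hε
    obtain ⟨N, hN⟩ := Metric.cauchySeq_iff.1 hv (ε / (C + 1)) (by positivity)
    refine ⟨N, fun m hm n hn z hz => ?_⟩
    have h1 := hN m hm n hn
    rw [dist_eq_norm] at h1 ⊢
    rw [← holo_sub _ _ (hsub hz)]
    calc _ ≤ C * ‖v m - v n‖ := hb _ z hz
      _ ≤ (C + 1) * ‖v m - v n‖ := by gcongr; linarith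
      _ < (C + 1) * (ε / (C + 1)) := by gcongr
      _ = ε := by field_simp
  have hpt : ∀ z ∈ Disc, ∃ w, Tendsto (fun n => holo (v n) z) atTop (𝓝 w) := by
    intro z hz
    obtain ⟨r, hr, h⟩ := hunif z hz
    exact cauchySeq_tendsto_of_complete (h.cauchySeq (Metric.mem_ball_self hr))
  choose! F hF using hpt
  have hloc : TendstoLocallyUniformlyOn (fun n => holo (v n)) F atTop Disc := by
    rw [Metric.tendstoLocallyUniformlyOn_iff]
    intro ε hε z₀ hz₀
    obtain ⟨r, hr, h⟩ := hunif z₀ hz₀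
    have h' : UniformCauchySeqOn (fun n => holo (v n)) atTop (Metric.ball z₀ r ∩ Disc) :=
      h.mono inter_subset_left
    exact ⟨Metric.ball z₀ r ∩ Disc, inter_mem (mem_nhdsWithin_of_mem_nhds (Metric.ball_mem_nhds z₀ hr)) self_mem_nhdsWithin,
      Metric.tendstoUniformlyOn_iff.1
        (h'.tendstoUniformlyOn_of_tendsto fun z hz => hF z hz.2) ε hε⟩
  have hFd : DifferentiableOn ℂ F Disc :=
    hloc.differentiableOn (Eventually.of_forall fun n => holo_differentiableOn (v n))
      Metric.isOpen_ball
  obtain ⟨ns, hns, hae⟩ := (tendstoInMeasure_of_tendsto_Lp hlim).exists_seq_tendsto_ae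
  refine ⟨F, hFd, ?_⟩
  have hall : ∀ᵐ z ∂ω.area, ∀ n, u n z = holo (v n) z := ae_all_iff.2 fun n => holo_ae (v n)
  have hdisc : ∀ᵐ z ∂ω.area, z ∈ Disc :=
    (withDensity_absolutelyContinuous _ _).ae_le (ae_restrict_mem measurableSet_ball)
  filter_upwards [hae, hall, hdisc] with z h1 h2 h3
  simp only [h2] at h1
  exact tendsto_nhds_unique h1 ((hF z h3).comp hns.tendsto_atTop)

instance (ω : Weight) : CompleteSpace (bergman ω) :=
  (bergman_isClosed ω).completeSpace_coe

/-- The Bergman space is a reproducing kernel Hilbert space of functions on the disc: an element is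
evaluated at a point through its holomorphic representative. -/
noncomputable instance (ω : Weight) : RKHS ℂ (bergman ω) Disc ℂ where
  coeCLM := ContinuousLinearMap.pi fun z =>
    LinearMap.mkContinuousOfExistsBound
      { toFun := fun f => holo f z
        map_add' := fun f g => holo_add f g z.2
        map_smul' := fun c f => holo_smul c f z.2 }
      (by
        obtain ⟨r, hr, -, C, -, h⟩ := exists_local_bound ω z.2
        exact ⟨C, fun f => h f z (Metric.mem_ball_self hr)⟩)
  coeCLM_injective := by
    intro f g h
    have hd : ∀ᵐ z ∂ω.area, z ∈ Disc :=
      (withDensity_absolutelyContinuous _ _).ae_le (ae_restrict_mem measurableSet_ball)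
    refine Subtype.ext (Lp.ext ?_)
    filter_upwards [holo_ae f, holo_ae g, hd] with z h1 h2 h3
    rw [h1, h2]
    exact congrFun h ⟨z, h3⟩

theorem bergman_apply {ω : Weight} (f : bergman ω) (z : Disc) : f z = holo f z := rfl

/-! Kernel, Hankel operators, weight classes. -/

/-- The reproducing kernel `K_z` of the Bergman space; `K(ζ, z)` is `K ω z ζ`. -/
noncomputable def K (ω : Weight) (z : Disc) : bergman ω := RKHS.kerFun (bergman ω) z 1

/-- `τ_ω(z) = 1 / (ω(z)^{1/2} ‖K_z‖)`. -/
noncomputable def tau (ω : Weight) (z : Disc) : ℝ := 1 / (Real.sqrt (ω z) * ‖K ω z‖)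

theorem conj_mul_add_ae {ω : Weight} (φ : ℂ → ℂ) (f g : bergman ω) :
    (fun z => conj (φ z) * ((f + g : bergman ω) : L2 ω) z) =ᵐ[ω.area]
      (fun z => conj (φ z) * (f : L2 ω) z) + fun z => conj (φ z) * (g : L2 ω) z := by
  filter_upwards [Lp.coeFn_add (f : L2 ω) (g : L2 ω)] with z hz
  rw [Submodule.coe_add, hz]
  simp [mul_add]

theorem conj_mul_smul_ae {ω : Weight} (φ : ℂ → ℂ) (c : ℂ) (f : bergman ω) :
    (fun z => conj (φ z) * ((c • f : bergman ω) : L2 ω) z) =ᵐ[ω.area]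
      c • fun z => conj (φ z) * (f : L2 ω) z := by
  filter_upwards [Lp.coeFn_smul c (f : L2 ω)] with z hz
  rw [Submodule.coe_smul, hz]
  simp only [Pi.smul_apply, smul_eq_mul]
  ring

/-- The `f` in the Bergman space for which `conj φ * f` is in `L²(ω dA)`. -/
noncomputable def conjMulDomain (ω : Weight) (φ : ℂ → ℂ) : Submodule ℂ (bergman ω) where
  carrier := {f | MemLp (fun z => conj (φ z) * (f : L2 ω) z) 2 ω.area}
  zero_mem' := by
    have h := conj_mul_smul_ae φ 0 (0 : bergman ω)
    rw [zero_smul, zero_smul] at h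
    exact (memLp_congr_ae h).2 MemLp.zero
  add_mem' := fun {f g} hf hg => (memLp_congr_ae (conj_mul_add_ae φ f g)).2 (MemLp.add hf hg)
  smul_mem' := fun c f hf => (memLp_congr_ae (conj_mul_smul_ae φ c f)).2 (MemLp.const_smul hf c)

/-- Multiplication by `conj φ`, as a map into `L²(ω dA)`. -/
noncomputable def conjMul (ω : Weight) (φ : ℂ → ℂ) : conjMulDomain ω φ →ₗ[ℂ] L2 ω where
  toFun f := MemLp.toLp (fun z => conj (φ z) * ((f : bergman ω) : L2 ω) z) f.2
  map_add' f g :=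
    (MemLp.toLp_congr (f + g).2 (MemLp.add f.2 g.2) (conj_mul_add_ae φ f.1 g.1)).trans
      (MemLp.toLp_add f.2 g.2)
  map_smul' c f :=
    (MemLp.toLp_congr (c • f).2 (MemLp.const_smul f.2 c) (conj_mul_smul_ae φ c f.1)).trans
      (MemLp.toLp_const_smul c f.2)

/-- The linear span of the reproducing kernels. -/
noncomputable def kernelSpan (ω : Weight) : Submodule ℂ (bergman ω) :=
  Submodule.span ℂ (range (K ω))

/-- The Hankel operator `H f = conj φ * f - P (conj φ * f)`, where `P` is the orthogonal projection
of `L²(ω dA)` onto the Bergman space. Its domain consists of the finite linear combinations of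
reproducing kernels (those for which `conj φ * f` is in `L²(ω dA)`, see `HankelDefined`). -/
noncomputable def hankel (ω : Weight) (φ : ℂ → ℂ) : bergman ω →ₗ.[ℂ] L2 ω where
  domain := kernelSpan ω ⊓ conjMulDomain ω φ
  toFun := (LinearMap.id - (bergman ω).starProjection.toLinearMap) ∘ₗ conjMul ω φ ∘ₗ
    Submodule.inclusion inf_le_right

/-- The Hankel operator is defined on all linear combinations of kernels, i.e. `conj φ * K_z` is
in `L²(ω dA)` for all `z`. -/
def HankelDefined (ω : Weight) (φ : ℂ → ℂ) : Prop := ∀ z : Disc, K ω z ∈ conjMulDomain ω φ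

/-- The densely defined Hankel operator is bounded. -/
def HankelBounded (ω : Weight) (φ : ℂ → ℂ) : Prop :=
  HankelDefined ω φ ∧ ∃ C : ℝ, ∀ f : (hankel ω φ).domain, ‖hankel ω φ f‖ ≤ C * ‖(f : bergman ω)‖

/-- The operator norm of the Hankel operator. -/
noncomputable def hankelNorm (ω : Weight) (φ : ℂ → ℂ) : ℝ :=
  sInf {C : ℝ | 0 ≤ C ∧ ∀ f : (hankel ω φ).domain, ‖hankel ω φ f‖ ≤ C * ‖(f : bergman ω)‖}

/-- The space `B^ω` of holomorphic `φ` on the disc with `sup τ_ω |φ'| < ∞`. -/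
def bloch (ω : Weight) : Set (ℂ → ℂ) :=
  {φ | DifferentiableOn ℂ φ Disc ∧ BddAbove (range fun z : Disc => tau ω z * ‖deriv φ z‖)}

/-- `sup τ_ω |φ'|`. -/
noncomputable def blochNorm (ω : Weight) (φ : ℂ → ℂ) : ℝ := ⨆ z : Disc, tau ω z * ‖deriv φ z‖

/-- `|z| → 1` in the disc. -/
noncomputable def toBoundary : Filter Disc := comap (fun z : Disc => ‖(z : ℂ)‖) (𝓝 1)

/-- The class `W` of weights. -/
structure Weight.IsW (ω : Weight) : Prop where
  norm_kernel : Tendsto (fun z => ‖K ω z‖) toBoundary atTop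
  kernel_isLittleO : ∀ ζ : Disc, (fun z => K ω z ζ) =o[toBoundary] fun z => ‖K ω z‖
  tau_le : ∃ C : ℝ, ∀ z : Disc, tau ω z ≤ C * (1 - ‖(z : ℂ)‖)
  local_estimates : ∃ η : ℝ, 0 < η ∧ ∃ C : ℝ, 0 < C ∧ ∀ z ζ : Disc,
    ‖(z : ℂ) - ζ‖ ≤ η * tau ω z →
      tau ω z ≤ C * tau ω ζ ∧ tau ω ζ ≤ C * tau ω z ∧ ‖K ω z‖ * ‖K ω ζ‖ ≤ C * ‖K ω z ζ‖

/-- `∂ = (∂/∂x - i ∂/∂y) / 2`. -/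
noncomputable def del (u : ℂ → ℂ) (z : ℂ) : ℂ :=
  1 / 2 * (fderiv ℝ u z 1 - Complex.I * fderiv ℝ u z Complex.I)

/-- `∂̄ = (∂/∂x + i ∂/∂y) / 2`. -/
noncomputable def delbar (u : ℂ → ℂ) (z : ℂ) : ℂ :=
  1 / 2 * (fderiv ℝ u z 1 + Complex.I * fderiv ℝ u z Complex.I)

/-- The Laplacian normalized as `Δ = ∂ ∂̄`, a quarter of the usual one, of a real function. -/
noncomputable def lap (u : ℂ → ℝ) (z : ℂ) : ℝ := (del (delbar fun w => (u w : ℂ)) z).re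

/-- `φ = log (1 / ω)`, so that `ω = exp (-φ)`. -/
noncomputable def Weight.potential (ω : Weight) (z : ℂ) : ℝ := -Real.log (ω z)

/-- First admissible condition: `τ_ω² Δφ` is bounded below by a positive constant. -/
def Weight.LaplacianLarge (ω : Weight) : Prop :=
  ∃ c : ℝ, 0 < c ∧ ∀ z : Disc, c ≤ tau ω z ^ 2 * lap ω.potential z

/-- Second admissible condition. A `C²` function `ψ` is subharmonic if and only if `Δψ ≥ 0`. -/
def Weight.HasAuxiliary (ω : Weight) : Prop :=
  ∃ ψ : ℂ → ℝ, ContDiffOn ℝ 2 ψ Disc ∧ (∀ z : Disc, 0 ≤ ψ z) ∧ (∀ z : Disc, 0 ≤ lap ψ z) ∧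
    ∃ δ t : ℝ, 0 < δ ∧ -1 < t ∧ t < 0 ∧ ∀ z : Disc,
      δ ≤ tau ω z ^ 2 * lap ψ z ∧ t * lap ψ z ≤ lap ω.potential z ∧
        ‖del (fun w => (ψ w : ℂ)) z‖ ^ 2 ≤ lap ψ z

/-- The class `W*` of weights. -/
structure Weight.IsWStar (ω : Weight) : Prop where
  isW : ω.IsW
  contDiffOn : ContDiffOn ℝ 2 ω.potential Disc
  laplacian : ω.LaplacianLarge ∨ ω.HasAuxiliary

end WeightedBergman

/-! Let `f` lie in the domain and let `F` be its holomorphic representative. Then `U = H f` differs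
from `conj φ * F` by a holomorphic function and is orthogonal to the Bergman space, so it is the
solution of `∂̄U = conj φ' * F` of least norm in `L²(ω dA)`. Both bounds come from pairing such a
`U` with `s = conj (∂̄b) / ω`, where `b` is a `C²` function with compact support in the disc. The
weight cancels and `⟨s, U⟩ = ∫ U ∂̄b = -∫ b ∂̄U`, so the projection drops out (`inner_delbarRange`,
`integral_mul_delbar_test`).

Upper bound. By Weyl's lemma, whatever is orthogonal to all these `s` is holomorphic, so their
closure contains the orthogonal complement of the Bergman space (`delbarRange_orthogonal_le`). An a
priori estimate `∫ L|b|²/ω ≤ C ∫ |∂̄b|²/ω` therefore dualizes to Hörmander's bound `‖U‖² ≤ C ∫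
|∂̄U|² ω/L` (`IsMinimal.integral_norm_sq_le`). The a priori estimate comes from the commutator
inequality `integral_lap_mul_le` with potential `p + 2ψ`, where `p = -log ω`: the error `|∂̄ψ|²` is
absorbed by `Δ(p + 2ψ)` (`exists_hasDelbarEstimate`). Since `L ≥ c τ⁻²`, this bounds `‖H f‖` by a
multiple of `sup τ|φ'| ‖f‖`.

Domain. That `conj φ * K_z` is square integrable needs proof. The kernel differs from a compactly
supported bump by a minimal solution whose `∂̄` has compact support. Hörmander's estimate persists
for `ω W` when `W` has a small logarithmic gradient relative to `L`. Taking for `W` bounded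
truncations of `A + |φ|²`, with `A` large, gives bounds independent of the truncation
(`IsMinimal.memLp_conj_mul`).

Lower bound. Take for `b` a mollifier at scale `τ(z)` around `z`, divided by `K_z`, which has no
zeros there. Pairing with `H K_z` gives exactly `-conj φ'(z)`, and the local estimates of the class
`W` give `‖s‖ ‖K_z‖ ≤ const / τ(z)`. Cauchy–Schwarz concludes
(`Weight.IsW.exists_tau_mul_norm_deriv_le`). -/

namespace WeightedBergman

/-- `C^n` functions with compact support in the unit disc. -/
structure IsTest {E : Type*} [NormedAddCommGroup E] [NormedSpace ℝ E] (n : WithTop ℕ∞) (b : ℂ → E) :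
    Prop where
  contDiff : ContDiff ℝ n b
  hasCompactSupport : HasCompactSupport b
  tsupport_subset : tsupport b ⊆ Disc

/-! ### Compactly supported functions in the disc and integration by parts -/

section Basic

variable {E : Type*} [NormedAddCommGroup E] [NormedSpace ℝ E]

theorem isOpen_disc : IsOpen Disc := Metric.isOpen_ball

theorem disc_mem_nhds {z : ℂ} (hz : z ∈ Disc) : Disc ∈ 𝓝 z := isOpen_disc.mem_nhds hz

/-- Regularity is only ever known on the disc, and values outside it are arbitrary. Vanishing off a
compact subset of the disc is what allows passing to integrals over the whole plane. -/
theorem integrable_of_eq_zero_off_compact {F : Type*} [NormedAddCommGroup F] {f : ℂ → F} {S : Set ℂ} (hf : ContinuousOn f Disc)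
    (hS : IsCompact S) (hSD : S ⊆ Disc) (h0 : ∀ z ∉ S, f z = 0) : Integrable f := by
  rw [← integrableOn_iff_integrable_of_support_subset (s := S)]
  · exact (hf.mono hSD).integrableOn_compact hS
  · intro z hz
    by_contra h
    exact hz (h0 z h)

theorem contDiff_of_eq_zero_off_compact {f : ℂ → E} {S : Set ℂ} {n : WithTop ℕ∞}
    (hf : ContDiffOn ℝ n f Disc) (hS : IsCompact S) (hSD : S ⊆ Disc) (h0 : ∀ z ∉ S, f z = 0) :
    ContDiff ℝ n f := by
  rw [contDiff_iff_contDiffAt]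
  intro z
  by_cases hz : z ∈ S
  · exact hf.contDiffAt (disc_mem_nhds (hSD hz))
  · refine (contDiffAt_const (c := (0 : E))).congr_of_eventuallyEq ?_
    filter_upwards [hS.isClosed.isOpen_compl.mem_nhds hz] with w hw using h0 w hw

theorem isTest_of_eq_zero_off_compact {f : ℂ → E} {S : Set ℂ} {n : WithTop ℕ∞}
    (hf : ContDiffOn ℝ n f Disc) (hS : IsCompact S) (hSD : S ⊆ Disc) (h0 : ∀ z ∉ S, f z = 0) :
    IsTest n f := by
  have hs : tsupport f ⊆ S := by
    refine closure_minimal (fun z hz => ?_) hS.isClosed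
    by_contra h
    exact hz (h0 z h)
  exact ⟨contDiff_of_eq_zero_off_compact hf hS hSD h0,
    hS.of_isClosed_subset (isClosed_tsupport f) hs, hs.trans hSD⟩

theorem IsTest.of_le {n m : WithTop ℕ∞} {b : ℂ → E} (hb : IsTest n b) (h : m ≤ n) : IsTest m b :=
  ⟨hb.contDiff.of_le h, hb.hasCompactSupport, hb.tsupport_subset⟩

theorem IsTest.eq_zero {n : WithTop ℕ∞} {b : ℂ → E} (_ : IsTest n b) {z : ℂ}
    (hz : z ∉ tsupport b) : b z = 0 := image_eq_zero_of_notMem_tsupport hz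

theorem IsTest.integrable {F : Type*} [NormedAddCommGroup F] [NormedSpace ℝ F]
    {n : WithTop ℕ∞} {b : ℂ → E} (hb : IsTest n b) {f : ℂ → F} (hf : ContinuousOn f Disc)
    (h0 : ∀ z ∉ tsupport b, f z = 0) : Integrable f :=
  integrable_of_eq_zero_off_compact hf hb.hasCompactSupport hb.tsupport_subset h0

theorem contDiffOn_fderiv_apply {f : ℂ → E} {n m : WithTop ℕ∞} (hf : ContDiffOn ℝ n f Disc)
    (h : m + 1 ≤ n) (v : ℂ) : ContDiffOn ℝ m (fun z => fderiv ℝ f z v) Disc :=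
  (hf.fderiv_of_isOpen isOpen_disc h).clm_apply contDiffOn_const

theorem differentiableAt_of_contDiffOn {f : ℂ → E} (hf : ContDiffOn ℝ 1 f Disc) {z : ℂ}
    (hz : z ∈ Disc) : DifferentiableAt ℝ f z :=
  (hf.contDiffAt (disc_mem_nhds hz)).differentiableAt one_ne_zero

/-- Integration by parts on the disc. -/
theorem integral_mul_fderiv_test {𝕜 : Type*} [NormedField 𝕜] [NormedAlgebra ℝ 𝕜] {f g : ℂ → 𝕜}
    (hf : ContDiffOn ℝ 1 f Disc) (hg : IsTest 1 g) (v : ℂ) :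
    ∫ z, f z * fderiv ℝ g z v = -∫ z, fderiv ℝ f z v * g z := by
  have hf' : ContinuousOn (fun z => fderiv ℝ f z v) Disc :=
    (contDiffOn_fderiv_apply (m := 0) hf (by simp) v).continuousOn
  have hg' : ContinuousOn (fun z => fderiv ℝ g z v) Disc :=
    (contDiffOn_fderiv_apply (m := 0) hg.contDiff.contDiffOn (by simp) v).continuousOn
  have hgc : ContinuousOn g Disc := hg.contDiff.continuous.continuousOn
  refine integral_mul_fderiv_eq_neg_fderiv_mul_of_integrable
    (hg.integrable (hf'.mul hgc) fun z hz => ?_)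
    (hg.integrable (hf.continuousOn.mul hg') fun z hz => ?_)
    (hg.integrable (hf.continuousOn.mul hgc) fun z hz => ?_)
    (fun z hz => differentiableAt_of_contDiffOn hf (hg.tsupport_subset hz))
    (fun z _ => hg.contDiff.differentiable one_ne_zero z)
  · rw [hg.eq_zero hz, mul_zero]
  · rw [fderiv_of_notMem_tsupport ℝ hz]; simp
  · rw [hg.eq_zero hz, mul_zero]

end Basic

/-! ### Calculus of the operator `∂̄` -/

section Delbar

theorem delbar_mul {f g : ℂ → ℂ} {z : ℂ} (hf : DifferentiableAt ℝ f z)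
    (hg : DifferentiableAt ℝ g z) :
    delbar (fun w => f w * g w) z = f z * delbar g z + delbar f z * g z := by
  simp only [delbar]
  rw [fderiv_fun_mul hf hg]
  simp only [add_apply, smul_apply, smul_eq_mul]
  ring

theorem delbar_sub {f g : ℂ → ℂ} {z : ℂ} (hf : DifferentiableAt ℝ f z)
    (hg : DifferentiableAt ℝ g z) :
    delbar (fun w => f w - g w) z = delbar f z - delbar g z := by
  simp only [delbar]
  rw [fderiv_fun_sub hf hg]
  simp only [sub_apply]
  ring

theorem delbar_add {f g : ℂ → ℂ} {z : ℂ} (hf : DifferentiableAt ℝ f z)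
    (hg : DifferentiableAt ℝ g z) :
    delbar (fun w => f w + g w) z = delbar f z + delbar g z := by
  simp only [delbar]
  rw [fderiv_fun_add hf hg]
  simp only [add_apply]
  ring

theorem delbar_const_mul {g : ℂ → ℂ} {z : ℂ} (hg : DifferentiableAt ℝ g z) (c : ℂ) :
    delbar (fun w => c * g w) z = c * delbar g z := by
  rw [delbar_mul (differentiableAt_const c) hg]
  simp [delbar]

theorem delbar_congr {f g : ℂ → ℂ} {z : ℂ} (h : f =ᶠ[𝓝 z] g) : delbar f z = delbar g z := by
  simp only [delbar, h.fderiv_eq]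

theorem delbar_eq_zero {f : ℂ → ℂ} {z : ℂ} (hf : DifferentiableAt ℂ f z) : delbar f z = 0 := by
  have h := hf.hasFDerivAt.restrictScalars ℝ
  simp only [delbar, h.fderiv, ContinuousLinearMap.coe_restrictScalars', fderiv_eq_smul_deriv,
    smul_eq_mul]
  linear_combination (1 / 2 * deriv f z) * Complex.I_sq

theorem delbar_conj {f : ℂ → ℂ} {z : ℂ} (hf : DifferentiableAt ℂ f z) :
    delbar (fun w => conj (f w)) z = conj (deriv f z) := by
  have h := hf.hasFDerivAt.restrictScalars ℝ
  have h2 : HasFDerivAt (fun w => conj (f w)) _ z := Complex.conjCLE.hasFDerivAt.comp z h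
  simp only [delbar, h2.fderiv]
  simp only [ContinuousLinearMap.comp_apply, ContinuousLinearMap.coe_restrictScalars',
    fderiv_eq_smul_deriv, smul_eq_mul, ContinuousLinearEquiv.coe_coe, Complex.conjCLE_apply,
    map_mul, Complex.conj_I, map_one]
  linear_combination (-1 / 2 * conj (deriv f z)) * Complex.I_sq

theorem differentiableAt_complex_of_delbar_eq_zero {f : ℂ → ℂ} {z : ℂ}
    (hf : DifferentiableAt ℝ f z) (h : delbar f z = 0) : DifferentiableAt ℂ f z := by
  rw [differentiableAt_complex_iff_differentiableAt_real]
  refine ⟨hf, ?_⟩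
  simp only [delbar] at h
  simp only [smul_eq_mul]
  linear_combination (-2 * Complex.I) * h + (fderiv ℝ f z Complex.I) * Complex.I_sq

theorem delbar_of_notMem_tsupport {b : ℂ → ℂ} {z : ℂ} (hz : z ∉ tsupport b) : delbar b z = 0 := by
  simp [delbar, fderiv_of_notMem_tsupport ℝ hz]

/-- The chain rule for `∂̄` of a real function of a real function. -/
theorem delbar_ofReal_comp {h : ℝ → ℝ} {s : ℂ → ℝ} {h' : ℝ} {z : ℂ} (hh : HasDerivAt h h' (s z))
    (hs : DifferentiableAt ℝ s z) :
    delbar (fun w => ((h (s w) : ℝ) : ℂ)) z = h' * delbar (fun w => (s w : ℂ)) z := by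
  have h1 : HasFDerivAt (fun w => ((h (s w) : ℝ) : ℂ)) _ z :=
    Complex.ofRealCLM.hasFDerivAt.comp z (hh.comp_hasFDerivAt z hs.hasFDerivAt)
  have h2 : HasFDerivAt (fun w => ((s w : ℝ) : ℂ)) _ z :=
    Complex.ofRealCLM.hasFDerivAt.comp z hs.hasFDerivAt
  simp only [delbar, h1.fderiv, h2.fderiv]
  simp
  ring

theorem contDiffOn_delbar {f : ℂ → ℂ} {n m : WithTop ℕ∞} (hf : ContDiffOn ℝ n f Disc)
    (h : m + 1 ≤ n) : ContDiffOn ℝ m (delbar f) Disc := by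
  unfold delbar
  exact contDiffOn_const.mul ((contDiffOn_fderiv_apply hf h 1).add
    (contDiffOn_const.mul (contDiffOn_fderiv_apply hf h Complex.I)))

theorem continuousOn_delbar {f : ℂ → ℂ} (hf : ContDiffOn ℝ 1 f Disc) :
    ContinuousOn (delbar f) Disc :=
  (contDiffOn_delbar (m := 0) hf (by simp)).continuousOn

theorem IsTest.continuousOn_delbar {b : ℂ → ℂ} (hb : IsTest 1 b) : ContinuousOn (delbar b) Disc :=
  WeightedBergman.continuousOn_delbar hb.contDiff.contDiffOn

theorem contDiffOn_of_differentiableOn {f : ℂ → ℂ} {n : WithTop ℕ∞}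
    (hf : DifferentiableOn ℂ f Disc) : ContDiffOn ℝ n f Disc :=
  (hf.contDiffOn isOpen_disc).restrict_scalars ℝ

theorem contDiffOn_conj {f : ℂ → ℂ} {n : WithTop ℕ∞} (hf : ContDiffOn ℝ n f Disc) :
    ContDiffOn ℝ n (fun z => conj (f z)) Disc :=
  Complex.conjCLE.contDiff.comp_contDiffOn hf

theorem contDiffOn_ofReal {f : ℂ → ℝ} {n : WithTop ℕ∞} (hf : ContDiffOn ℝ n f Disc) :
    ContDiffOn ℝ n (fun z => (f z : ℂ)) Disc :=
  Complex.ofRealCLM.contDiff.comp_contDiffOn hf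

/-- Integration by parts for `∂̄` on the disc. -/
theorem integral_mul_delbar_test {f g : ℂ → ℂ} (hf : ContDiffOn ℝ 1 f Disc) (hg : IsTest 1 g) :
    ∫ z, f z * delbar g z = -∫ z, delbar f z * g z := by
  have hi1 : ∀ v, Integrable fun z => f z * fderiv ℝ g z v := fun v =>
    hg.integrable (hf.continuousOn.mul
      (contDiffOn_fderiv_apply (m := 0) hg.contDiff.contDiffOn (by simp) v).continuousOn)
      fun z hz => by rw [fderiv_of_notMem_tsupport ℝ hz]; simp
  have hi2 : ∀ v, Integrable fun z => fderiv ℝ f z v * g z := fun v =>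
    hg.integrable ((contDiffOn_fderiv_apply (m := 0) hf (by simp) v).continuousOn.mul
      hg.contDiff.continuous.continuousOn) fun z hz => by rw [hg.eq_zero hz, mul_zero]
  have e1 : ∫ z, f z * delbar g z = 1 / 2 * ((∫ z, f z * fderiv ℝ g z 1) +
      Complex.I * ∫ z, f z * fderiv ℝ g z Complex.I) := by
    rw [← integral_const_mul, ← integral_add (hi1 _) ((hi1 _).const_mul _), ← integral_const_mul]
    congr 1; ext z; simp only [delbar]; ring
  have e2 : ∫ z, delbar f z * g z = 1 / 2 * ((∫ z, fderiv ℝ f z 1 * g z) +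
      Complex.I * ∫ z, fderiv ℝ f z Complex.I * g z) := by
    rw [← integral_const_mul, ← integral_add (hi2 _) ((hi2 _).const_mul _), ← integral_const_mul]
    congr 1; ext z; simp only [delbar]; ring
  rw [e1, e2, integral_mul_fderiv_test hf hg, integral_mul_fderiv_test hf hg]
  ring

end Delbar

/-! ### Radial mollifiers and their `∂̄`-primitives -/

section Mollifier

open scoped ContDiff

/-- A smooth function that is `1` on `(-∞, 1/3]` and `0` on `[2/3, ∞)`. -/
noncomputable def cutoff (s : ℝ) : ℝ := Real.smoothTransition (2 - 3 * s)

theorem contDiff_cutoff {n : ℕ∞} : ContDiff ℝ n cutoff :=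
  Real.smoothTransition.contDiff.comp (contDiff_const.sub (contDiff_const.mul contDiff_id))

theorem cutoff_of_le {s : ℝ} (h : s ≤ 1 / 3) : cutoff s = 1 :=
  Real.smoothTransition.one_of_one_le (by linarith)

theorem cutoff_of_ge {s : ℝ} (h : 2 / 3 ≤ s) : cutoff s = 0 :=
  Real.smoothTransition.zero_of_nonpos (by linarith)

theorem deriv_cutoff_of_lt {s : ℝ} (h : s < 1 / 3) : deriv cutoff s = 0 := by
  have : cutoff =ᶠ[𝓝 s] fun _ => 1 := by
    filter_upwards [Iio_mem_nhds h] with t ht using cutoff_of_le (le_of_lt ht)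
  rw [this.deriv_eq, deriv_const]

theorem deriv_cutoff_of_gt {s : ℝ} (h : 2 / 3 < s) : deriv cutoff s = 0 := by
  have : cutoff =ᶠ[𝓝 s] fun _ => 0 := by
    filter_upwards [Ioi_mem_nhds h] with t ht using cutoff_of_ge (le_of_lt ht)
  rw [this.deriv_eq, deriv_const]

theorem contDiff_deriv_cutoff {n : ℕ∞} : ContDiff ℝ n (deriv cutoff) := by
  have h : ContDiff ℝ ∞ cutoff := contDiff_cutoff (n := ⊤)
  exact (contDiff_infty_iff_deriv.1 h).2.of_le (by exact_mod_cast le_top)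

theorem exists_deriv_cutoff_bound : ∃ B : ℝ, 0 < B ∧ ∀ s, |deriv cutoff s| ≤ B := by
  have hc : HasCompactSupport (deriv cutoff) := by
    refine HasCompactSupport.intro (isCompact_Icc (a := (1 / 3 : ℝ)) (b := 2 / 3)) fun s hs => ?_
    rcases lt_or_ge s (1 / 3) with h | h
    · exact deriv_cutoff_of_lt h
    · exact deriv_cutoff_of_gt (lt_of_not_ge fun h' => hs ⟨h, h'⟩)
  obtain ⟨B, hB⟩ := hc.exists_bound_of_continuous (contDiff_deriv_cutoff (n := 0)).continuous
  exact ⟨max B 1, by positivity, fun s => (hB s).trans (le_max_left _ _)⟩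

/-- A smooth radial mollifier supported in an annulus of outer radius less than `ε`. -/
noncomputable def mol (ε : ℝ) (z : ℂ) : ℝ := -deriv cutoff (Complex.normSq z / ε ^ 2) / (Real.pi * ε ^ 2)

theorem contDiff_normSq {n : WithTop ℕ∞} : ContDiff ℝ n (fun z : ℂ => Complex.normSq z) := by
  simp only [Complex.normSq_apply]
  exact (Complex.reCLM.contDiff.mul Complex.reCLM.contDiff).add
    (Complex.imCLM.contDiff.mul Complex.imCLM.contDiff)

theorem contDiff_mol {n : ℕ∞} (ε : ℝ) : ContDiff ℝ n (mol ε) :=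
  ((contDiff_deriv_cutoff.comp (contDiff_normSq.div_const _)).neg).div_const _

theorem mol_eq_zero {ε : ℝ} (hε : 0 < ε) {z : ℂ} (hz : ε ≤ ‖z‖) : mol ε z = 0 := by
  have : (2 : ℝ) / 3 < Complex.normSq z / ε ^ 2 := by
    rw [Complex.normSq_eq_norm_sq, lt_div_iff₀ (by positivity)]
    nlinarith
  simp [mol, deriv_cutoff_of_gt this]

theorem abs_mol_le {B : ℝ} (hB : ∀ s, |deriv cutoff s| ≤ B) (ε : ℝ) (z : ℂ) :
    |mol ε z| ≤ B / (Real.pi * ε ^ 2) := by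
  rw [mol, abs_div, abs_neg, abs_of_nonneg (by positivity : 0 ≤ Real.pi * ε ^ 2)]
  gcongr
  exact hB _

/-- In polar coordinates the radial integrand is the derivative of `-cutoff (r² / ε²) / (2π)`, which
goes from `-1/(2π)` at `0` to `0` at infinity; the angle contributes `2π`. -/
theorem integral_mol {ε : ℝ} (hε : 0 < ε) : ∫ z, mol ε z = 1 := by
  rw [← Complex.integral_comp_polarCoord_symm, polarCoord_target, Measure.volume_eq_prod]
  have e : ∀ p : ℝ × ℝ, p.1 • mol ε (Complex.polarCoord.symm p) =
      (p.1 * (-deriv cutoff (p.1 ^ 2 / ε ^ 2) / (Real.pi * ε ^ 2))) * 1 := by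
    intro p
    rw [mol, Complex.normSq_eq_norm_sq, Complex.norm_polarCoord_symm, sq_abs, smul_eq_mul, mul_one]
  simp only [e]
  rw [setIntegral_prod_mul (fun r : ℝ => r * (-deriv cutoff (r ^ 2 / ε ^ 2) / (Real.pi * ε ^ 2)))
    (fun _ => (1 : ℝ))]
  have hd : ∀ x : ℝ, HasDerivAt (fun r : ℝ => -cutoff (r ^ 2 / ε ^ 2) / (2 * Real.pi))
      (x * (-deriv cutoff (x ^ 2 / ε ^ 2) / (Real.pi * ε ^ 2))) x := by
    intro x
    have h1 : HasDerivAt cutoff (deriv cutoff (x ^ 2 / ε ^ 2)) (x ^ 2 / ε ^ 2) :=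
      ((contDiff_cutoff (n := 1)).differentiable one_ne_zero _).hasDerivAt
    have h2 : HasDerivAt (fun r : ℝ => r ^ 2 / ε ^ 2) (2 * x / ε ^ 2) x := by
      simpa using (hasDerivAt_pow 2 x).div_const (ε ^ 2)
    convert! ((h1.comp x h2).neg).div_const (2 * Real.pi) using 1
    field_simp
  have hz : ∀ x : ℝ, ε ≤ x → x ^ 2 / ε ^ 2 > 2 / 3 := by
    intro x hx
    rw [gt_iff_lt, lt_div_iff₀ (by positivity)]
    nlinarith
  have hint : IntegrableOn (fun r : ℝ => r * (-deriv cutoff (r ^ 2 / ε ^ 2) / (Real.pi * ε ^ 2)))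
      (Ioi 0) := by
    have hcont : Continuous fun r : ℝ => r * (-deriv cutoff (r ^ 2 / ε ^ 2) / (Real.pi * ε ^ 2)) := by
      have := (contDiff_deriv_cutoff (n := 0)).continuous
      fun_prop
    refine (hcont.integrable_of_hasCompactSupport ?_).integrableOn
    refine HasCompactSupport.intro (isCompact_Icc (a := -ε) (b := ε)) fun x hx => ?_
    have h2 : (2 : ℝ) / 3 < x ^ 2 / ε ^ 2 := by
      have hx' : ε < |x| := by
        by_contra h
        exact hx ⟨by linarith [neg_abs_le x], by linarith [le_abs_self x]⟩
      have := hz |x| hx'.le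
      rwa [sq_abs] at this
    simp [deriv_cutoff_of_gt h2]
  have hlim : Tendsto (fun r : ℝ => -cutoff (r ^ 2 / ε ^ 2) / (2 * Real.pi)) atTop (𝓝 0) := by
    refine tendsto_const_nhds.congr' ?_
    filter_upwards [eventually_ge_atTop ε] with x hx
    rw [cutoff_of_ge (hz x hx).le]; simp
  have hI := integral_Ioi_of_hasDerivAt_of_tendsto' (fun x _ => hd x) hint hlim
  rw [hI, cutoff_of_le (by norm_num)]
  simp
  rw [max_eq_left (by positivity)]
  field_simp
  norm_num

/-- A compactly supported primitive, with respect to `∂̄`, of a difference of two mollifiers. -/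
noncomputable def molPrimitive (δ ε : ℝ) (z : ℂ) : ℂ :=
  (Real.pi * z)⁻¹ * ((cutoff (Complex.normSq z / δ ^ 2) - cutoff (Complex.normSq z / ε ^ 2) : ℝ) : ℂ)

theorem eventually_molPrimitive_eq_zero {δ ε : ℝ} (hδ : 0 < δ) (hε : 0 < ε) :
    ∀ᶠ z in 𝓝 (0 : ℂ), molPrimitive δ ε z = 0 ∧ mol δ z = 0 ∧ mol ε z = 0 := by
  have h : ∀ r : ℝ, 0 < r → ∀ᶠ z in 𝓝 (0 : ℂ), Complex.normSq z / r ^ 2 < 1 / 3 := by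
    intro r hr
    have hc : Continuous fun z : ℂ => Complex.normSq z / r ^ 2 :=
      (contDiff_normSq (n := 0)).continuous.div_const _
    exact hc.continuousAt.eventually_lt_const (by simp)
  filter_upwards [h δ hδ, h ε hε] with z h1 h2
  refine ⟨?_, ?_, ?_⟩
  · rw [molPrimitive, cutoff_of_le h1.le, cutoff_of_le h2.le]; simp
  · simp only [mol, deriv_cutoff_of_lt h1]; simp
  · simp only [mol, deriv_cutoff_of_lt h2]; simp

/-- The pole of `1/(πz)` is harmless because both cutoffs equal `1` near the origin, so their
difference vanishes there. -/
theorem contDiff_molPrimitive {n : ℕ∞} {δ ε : ℝ} (hδ : 0 < δ) (hε : 0 < ε) :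
    ContDiff ℝ n (molPrimitive δ ε) := by
  rw [contDiff_iff_contDiffAt]
  intro z
  by_cases hz : z = 0
  · rw [hz]
    refine (contDiffAt_const (c := (0 : ℂ))).congr_of_eventuallyEq ?_
    filter_upwards [eventually_molPrimitive_eq_zero hδ hε] with w hw using hw.1
  · refine ContDiffAt.mul (ContDiffAt.inv (contDiffAt_const.mul contDiffAt_id) ?_) ?_
    · simpa using hz
    · refine Complex.ofRealCLM.contDiff.contDiffAt.comp z (ContDiff.contDiffAt ?_)
      exact (contDiff_cutoff.comp (contDiff_normSq.div_const _)).sub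
        (contDiff_cutoff.comp (contDiff_normSq.div_const _))

theorem molPrimitive_eq_zero {δ ε : ℝ} (hδ : 0 < δ) (hε : 0 < ε) {z : ℂ} (h : max δ ε ≤ ‖z‖) :
    molPrimitive δ ε z = 0 := by
  have : ∀ r : ℝ, 0 < r → r ≤ max δ ε → (2 : ℝ) / 3 ≤ Complex.normSq z / r ^ 2 := by
    intro r hr h'
    rw [Complex.normSq_eq_norm_sq, le_div_iff₀ (by positivity)]
    nlinarith
  rw [molPrimitive, cutoff_of_ge (this δ hδ (le_max_left _ _)),
    cutoff_of_ge (this ε hε (le_max_right _ _))]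
  simp

theorem delbar_normSq (z : ℂ) : delbar (fun w => (Complex.normSq w : ℂ)) z = z := by
  simp only [← Complex.mul_conj]
  rw [delbar_mul (f := fun w => w) (g := fun w => conj w) differentiableAt_id
      Complex.conjCLE.differentiableAt,
    delbar_conj (f := fun w => w) differentiableAt_id, delbar_eq_zero (f := fun w => w) differentiableAt_id]
  simp

/-- Away from the origin `1/(πz)` is holomorphic, so `∂̄` only hits the cutoffs; since `∂̄|z|² = z`,
the factor `1/z` cancels and leaves the mollifiers. -/
theorem delbar_molPrimitive {δ ε : ℝ} (hδ : 0 < δ) (hε : 0 < ε) (z : ℂ) :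
    delbar (molPrimitive δ ε) z = ((mol ε z - mol δ z : ℝ) : ℂ) := by
  by_cases hz : z = 0
  · have h := eventually_molPrimitive_eq_zero hδ hε
    rw [hz, h.self_of_nhds.2.1, h.self_of_nhds.2.2,
      delbar_congr (g := fun _ => 0) (h.mono fun w hw => hw.1), delbar_eq_zero (by fun_prop)]
    simp
  · have hpi : (Real.pi : ℂ) ≠ 0 := by exact_mod_cast Real.pi_ne_zero
    have hG : ∀ r : ℝ, HasDerivAt (fun s => cutoff (s / r ^ 2))
        (deriv cutoff (Complex.normSq z / r ^ 2) * (1 / r ^ 2)) (Complex.normSq z) := by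
      intro r
      have h1 : HasDerivAt cutoff (deriv cutoff (Complex.normSq z / r ^ 2))
          (Complex.normSq z / r ^ 2) :=
        ((contDiff_cutoff (n := 1)).differentiable one_ne_zero _).hasDerivAt
      exact HasDerivAt.comp (h₂ := cutoff) (h := fun s => s / r ^ 2) (Complex.normSq z) h1
        ((hasDerivAt_id (Complex.normSq z)).div_const (r ^ 2))
    have hn : DifferentiableAt ℝ (fun w : ℂ => Complex.normSq w) z :=
      (contDiff_normSq (n := 1)).differentiable one_ne_zero z
    have hinv : DifferentiableAt ℂ (fun w : ℂ => ((Real.pi : ℂ) * w)⁻¹) z :=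
      ((differentiableAt_id.const_mul _).inv (mul_ne_zero hpi hz))
    have hD := (hG δ).fun_sub (hG ε)
    have e := delbar_ofReal_comp hD hn
    unfold molPrimitive
    rw [delbar_mul (hinv.restrictScalars ℝ) ?_, delbar_eq_zero hinv, e, delbar_normSq]
    · simp only [mol]
      push_cast
      field_simp
      ring
    · exact Complex.ofRealCLM.differentiableAt.comp z
        ((hD.differentiableAt).comp z hn)

end Mollifier

/-! ### Weyl's lemma for `∂̄` -/

section Weyl

open scoped ContDiff Convolution

/-- A function `u` on the disc with `∂̄u = 0` in the sense of distributions. -/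
structure IsWeaklyHolomorphic (u : ℂ → ℂ) : Prop where
  locallyIntegrableOn : LocallyIntegrableOn u Disc
  integral_eq_zero : ∀ b : ℂ → ℂ, IsTest ∞ b → ∫ z, u z * delbar b z = 0

theorem integrable_mul_of_eq_zero_off_compact {u g : ℂ → ℂ} (hu : LocallyIntegrableOn u Disc)
    {S : Set ℂ} (hS : IsCompact S) (hSD : S ⊆ Disc) (hg : ContinuousOn g Disc)
    (h0 : ∀ z ∉ S, g z = 0) : Integrable fun z => u z * g z := by
  rw [← integrableOn_iff_integrable_of_support_subset (s := S)]
  · exact (hu.integrableOn_compact_subset hSD hS).mul_continuousOn (hg.mono hSD) hS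
  · intro z hz
    by_contra h
    exact hz (by simp [h0 z h])

theorem isWeaklyHolomorphic_of_differentiableOn {f : ℂ → ℂ} (hf : DifferentiableOn ℂ f Disc) :
    IsWeaklyHolomorphic f := by
  refine ⟨hf.continuousOn.locallyIntegrableOn measurableSet_ball, fun b hb => ?_⟩
  rw [integral_mul_delbar_test (contDiffOn_of_differentiableOn hf) (hb.of_le (by simp)),
    neg_eq_zero]
  refine integral_eq_zero_of_ae (Eventually.of_forall fun z => ?_)
  by_cases hz : z ∈ Disc
  · simp [delbar_eq_zero (hf.differentiableAt (disc_mem_nhds hz))]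
  · simp [hb.eq_zero fun h => hz (hb.tsupport_subset h)]

theorem delbar_comp_sub {f : ℂ → ℂ} (hf : Differentiable ℝ f) (z w : ℂ) :
    delbar (fun t => f (z - t)) w = -delbar f (z - w) := by
  have h : HasFDerivAt (fun t => f (z - t)) _ w :=
    (hf (z - w)).hasFDerivAt.comp w ((hasFDerivAt_id w).const_sub z)
  simp only [delbar, h.fderiv]
  simp
  ring

/-- The average of `u` over an annulus around `z`. -/
noncomputable def molAvg (u : ℂ → ℂ) (ε : ℝ) (z : ℂ) : ℂ := ∫ w, u w * (mol ε (z - w) : ℂ)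

theorem closedBall_subset_disc {z : ℂ} {r : ℝ} (h : ‖z‖ + r < 1) :
    Metric.closedBall z r ⊆ Disc := by
  intro w hw
  rw [Metric.mem_closedBall, dist_eq_norm] at hw
  rw [Metric.mem_ball, dist_zero_right]
  have := norm_add_le (w - z) z
  rw [sub_add_cancel] at this
  linarith

theorem isTest_comp_sub {E : Type*} [NormedAddCommGroup E] [NormedSpace ℝ E] {n : WithTop ℕ∞}
    {f : ℂ → E} (hf : ContDiff ℝ n f) {z : ℂ} {r : ℝ}
    (h0 : ∀ w, r ≤ ‖w‖ → f w = 0) (hr : ‖z‖ + r < 1) : IsTest n fun w => f (z - w) := by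
  refine isTest_of_eq_zero_off_compact (S := Metric.closedBall z r)
    (hf.comp (contDiff_const.sub contDiff_id)).contDiffOn
    (isCompact_closedBall z r) (closedBall_subset_disc hr) fun w hw => h0 _ ?_
  rw [Metric.mem_closedBall, dist_eq_norm, norm_sub_rev, not_le] at hw
  exact hw.le

theorem integrable_mul_mol {u : ℂ → ℂ} (hu : LocallyIntegrableOn u Disc) {z : ℂ} {ε : ℝ}
    (hε : 0 < ε) (h : ‖z‖ + ε < 1) : Integrable fun w => u w * (mol ε (z - w) : ℂ) := by
  refine integrable_mul_of_eq_zero_off_compact hu (isCompact_closedBall z ε)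
    (closedBall_subset_disc h) (Continuous.continuousOn ?_) fun w hw => ?_
  · have := (contDiff_mol (n := 0) ε).continuous
    fun_prop
  · rw [Metric.mem_closedBall, dist_eq_norm, norm_sub_rev, not_le] at hw
    simp [mol_eq_zero hε hw.le]

/-- The difference of the two mollifiers is `∂̄` of a test function, namely the translated
reflection of `molPrimitive δ ε`, up to sign. A weakly holomorphic function integrates to zero
against it. -/
theorem IsWeaklyHolomorphic.molAvg_eq {u : ℂ → ℂ} (hu : IsWeaklyHolomorphic u) {z : ℂ} {δ ε : ℝ}
    (hδ : 0 < δ) (hε : 0 < ε) (h1 : ‖z‖ + δ < 1) (h2 : ‖z‖ + ε < 1) :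
    molAvg u δ z = molAvg u ε z := by
  have ht : IsTest ∞ fun w => molPrimitive δ ε (z - w) := by
    refine isTest_comp_sub (contDiff_molPrimitive (n := ⊤) hδ hε) (r := max δ ε)
      (fun w hw => molPrimitive_eq_zero hδ hε hw) ?_
    rcases max_cases δ ε with h | h <;> rw [h.1] <;> assumption
  have h := hu.integral_eq_zero _ ht
  simp only [delbar_comp_sub
    ((contDiff_molPrimitive (n := 1) hδ hε).differentiable (by simp)), delbar_molPrimitive hδ hε] at h
  rw [← sub_eq_zero, molAvg, molAvg, ← integral_sub (integrable_mul_mol hu.1 hδ h1)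
    (integrable_mul_mol hu.1 hε h2), ← h]
  congr 1
  ext w
  push_cast
  ring

theorem molAvg_indicator {u : ℂ → ℂ} {S : Set ℂ} {z : ℂ} {ε : ℝ} (hε : 0 < ε)
    (h : Metric.closedBall z ε ⊆ S) : molAvg (S.indicator u) ε z = molAvg u ε z := by
  refine integral_congr_ae (Eventually.of_forall fun w => ?_)
  by_cases hw : w ∈ S
  · simp [indicator_of_mem hw]
  · have : w ∉ Metric.closedBall z ε := fun h' => hw (h h')
    rw [Metric.mem_closedBall, dist_eq_norm, norm_sub_rev, not_le] at this
    simp [mol_eq_zero hε this.le]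

/-- In the convolution the derivative falls on the mollifier, so `∂̄` of the average is, up to sign,
`u` integrated against `∂̄` of a test function, hence zero; the Cauchy–Riemann equations then give
complex differentiability. -/
theorem IsWeaklyHolomorphic.differentiableAt_molAvg {u : ℂ → ℂ} (hu : IsWeaklyHolomorphic u)
    {z : ℂ} {ε : ℝ} (hε : 0 < ε) (h : ‖z‖ + ε < 1) : DifferentiableAt ℂ (molAvg u ε) z := by
  -- Half of the remaining gap: discs of radius `ε` centred within `ρ` of `z` stay in `S`, so `u`
  -- may be replaced near `z` by its globally integrable cut-off `v`.
  set ρ := (1 - ‖z‖ - ε) / 2 with hρ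
  have hρ0 : 0 < ρ := by rw [hρ]; linarith
  set S := Metric.closedBall (0 : ℂ) (1 - ρ) with hS
  have hSD : S ⊆ Disc := by
    rw [hS]; exact Metric.closedBall_subset_ball (by linarith)
  set v := S.indicator u with hv
  have hvi : Integrable v := by
    rw [hv, integrable_indicator_iff measurableSet_closedBall]
    exact hu.1.integrableOn_compact_subset hSD (isCompact_closedBall _ _)
  have hev : molAvg u ε =ᶠ[𝓝 z] molAvg v ε := by
    filter_upwards [Metric.ball_mem_nhds z hρ0] with w hw
    refine (molAvg_indicator hε fun t ht => ?_).symm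
    rw [Metric.mem_ball, dist_eq_norm] at hw
    rw [Metric.mem_closedBall, dist_eq_norm] at ht
    rw [hS, Metric.mem_closedBall, dist_zero_right]
    have h1 := norm_add_le (t - w) w
    have h2 := norm_add_le (w - z) z
    rw [sub_add_cancel] at h1 h2
    linarith
  refine DifferentiableAt.congr_of_eventuallyEq ?_ hev
  set m : ℂ → ℂ := fun w => (mol ε w : ℂ) with hm
  have hmc : ContDiff ℝ 1 m := Complex.ofRealCLM.contDiff.comp (contDiff_mol (n := 1) ε)
  have hms : HasCompactSupport m :=
    HasCompactSupport.intro (isCompact_closedBall (0 : ℂ) ε) fun w hw => by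
      rw [Metric.mem_closedBall, dist_zero_right, not_le] at hw
      simp [hm, mol_eq_zero hε hw.le]
  have hconv : molAvg v ε = v ⋆[ContinuousLinearMap.mul ℝ ℂ, volume] m := by
    ext w; rfl
  have hfd := hms.hasFDerivAt_convolution_right (ContinuousLinearMap.mul ℝ ℂ)
    hvi.locallyIntegrable hmc z
  rw [← hconv] at hfd
  refine differentiableAt_complex_of_delbar_eq_zero hfd.differentiableAt ?_
  have hap : ∀ x : ℂ, fderiv ℝ (molAvg v ε) z x = ∫ t, v t * fderiv ℝ m (z - t) x := by
    intro x
    rw [hfd.fderiv, convolution_precompR_apply _ hvi.locallyIntegrable (hms.fderiv ℝ)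
      (hmc.continuous_fderiv one_ne_zero)]
    rfl
  have hint : ∀ x : ℂ, Integrable fun t => v t * fderiv ℝ m (z - t) x := by
    intro x
    have hc : Continuous fun t => fderiv ℝ m (z - t) x :=
      ((hmc.continuous_fderiv one_ne_zero).comp (continuous_const.sub continuous_id)).clm_apply
        continuous_const
    have hloc : LocallyIntegrableOn v Disc := hvi.locallyIntegrable.locallyIntegrableOn _
    refine integrable_mul_of_eq_zero_off_compact hloc (isCompact_closedBall z ε)
      (closedBall_subset_disc h) hc.continuousOn fun w hw => ?_
    rw [fderiv_of_notMem_tsupport ℝ]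
    · simp
    · intro hmem
      have hsub : tsupport m ⊆ Metric.closedBall 0 ε := by
        refine closure_minimal (fun t ht => ?_) Metric.isClosed_closedBall
        rw [Metric.mem_closedBall, dist_zero_right]
        by_contra hlt
        exact ht (by simp [hm, mol_eq_zero hε (not_le.1 hlt).le])
      have := hsub hmem
      rw [Metric.mem_closedBall, dist_zero_right] at this
      exact hw (by rwa [Metric.mem_closedBall, dist_eq_norm, norm_sub_rev])
  have hD : delbar (molAvg v ε) z = ∫ t, v t * delbar m (z - t) := by
    have : ∀ t, v t * delbar m (z - t) = 1 / 2 * (v t * fderiv ℝ m (z - t) 1 +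
        Complex.I * (v t * fderiv ℝ m (z - t) Complex.I)) := fun t => by
      simp only [delbar]; ring
    simp only [this]
    rw [integral_const_mul, integral_add (hint _) ((hint _).const_mul _), integral_const_mul,
      ← hap, ← hap, delbar]
  have htest : IsTest ∞ fun w => m (z - w) := by
    refine isTest_comp_sub (Complex.ofRealCLM.contDiff.comp (contDiff_mol (n := ⊤) ε)) (r := ε)
      (fun w hw => ?_) h
    simp [mol_eq_zero hε hw]
  have h0 := hu.integral_eq_zero _ htest
  simp only [delbar_comp_sub (hmc.differentiable one_ne_zero), mul_neg, integral_neg, neg_eq_zero] at h0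
  rw [hD, ← h0]
  refine integral_congr_ae (Eventually.of_forall fun t => ?_)
  by_cases ht : t ∈ S
  · simp [hv, indicator_of_mem ht]
  · have : delbar (fun w => m (z - w)) t = 0 := by
      refine delbar_of_notMem_tsupport fun hmem => ht ?_
      have hsub : tsupport (fun w => m (z - w)) ⊆ Metric.closedBall z ε := by
        refine closure_minimal (fun w hw => ?_) Metric.isClosed_closedBall
        rw [Metric.mem_closedBall, dist_eq_norm, norm_sub_rev]
        by_contra hlt
        exact hw (by simp [hm, mol_eq_zero hε (not_le.1 hlt).le])
      have h3 := hsub hmem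
      rw [Metric.mem_closedBall, dist_eq_norm] at h3
      rw [hS, Metric.mem_closedBall, dist_zero_right]
      have h1 := norm_add_le (t - z) z
      rw [sub_add_cancel] at h1
      linarith
    rw [delbar_comp_sub (hmc.differentiable one_ne_zero), neg_eq_zero] at this
    simp [this]

/-- Lebesgue's differentiation theorem applies: the mollifier has integral `1`, is supported in a
disc of radius `ε`, and is bounded by a constant over the area of that disc. -/
theorem tendsto_molAvg_ae {u : ℂ → ℂ} (hu : LocallyIntegrable u) :
    ∀ᵐ z, Tendsto (fun n : ℕ => molAvg u (1 / (n + 1)) z) atTop (𝓝 (u z)) := by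
  obtain ⟨B, hB0, hB⟩ := exists_deriv_cutoff_bound
  filter_upwards [IsUnifLocDoublingMeasure.ae_tendsto_average_norm_sub volume hu 1] with z hz
  have hpos : ∀ n : ℕ, (0 : ℝ) < 1 / (n + 1) := fun n => by positivity
  have hlim : Tendsto (fun n : ℕ => (1 : ℝ) / (n + 1)) atTop (𝓝[>] 0) :=
    tendsto_nhdsWithin_iff.2 ⟨tendsto_one_div_add_atTop_nhds_zero_nat,
      Eventually.of_forall fun n => hpos n⟩
  have h1 := hz (l := atTop) (fun _ : ℕ => z) (fun n : ℕ => (1 : ℝ) / (n + 1)) hlim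
    (Eventually.of_forall fun n => by simpa using (hpos n).le)
  have h2 := tendsto_integral_smul_of_tendsto_average_norm_sub (μ := volume)
    (g := fun (n : ℕ) w => mol (1 / (n + 1)) (z - w)) B h1
    (Eventually.of_forall fun n => hu.integrableOn_isCompact (isCompact_closedBall _ _))
    (tendsto_const_nhds.congr fun n => ?_) (Eventually.of_forall fun n w hw => ?_)
    (Eventually.of_forall fun n w => ?_)
  · refine h2.congr fun n => ?_
    refine integral_congr_ae (Eventually.of_forall fun w => ?_)
    simp only [Complex.real_smul]
    ring
  · rw [integral_sub_left_eq_self (mol (1 / (n + 1))) volume z, integral_mol (hpos n)]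
  · by_contra h
    rw [Metric.mem_closedBall, dist_eq_norm, norm_sub_rev, not_le] at h
    exact hw (mol_eq_zero (hpos n) h.le)
  · refine (abs_mol_le hB _ _).trans_eq ?_
    rw [Measure.real, Complex.volume_closedBall]
    simp only [ENNReal.toReal_mul, ENNReal.toReal_pow, ENNReal.toReal_ofReal (hpos n).le]
    simp [mul_comm]

/-- The holomorphic representative of a weakly holomorphic function. -/
noncomputable def weylRep (u : ℂ → ℂ) (z : ℂ) : ℂ := molAvg u ((1 - ‖z‖) / 2) z

theorem IsWeaklyHolomorphic.weylRep_eq {u : ℂ → ℂ} (hu : IsWeaklyHolomorphic u) {z : ℂ} {ε : ℝ}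
    (hε : 0 < ε) (h : ‖z‖ + ε < 1) : weylRep u z = molAvg u ε z :=
  hu.molAvg_eq (by linarith) hε (by linarith) h

theorem IsWeaklyHolomorphic.differentiableOn_weylRep {u : ℂ → ℂ} (hu : IsWeaklyHolomorphic u) :
    DifferentiableOn ℂ (weylRep u) Disc := by
  intro z hz
  rw [Metric.mem_ball, dist_zero_right] at hz
  refine DifferentiableAt.differentiableWithinAt ?_
  -- The radius in `weylRep` moves with the point. Averages do not depend on the radius, so near `z`
  -- this fixed one serves.
  have h0 : 0 < (1 - ‖z‖) / 4 := by linarith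
  refine (hu.differentiableAt_molAvg h0 (by linarith)).congr_of_eventuallyEq ?_
  filter_upwards [Metric.ball_mem_nhds z h0] with w hw
  refine hu.weylRep_eq h0 ?_
  rw [Metric.mem_ball, dist_eq_norm] at hw
  have h1 := norm_add_le (w - z) z
  rw [sub_add_cancel] at h1
  linarith

/-- **Weyl's lemma** for `∂̄`: a weakly holomorphic function agrees almost everywhere with a
holomorphic one. -/
theorem IsWeaklyHolomorphic.ae_eq_weylRep {u : ℂ → ℂ} (hu : IsWeaklyHolomorphic u) :
    ∀ᵐ z, z ∈ Disc → u z = weylRep u z := by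
  have hS : ∀ n : ℕ, Metric.closedBall (0 : ℂ) (1 - 1 / (n + 1)) ⊆ Disc := fun n =>
    Metric.closedBall_subset_ball (by have : (0 : ℝ) < 1 / (n + 1) := by positivity
                                      linarith)
  have hae : ∀ᵐ z, ∀ n : ℕ, Tendsto (fun k : ℕ =>
      molAvg ((Metric.closedBall (0 : ℂ) (1 - 1 / (n + 1))).indicator u) (1 / (k + 1)) z) atTop
      (𝓝 ((Metric.closedBall (0 : ℂ) (1 - 1 / (n + 1))).indicator u z)) := by
    refine ae_all_iff.2 fun n => tendsto_molAvg_ae (Integrable.locallyIntegrable ?_)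
    rw [integrable_indicator_iff measurableSet_closedBall]
    exact hu.1.integrableOn_compact_subset (hS n) (isCompact_closedBall _ _)
  filter_upwards [hae] with z hz hzD
  rw [Metric.mem_ball, dist_zero_right] at hzD
  have hd : 0 < (1 - ‖z‖) / 2 := by linarith
  obtain ⟨n, hn⟩ := exists_nat_one_div_lt hd
  have hlim := hz n
  have hzS : z ∈ Metric.closedBall (0 : ℂ) (1 - 1 / (n + 1)) := by
    rw [Metric.mem_closedBall, dist_zero_right]; linarith
  rw [indicator_of_mem hzS] at hlim
  refine tendsto_nhds_unique hlim (tendsto_const_nhds.congr' ?_)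
  filter_upwards [tendsto_one_div_add_atTop_nhds_zero_nat.eventually_lt_const hd] with k hk
  have hk0 : (0 : ℝ) < 1 / (k + 1) := by positivity
  rw [molAvg_indicator hk0, hu.weylRep_eq hk0 (by linarith)]
  intro w hw
  rw [Metric.mem_closedBall, dist_eq_norm] at hw
  rw [Metric.mem_closedBall, dist_zero_right]
  have h1 := norm_add_le (w - z) z
  rw [sub_add_cancel] at h1
  linarith

/-- The mean value property of holomorphic functions for the mollifiers. -/
theorem molAvg_eq_of_differentiableOn {f : ℂ → ℂ} (hf : DifferentiableOn ℂ f Disc) {z : ℂ} {ε : ℝ}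
    (hε : 0 < ε) (h : ‖z‖ + ε < 1) : molAvg f ε z = f z := by
  have hu := isWeaklyHolomorphic_of_differentiableOn hf
  rw [← hu.weylRep_eq hε h]
  -- The average is the value of `weylRep f`, which is continuous and equals the continuous `f`
  -- almost everywhere, hence everywhere on the disc.
  have hae : f =ᵐ[volume.restrict Disc] weylRep f :=
    (ae_restrict_iff' measurableSet_ball).2 hu.ae_eq_weylRep
  have hz : z ∈ Disc := by rw [Metric.mem_ball, dist_zero_right]; linarith
  exact (Measure.eqOn_open_of_ae_eq hae isOpen_disc hf.continuousOn
    hu.differentiableOn_weylRep.continuousOn hz).symm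

end Weyl

/-! ### The commutator inequality for `∂̄` -/

section BasicEstimate

theorem fderiv_ofReal {u : ℂ → ℝ} {z : ℂ} (hu : DifferentiableAt ℝ u z) (v : ℂ) :
    fderiv ℝ (fun w => (u w : ℂ)) z v = (fderiv ℝ u z v : ℂ) := by
  have h : HasFDerivAt (fun w => (u w : ℂ)) _ z :=
    Complex.ofRealCLM.hasFDerivAt.comp z hu.hasFDerivAt
  rw [h.fderiv]
  rfl

theorem delbar_ofReal {u : ℂ → ℝ} {z : ℂ} (hu : DifferentiableAt ℝ u z) :
    delbar (fun w => (u w : ℂ)) z =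
      1 / 2 * ((fderiv ℝ u z 1 : ℂ) + Complex.I * (fderiv ℝ u z Complex.I : ℂ)) := by
  rw [delbar, fderiv_ofReal hu, fderiv_ofReal hu]

theorem norm_del_ofReal {u : ℂ → ℝ} {z : ℂ} (hu : DifferentiableAt ℝ u z) :
    ‖del (fun w => (u w : ℂ)) z‖ = ‖delbar (fun w => (u w : ℂ)) z‖ := by
  rw [delbar_ofReal hu, del, fderiv_ofReal hu, fderiv_ofReal hu, ← RCLike.norm_conj]
  simp

/-- The mixed second derivatives only enter the imaginary part, which `lap` discards, so their
symmetry plays no role here. -/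
theorem lap_eq {u : ℂ → ℝ} (hu : ContDiffOn ℝ 2 u Disc) {z : ℂ} (hz : z ∈ Disc) :
    lap u z = (fderiv ℝ (fun w => fderiv ℝ u w 1) z 1 +
      fderiv ℝ (fun w => fderiv ℝ u w Complex.I) z Complex.I) / 4 := by
  have hev : delbar (fun w => (u w : ℂ)) =ᶠ[𝓝 z] fun w =>
      1 / 2 * ((fderiv ℝ u w 1 : ℂ) + Complex.I * (fderiv ℝ u w Complex.I : ℂ)) := by
    filter_upwards [disc_mem_nhds hz] with w hw
    exact delbar_ofReal (differentiableAt_of_contDiffOn (hu.of_le (by norm_num)) hw)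
  have hd : ∀ v, DifferentiableAt ℝ (fun w => fderiv ℝ u w v) z := fun v =>
    differentiableAt_of_contDiffOn (contDiffOn_fderiv_apply hu (by norm_num) v) hz
  have hd' : ∀ v, HasFDerivAt (fun w => (fderiv ℝ u w v : ℂ)) _ z := fun v =>
    Complex.ofRealCLM.hasFDerivAt.comp z (hd v).hasFDerivAt
  have h := ((hd' 1).fun_add ((hd' Complex.I).const_mul Complex.I)).const_mul (1 / 2 : ℂ)
  rw [lap, del, hev.fderiv_eq, h.fderiv]
  simp
  ring

theorem continuousOn_lap {u : ℂ → ℝ} (hu : ContDiffOn ℝ 2 u Disc) : ContinuousOn (lap u) Disc := by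
  have h : ∀ v, ContinuousOn (fun z => fderiv ℝ (fun w => fderiv ℝ u w v) z v) Disc := fun v =>
    (contDiffOn_fderiv_apply (m := 0)
      (contDiffOn_fderiv_apply (m := 1) hu (by norm_num) v) (by simp) v).continuousOn
  exact (((h 1).add (h Complex.I)).div_const 4).congr fun z hz => lap_eq hu hz

theorem lap_add_const_mul {u v : ℂ → ℝ} (hu : ContDiffOn ℝ 2 u Disc) (hv : ContDiffOn ℝ 2 v Disc)
    (c : ℝ) {z : ℂ} (hz : z ∈ Disc) : lap (fun w => u w + c * v w) z = lap u z + c * lap v z := by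
  have hd : ∀ {f : ℂ → ℝ}, ContDiffOn ℝ 2 f Disc → ∀ w ∈ Disc, DifferentiableAt ℝ f w :=
    fun hf w hw => differentiableAt_of_contDiffOn (hf.of_le (by norm_num)) hw
  have hd2 : ∀ {f : ℂ → ℝ}, ContDiffOn ℝ 2 f Disc → ∀ v,
      DifferentiableAt ℝ (fun w => fderiv ℝ f w v) z := fun hf v =>
    differentiableAt_of_contDiffOn (contDiffOn_fderiv_apply hf (by norm_num) v) hz
  have key : ∀ x, fderiv ℝ (fun w => fderiv ℝ (fun w => u w + c * v w) w x) z x =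
      fderiv ℝ (fun w => fderiv ℝ u w x) z x + c * fderiv ℝ (fun w => fderiv ℝ v w x) z x := by
    intro x
    have hev : (fun w => fderiv ℝ (fun w => u w + c * v w) w x) =ᶠ[𝓝 z]
        fun w => fderiv ℝ u w x + c * fderiv ℝ v w x := by
      filter_upwards [disc_mem_nhds hz] with w hw
      rw [fderiv_fun_add (hd hu w hw) ((hd hv w hw).const_mul c), fderiv_const_mul (hd hv w hw)]
      rfl
    rw [hev.fderiv_eq, fderiv_fun_add (hd2 hu x) ((hd2 hv x).const_mul c),
      fderiv_const_mul (hd2 hv x)]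
    rfl
  rw [lap_eq (hu.add (contDiffOn_const.mul hv)) hz, lap_eq hu hz, lap_eq hv hz]
  simp only [key]
  ring

/-- The Jacobian is a divergence, by symmetry of second derivatives. For `g = a + ib` the integrand
is `|∂̄g|² - |∂g|²`, so this lets `∂g` be traded for `∂̄g` in `L²`. -/
theorem integral_jacobian_eq_zero {a b : ℂ → ℝ} (ha : IsTest 2 a) (hb : IsTest 2 b) :
    ∫ z, (fderiv ℝ a z Complex.I * fderiv ℝ b z 1 - fderiv ℝ a z 1 * fderiv ℝ b z Complex.I) = 0 := by
  have hca : ∀ v, ContDiffOn ℝ 1 (fun z => fderiv ℝ a z v) Disc := fun v =>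
    contDiffOn_fderiv_apply ha.contDiff.contDiffOn (by norm_num) v
  have hcb : ∀ v, ContDiffOn ℝ 1 (fun z => fderiv ℝ b z v) Disc := fun v =>
    contDiffOn_fderiv_apply hb.contDiff.contDiffOn (by norm_num) v
  have hi : ∀ v w, Integrable fun z => fderiv ℝ a z v * fderiv ℝ b z w := fun v w =>
    ha.integrable ((hca v).continuousOn.mul (hcb w).continuousOn) fun z hz => by
      rw [fderiv_of_notMem_tsupport ℝ hz]; simp
  rw [integral_sub (hi _ _) (hi _ _), integral_mul_fderiv_test (hca _) (hb.of_le (by norm_num)),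
    integral_mul_fderiv_test (hca _) (hb.of_le (by norm_num)), sub_eq_zero]
  congr 2
  ext z
  have hsym : IsSymmSndFDerivAt ℝ a z :=
    ha.contDiff.contDiffAt.isSymmSndFDerivAt (by simp)
  have hd : DifferentiableAt ℝ (fderiv ℝ a) z :=
    (ha.contDiff.fderiv_right (m := 1) (by norm_num)).differentiable one_ne_zero z
  have e : ∀ v w, fderiv ℝ (fun z => fderiv ℝ a z v) z w = fderiv ℝ (fderiv ℝ a) z w v := by
    intro v w
    have := hd.hasFDerivAt.clm_apply (hasFDerivAt_const v z)
    rw [this.fderiv]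
    simp
  rw [e, e, hsym]

theorem IsTest.clm {E F : Type*} [NormedAddCommGroup E] [NormedSpace ℝ E] [NormedAddCommGroup F]
    [NormedSpace ℝ F] {n : WithTop ℕ∞} {b : ℂ → E} (hb : IsTest n b) (L : E →L[ℝ] F) :
    IsTest n fun z => L (b z) :=
  isTest_of_eq_zero_off_compact (L.contDiff.comp hb.contDiff).contDiffOn hb.hasCompactSupport
    hb.tsupport_subset fun z hz => by rw [hb.eq_zero hz, map_zero]

/-- The basic inequality behind Hörmander's `L²` estimates for `∂̄`. -/
theorem integral_lap_mul_le {Φ : ℂ → ℝ} (hΦ : ContDiffOn ℝ 2 Φ Disc) {g : ℂ → ℂ}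
    (hg : IsTest 2 g) :
    ∫ z, lap Φ z * ‖g z‖ ^ 2 ≤ ∫ z, ‖delbar g z - g z * delbar (fun w => (Φ w : ℂ)) z / 2‖ ^ 2 := by
  set a : ℂ → ℝ := fun z => (g z).re with ha
  set b : ℂ → ℝ := fun z => (g z).im with hb
  have hta : IsTest 2 a := hg.clm Complex.reCLM
  have htb : IsTest 2 b := hg.clm Complex.imCLM
  set s : ℂ → ℝ := fun z => a z ^ 2 + b z ^ 2 with hs
  have hts : IsTest 2 s :=
    isTest_of_eq_zero_off_compact ((hta.contDiff.pow 2).add (htb.contDiff.pow 2)).contDiffOn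
      hg.hasCompactSupport hg.tsupport_subset fun z hz => by simp [hs, ha, hb, hg.eq_zero hz]
  have hsg : ∀ z, ‖g z‖ ^ 2 = s z := fun z => by
    rw [Complex.sq_norm, Complex.normSq_apply]; simp only [hs, ha, hb]; ring
  have hcΦ : ∀ v, ContDiffOn ℝ 1 (fun z => fderiv ℝ Φ z v) Disc := fun v =>
    contDiffOn_fderiv_apply hΦ (by norm_num) v
  have hcs : ∀ v, ContinuousOn (fun z => fderiv ℝ s z v) Disc := fun v =>
    (contDiffOn_fderiv_apply (m := 0) (hts.contDiff.contDiffOn (n := 2)) (by norm_num) v).continuousOn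
  have hcΦ2 : ∀ v, ContinuousOn (fun z => fderiv ℝ (fun w => fderiv ℝ Φ w v) z v) Disc := fun v =>
    (contDiffOn_fderiv_apply (m := 0) (hcΦ v) (by simp) v).continuousOn
  have hI1 : ∀ v, Integrable fun z => fderiv ℝ Φ z v * fderiv ℝ s z v := fun v =>
    hts.integrable ((hcΦ v).continuousOn.mul (hcs v)) fun z hz => by
      rw [fderiv_of_notMem_tsupport ℝ hz]; simp
  have hI2 : ∀ v, Integrable fun z => fderiv ℝ (fun w => fderiv ℝ Φ w v) z v * s z := fun v =>
    hts.integrable ((hcΦ2 v).mul hts.contDiff.continuous.continuousOn) fun z hz => by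
      rw [hts.eq_zero hz, mul_zero]
  have hibp := fun v => integral_mul_fderiv_test (hcΦ v) (hts.of_le (by norm_num)) v
  have hlap : ∫ z, lap Φ z * ‖g z‖ ^ 2 =
      ∫ z, -(1 / 4) * (fderiv ℝ Φ z 1 * fderiv ℝ s z 1 +
        fderiv ℝ Φ z Complex.I * fderiv ℝ s z Complex.I) := by
    have : ∫ z, lap Φ z * ‖g z‖ ^ 2 = ∫ z, 1 / 4 * (fderiv ℝ (fun w => fderiv ℝ Φ w 1) z 1 * s z +
        fderiv ℝ (fun w => fderiv ℝ Φ w Complex.I) z Complex.I * s z) := by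
      refine integral_congr_ae (Eventually.of_forall fun z => ?_)
      simp only [hsg]
      by_cases hz : z ∈ Disc
      · rw [lap_eq hΦ hz]; ring
      · rw [hts.eq_zero fun h => hz (hts.tsupport_subset h)]; simp
    rw [this, integral_const_mul, integral_const_mul, integral_add (hI2 _) (hI2 _),
      integral_add (hI1 _) (hI1 _), hibp, hibp]
    ring
  have hcd : ∀ (f : ℂ → ℝ), IsTest 2 f → ∀ v, ContinuousOn (fun z => fderiv ℝ f z v) Disc :=
    fun f hf v => (contDiffOn_fderiv_apply (m := 0) (hf.contDiff.contDiffOn (n := 2))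
      (by norm_num) v).continuousOn
  have hJint : Integrable fun z =>
      fderiv ℝ a z Complex.I * fderiv ℝ b z 1 - fderiv ℝ a z 1 * fderiv ℝ b z Complex.I :=
    hta.integrable (((hcd a hta _).mul (hcd b htb _)).sub ((hcd a hta _).mul (hcd b htb _)))
      fun z hz => by simp [fderiv_of_notMem_tsupport ℝ hz]
  have hLint : Integrable fun z => -(1 / 4) * (fderiv ℝ Φ z 1 * fderiv ℝ s z 1 +
        fderiv ℝ Φ z Complex.I * fderiv ℝ s z Complex.I) :=
    ((hI1 _).add (hI1 _)).const_mul _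
  have hdΦ : ContinuousOn (delbar fun w => (Φ w : ℂ)) Disc :=
    continuousOn_delbar ((contDiffOn_ofReal hΦ).of_le (by norm_num))
  have hRint : Integrable fun z => ‖delbar g z - g z * delbar (fun w => (Φ w : ℂ)) z / 2‖ ^ 2 :=
    hg.integrable ((((hg.of_le (m := 1) (by norm_num)).continuousOn_delbar.sub
      ((hg.contDiff.continuous.continuousOn.mul hdΦ).div_const 2)).norm).pow 2) fun z hz => by
        rw [hg.eq_zero hz, delbar_of_notMem_tsupport hz]; simp
  -- Adding the Jacobian, which has integral zero, makes the inequality pointwise: the right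
  -- integrand exceeds the left one by exactly `|∂g + g ∂Φ / 2|²`.
  have hsum := integral_add hLint hJint
  rw [integral_jacobian_eq_zero hta htb, add_zero] at hsum
  rw [hlap, ← hsum]
  refine integral_mono (hLint.add hJint) hRint fun z => ?_
  by_cases hz : z ∈ Disc
  swap
  · have hz' : z ∉ tsupport g := fun h => hz (hg.tsupport_subset h)
    have hzs : z ∉ tsupport s := fun h => hz (hts.tsupport_subset h)
    have hza : z ∉ tsupport a := fun h => hz (hta.tsupport_subset h)
    simp only [fderiv_of_notMem_tsupport ℝ hzs, fderiv_of_notMem_tsupport ℝ hza]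
    simp only [zero_apply, mul_zero, zero_mul, add_zero, sub_zero]
    positivity
  have hdg : DifferentiableAt ℝ g z := hg.contDiff.differentiable (by norm_num) z
  have hda : ∀ v, fderiv ℝ a z v = (fderiv ℝ g z v).re := fun v => by
    have h : HasFDerivAt a _ z := Complex.reCLM.hasFDerivAt.comp z hdg.hasFDerivAt
    rw [h.fderiv]; rfl
  have hdb : ∀ v, fderiv ℝ b z v = (fderiv ℝ g z v).im := fun v => by
    have h : HasFDerivAt b _ z := Complex.imCLM.hasFDerivAt.comp z hdg.hasFDerivAt
    rw [h.fderiv]; rfl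
  have hds : ∀ v, fderiv ℝ s z v = 2 * (a z * fderiv ℝ a z v + b z * fderiv ℝ b z v) := fun v => by
    have h1 := (hta.contDiff.differentiable (by norm_num) z).hasFDerivAt
    have h2 := (htb.contDiff.differentiable (by norm_num) z).hasFDerivAt
    have h : HasFDerivAt s _ z := (h1.pow 2).add (h2.pow 2)
    rw [h.fderiv]
    simp
    ring
  have hΦd : DifferentiableAt ℝ Φ z := differentiableAt_of_contDiffOn (hΦ.of_le (by norm_num)) hz
  simp only [hds, hda, hdb, delbar_ofReal hΦd]
  rw [delbar, Complex.sq_norm, Complex.normSq_apply]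
  simp only [ha, hb]
  generalize fderiv ℝ g z 1 = p
  generalize fderiv ℝ g z Complex.I = q
  generalize fderiv ℝ Φ z 1 = X
  generalize fderiv ℝ Φ z Complex.I = Y
  generalize g z = γ
  simp
  -- The two squares are those of the real and imaginary parts of `2∂g + g ∂Φ`.
  nlinarith [sq_nonneg (p.re + q.im + (γ.re * X + γ.im * Y) / 2),
    sq_nonneg (p.im - q.re + (γ.im * X - γ.re * Y) / 2)]

end BasicEstimate

/-! ### Donnelly–Fefferman type estimates for weights in `W*` -/

section Estimate

/-- A weighted a priori estimate for `∂̄` on test functions. -/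
def HasDelbarEstimate (w L : ℂ → ℝ) (C : ℝ) : Prop :=
  ∀ b : ℂ → ℂ, IsTest 2 b → ∫ z, L z * ‖b z‖ ^ 2 / w z ≤ C * ∫ z, ‖delbar b z‖ ^ 2 / w z

theorem norm_sub_sq_le {ε : ℝ} (hε : 0 < ε) (x y : ℂ) :
    ‖x - y‖ ^ 2 ≤ (1 + 1 / ε) * ‖x‖ ^ 2 + (1 + ε) * ‖y‖ ^ 2 := by
  have h1 : ‖x - y‖ ^ 2 ≤ (‖x‖ + ‖y‖) ^ 2 := by
    gcongr
    exact norm_sub_le x y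
  have h2 : 0 ≤ (‖x‖ - ε * ‖y‖) ^ 2 / ε := by positivity
  have h3 : (‖x‖ - ε * ‖y‖) ^ 2 / ε = 1 / ε * ‖x‖ ^ 2 - 2 * ‖x‖ * ‖y‖ + ε * ‖y‖ ^ 2 := by
    field_simp
    ring
  nlinarith

theorem IsTest.integrable_mul_sq_div {b : ℂ → ℂ} (hb : IsTest 1 b) {L w : ℂ → ℝ}
    (hL : ContinuousOn L Disc) (hw : ContinuousOn w Disc) (hpos : ∀ z ∈ Disc, 0 < w z) :
    Integrable fun z => L z * ‖b z‖ ^ 2 / w z :=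
  hb.integrable ((hL.mul (hb.contDiff.continuous.norm.pow 2).continuousOn).div hw
    fun z hz => (hpos z hz).ne') fun z hz => by rw [hb.eq_zero hz]; simp

theorem IsTest.integrable_delbar_sq_div {b : ℂ → ℂ} (hb : IsTest 1 b) {w : ℂ → ℝ}
    (hw : ContinuousOn w Disc) (hpos : ∀ z ∈ Disc, 0 < w z) :
    Integrable fun z => ‖delbar b z‖ ^ 2 / w z :=
  hb.integrable ((hb.continuousOn_delbar.norm.pow 2).div hw
    fun z hz => (hpos z hz).ne') fun z hz => by rw [delbar_of_notMem_tsupport hz]; simp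

/-- A Donnelly–Fefferman type estimate: the Laplacian of the potential is helped by an auxiliary
function with small gradient. -/
theorem exists_hasDelbarEstimate {w p ψ L : ℂ → ℝ} (hw : ∀ z ∈ Disc, Real.exp (p z) = 1 / w z)
    (hpos : ∀ z ∈ Disc, 0 < w z)
    (hp : ContDiffOn ℝ 2 p Disc) (hψ : ContDiffOn ℝ 2 ψ Disc) (hL : ContinuousOn L Disc)
    {a b : ℝ} (ha : 0 ≤ a) (hab : a < b)
    (h1 : ∀ z ∈ Disc, ‖delbar (fun w => (ψ w : ℂ)) z‖ ^ 2 ≤ a * L z)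
    (h2 : ∀ z ∈ Disc, b * L z ≤ lap p z + 2 * lap ψ z) :
    ∃ C : ℝ, 0 < C ∧ HasDelbarEstimate w L C := by
  -- This `ε` is the weight in the inequality for `‖x - y‖²`; the strict gap `a < b` leaves room to
  -- absorb the gradient term.
  obtain ⟨ε, hε, hεb⟩ : ∃ ε : ℝ, 0 < ε ∧ (1 + ε) * a < b := by
    refine ⟨(b - a) / (2 * (a + 1)), div_pos (by linarith) (by linarith), ?_⟩
    have : (b - a) / (2 * (a + 1)) * a ≤ (b - a) / 2 := by
      rw [div_mul_eq_mul_div, div_le_div_iff₀ (by linarith) (by norm_num)]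
      nlinarith
    linarith
  have hwc : ContinuousOn w Disc := by
    have : ContinuousOn (fun z => 1 / Real.exp (p z)) Disc :=
      continuousOn_const.div (Real.continuous_exp.comp_continuousOn hp.continuousOn)
        fun z _ => (Real.exp_pos _).ne'
    refine this.congr fun z hz => ?_
    simp [hw z hz]
  refine ⟨(1 + 1 / ε) / (b - (1 + ε) * a), div_pos (by positivity) (by linarith), fun β hβ => ?_⟩
  have hβ1 : IsTest 1 β := hβ.of_le (by norm_num)
  set Φ : ℂ → ℝ := fun z => p z + 2 * ψ z with hΦ
  have hΦc : ContDiffOn ℝ 2 Φ Disc := hp.add (contDiffOn_const.mul hψ)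
  set e : ℂ → ℝ := fun z => Real.exp (p z / 2) with he
  have hec : ContDiffOn ℝ 2 e Disc := (hp.div_const 2).exp
  set γ : ℂ → ℂ := fun z => (e z : ℂ) * β z with hγ
  have hγt : IsTest 2 γ := isTest_of_eq_zero_off_compact
    ((contDiffOn_ofReal hec).mul hβ.contDiff.contDiffOn) hβ.hasCompactSupport hβ.tsupport_subset
    fun z hz => by simp [hγ, hβ.eq_zero hz]
  have hesq : ∀ z ∈ Disc, e z ^ 2 = 1 / w z := fun z hz => by
    rw [← hw z hz, he, ← Real.exp_nat_mul]; congr 1; push_cast; ring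
  have hγn : ∀ z ∈ Disc, ‖γ z‖ ^ 2 = ‖β z‖ ^ 2 / w z := fun z hz => by
    rw [hγ, norm_mul, mul_pow, Complex.norm_real, Real.norm_eq_abs, sq_abs, hesq z hz]; ring
  -- With `γ = e^{p/2} β` the contribution of `p` to `∂̄γ` cancels against half of `∂̄Φ`, and only
  -- the gradient of `ψ` survives.
  have hident : ∀ z ∈ Disc, delbar γ z - γ z * delbar (fun w => (Φ w : ℂ)) z / 2 =
      (e z : ℂ) * delbar β z - γ z * delbar (fun w => (ψ w : ℂ)) z := by
    intro z hz
    have hdp : DifferentiableAt ℝ p z := differentiableAt_of_contDiffOn (hp.of_le (by norm_num)) hz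
    have hdψ : DifferentiableAt ℝ ψ z := differentiableAt_of_contDiffOn (hψ.of_le (by norm_num)) hz
    have hde : DifferentiableAt ℝ (fun z => (e z : ℂ)) z :=
      differentiableAt_of_contDiffOn ((contDiffOn_ofReal hec).of_le (by norm_num)) hz
    have hdpC : DifferentiableAt ℝ (fun z => (p z : ℂ)) z :=
      Complex.ofRealCLM.differentiableAt.comp z hdp
    have hdψC : DifferentiableAt ℝ (fun z => (ψ z : ℂ)) z :=
      Complex.ofRealCLM.differentiableAt.comp z hdψ
    have e1 : delbar (fun w => (Φ w : ℂ)) z =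
        delbar (fun w => (p w : ℂ)) z + 2 * delbar (fun w => (ψ w : ℂ)) z := by
      simp only [hΦ, Complex.ofReal_add, Complex.ofReal_mul, Complex.ofReal_ofNat]
      rw [delbar_add hdpC (hdψC.const_mul 2), delbar_const_mul hdψC]
    have e2 : delbar (fun w => (e w : ℂ)) z = (e z / 2 : ℝ) * delbar (fun w => (p w : ℂ)) z := by
      refine delbar_ofReal_comp (h := fun s => Real.exp (s / 2)) ?_ hdp
      have := ((hasDerivAt_id (p z)).div_const 2).exp
      convert! this using 1
      simp [he]; ring
    rw [hγ, delbar_mul hde (hβ1.contDiff.differentiable one_ne_zero z), e1, e2]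
    push_cast
    ring
  have hdψc : ContinuousOn (delbar fun w => (ψ w : ℂ)) Disc :=
    continuousOn_delbar ((contDiffOn_ofReal hψ).of_le (by norm_num))
  have hiA : Integrable fun z => L z * ‖β z‖ ^ 2 / w z := hβ1.integrable_mul_sq_div hL hwc hpos
  have hiB : Integrable fun z => ‖delbar β z‖ ^ 2 / w z := hβ1.integrable_delbar_sq_div hwc hpos
  have hlower : b * ∫ z, L z * ‖β z‖ ^ 2 / w z ≤ ∫ z, lap Φ z * ‖γ z‖ ^ 2 := by
    rw [← integral_const_mul]
    refine integral_mono (hiA.const_mul b) (hγt.integrable ((continuousOn_lap hΦc).mul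
      (hγt.contDiff.continuous.norm.pow 2).continuousOn)
      fun z hz => by rw [hγt.eq_zero hz]; simp) fun z => ?_
    by_cases hz : z ∈ Disc
    · simp only [hγn z hz, hΦ, lap_add_const_mul hp hψ 2 hz]
      have := h2 z hz
      have h0 : 0 ≤ ‖β z‖ ^ 2 / w z := div_nonneg (by positivity) (hpos z hz).le
      calc b * (L z * ‖β z‖ ^ 2 / w z) = b * L z * (‖β z‖ ^ 2 / w z) := by ring
        _ ≤ _ := by gcongr
    · have hb0 : β z = 0 := hβ.eq_zero fun h => hz (hβ.tsupport_subset h)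
      simp [hγ, hb0]
  have hupper : ∫ z, ‖delbar γ z - γ z * delbar (fun w => (Φ w : ℂ)) z / 2‖ ^ 2 ≤
      (1 + 1 / ε) * (∫ z, ‖delbar β z‖ ^ 2 / w z) +
        (1 + ε) * a * ∫ z, L z * ‖β z‖ ^ 2 / w z := by
    rw [← integral_const_mul, ← integral_const_mul,
      ← integral_add (hiB.const_mul _) (hiA.const_mul _)]
    have hc : ContinuousOn (fun z => ‖delbar γ z - γ z * delbar (fun w => (Φ w : ℂ)) z / 2‖ ^ 2)
        Disc :=
      (((hγt.of_le (m := 1) (by norm_num)).continuousOn_delbar.sub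
        ((hγt.contDiff.continuous.continuousOn.mul
          (continuousOn_delbar ((contDiffOn_ofReal hΦc).of_le (by norm_num)))).div_const 2)).norm).pow 2
    refine integral_mono (hγt.integrable hc fun z hz => ?_)
      ((hiB.const_mul _).add (hiA.const_mul _)) fun z => ?_
    · rw [hγt.eq_zero hz, delbar_of_notMem_tsupport hz]; simp
    · by_cases hz : z ∈ Disc
      · simp only [hident z hz]
        refine (norm_sub_sq_le hε _ _).trans ?_
        rw [norm_mul, norm_mul, mul_pow, mul_pow, hγn z hz, Complex.norm_real, Real.norm_eq_abs,
          sq_abs, hesq z hz]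
        have h0 : 0 ≤ ‖β z‖ ^ 2 / w z := div_nonneg (by positivity) (hpos z hz).le
        have h3 : ‖β z‖ ^ 2 / w z * ‖delbar (fun w => (ψ w : ℂ)) z‖ ^ 2 ≤
            ‖β z‖ ^ 2 / w z * (a * L z) := mul_le_mul_of_nonneg_left (h1 z hz) h0
        have h4 := mul_le_mul_of_nonneg_left h3 (by linarith : 0 ≤ 1 + ε)
        calc _ ≤ (1 + 1 / ε) * (1 / w z * ‖delbar β z‖ ^ 2) +
              (1 + ε) * (‖β z‖ ^ 2 / w z * (a * L z)) := by linarith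
          _ = _ := by ring
      · have hz' : z ∉ tsupport γ := fun h => hz (hγt.tsupport_subset h)
        have hz'' : z ∉ tsupport β := fun h => hz (hβ.tsupport_subset h)
        simp [hγt.eq_zero hz', delbar_of_notMem_tsupport hz', hβ.eq_zero hz'',
          delbar_of_notMem_tsupport hz'']
  have hmain := hlower.trans ((integral_lap_mul_le hΦc hγt).trans hupper)
  rw [div_mul_eq_mul_div, le_div_iff₀ (by linarith)]
  linarith

theorem Weight.exp_potential (ω : Weight) {z : ℂ} (hz : z ∈ Disc) :
    Real.exp (ω.potential z) = 1 / ω z := by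
  rw [Weight.potential, Real.exp_neg, Real.exp_log (ω.pos z hz), one_div]

/-- Weights in `W*` admit a weighted estimate for `∂̄` with a density comparable to `τ⁻²` from
below. -/
theorem Weight.IsWStar.exists_hasDelbarEstimate {ω : Weight} (hω : ω.IsWStar) :
    ∃ L : ℂ → ℝ, ContinuousOn L Disc ∧ (∃ c : ℝ, 0 < c ∧ ∀ z : Disc, c ≤ tau ω z ^ 2 * L z) ∧
      ∃ C : ℝ, 0 < C ∧ HasDelbarEstimate ω L C := by
  have hz : ∀ z : ℂ, lap (fun _ => 0) z = 0 := fun z => by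
    have : delbar (fun _ => ((0 : ℝ) : ℂ)) = fun _ => 0 := by
      ext w; simp [delbar]
    rw [lap, this]; simp [del]
  rcases hω.laplacian with ⟨c, hc, h⟩ | ⟨ψ, hψ, -, hψ0, δ, t, hδ, ht, -, h⟩
  -- In case (i) the potential suffices by itself: no auxiliary function, hence no gradient term,
  -- and `a = 0 < b = 1`.
  · refine ⟨lap ω.potential, continuousOn_lap hω.contDiffOn, ⟨c, hc, h⟩, ?_⟩
    refine WeightedBergman.exists_hasDelbarEstimate (ψ := fun _ => 0) (a := 0) (b := 1)
      (fun z hz => ω.exp_potential hz) ω.pos hω.contDiffOn contDiffOn_const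
      (continuousOn_lap hω.contDiffOn) le_rfl one_pos (fun z _ => ?_) fun z _ => ?_
    · simp [delbar]
    · rw [hz]; linarith
  -- In case (ii) `Δφ + 2Δψ ≥ (2 + t)Δψ` while `|∂ψ|² ≤ Δψ`; the requirement `a < b` reads `1 < 2 +
  -- t`, which is the hypothesis `t > -1`.
  · refine ⟨lap ψ, continuousOn_lap hψ, ⟨δ, hδ, fun z => (h z).1⟩, ?_⟩
    refine WeightedBergman.exists_hasDelbarEstimate (ψ := ψ) (a := 1) (b := 2 + t)
      (fun z hz => ω.exp_potential hz) ω.pos hω.contDiffOn hψ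
      (continuousOn_lap hψ) zero_le_one (by linarith) (fun z hz => ?_) fun z hz => ?_
    · rw [← norm_del_ofReal (differentiableAt_of_contDiffOn (hψ.of_le (by norm_num)) hz), one_mul]
      exact (h ⟨z, hz⟩).2.2
    · have := (h ⟨z, hz⟩).2.1
      linarith

end Estimate

/-! ### Integration against the measure `ω dA` -/

section Area

variable {E : Type*} [NormedAddCommGroup E] [NormedSpace ℝ E]

instance (ω : Weight) : IsFiniteMeasure ω.area :=
  isFiniteMeasure_withDensity_ofReal ω.integrableOn.hasFiniteIntegral

theorem Weight.ae_mem_disc (ω : Weight) : ∀ᵐ z ∂ω.area, z ∈ Disc :=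
  (withDensity_absolutelyContinuous _ _).ae_le (ae_restrict_mem measurableSet_ball)

theorem Weight.integral_area (ω : Weight) (f : ℂ → E) :
    ∫ z, f z ∂ω.area = ∫ z in Disc, ω z • f z := by
  rw [Weight.area, integral_withDensity_eq_integral_toReal_smul₀ ω.aemeasurable
    (Eventually.of_forall fun _ => ENNReal.ofReal_lt_top)]
  refine setIntegral_congr_fun measurableSet_ball fun z hz => ?_
  simp only [ENNReal.toReal_ofReal (ω.pos z hz).le]

theorem Weight.integrable_area_iff (ω : Weight) {f : ℂ → E} :
    Integrable f ω.area ↔ IntegrableOn (fun z => ω z • f z) Disc := by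
  rw [Weight.area, integrable_withDensity_iff_integrable_smul₀' ω.aemeasurable
    (Eventually.of_forall fun _ => ENNReal.ofReal_lt_top), IntegrableOn]
  refine integrable_congr ?_
  filter_upwards [ae_restrict_mem measurableSet_ball] with z hz
  rw [ENNReal.toReal_ofReal (ω.pos z hz).le]

theorem Weight.aestronglyMeasurable_of_continuousOn (ω : Weight) {F : Type*}
    [NormedAddCommGroup F] {f : ℂ → F} (hf : ContinuousOn f Disc) :
    AEStronglyMeasurable f ω.area :=
  (hf.aestronglyMeasurable measurableSet_ball).mono_ac (withDensity_absolutelyContinuous _ _)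

theorem Weight.memLp_of_eq_zero_off_compact (ω : Weight) {F : Type*} [NormedAddCommGroup F]
    {f : ℂ → F} {S : Set ℂ} {p : ℝ≥0∞}
    (hf : ContinuousOn f Disc) (hS : IsCompact S) (hSD : S ⊆ Disc) (h0 : ∀ z ∉ S, f z = 0) :
    MemLp f p ω.area := by
  obtain ⟨C, hC⟩ := hS.exists_bound_of_continuousOn (hf.mono hSD)
  refine MemLp.of_bound (ω.aestronglyMeasurable_of_continuousOn hf) (max C 0)
    (Eventually.of_forall fun z => ?_)
  by_cases hz : z ∈ S
  · exact (hC z hz).trans (le_max_left _ _)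
  · simp [h0 z hz]

/-- The measure is finite, so `L²` lies in `L¹`, and on a compact subset of the disc the lower bound
of the weight lets one divide it out. -/
theorem Weight.locallyIntegrableOn_of_memLp (ω : Weight) {f : ℂ → ℂ} (hf : MemLp f 2 ω.area) :
    LocallyIntegrableOn f Disc := by
  rw [locallyIntegrableOn_iff isOpen_disc.isLocallyClosed]
  intro S hSD hS
  obtain ⟨c, hc, hcω⟩ := ω.bddBelow S hSD hS
  have h1 := ω.integrable_area_iff.1 (hf.integrable (by norm_num))
  have h2 : IntegrableOn (fun z => c⁻¹ * ‖ω z • f z‖) S :=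
    IntegrableOn.mono_set (h1.norm.const_mul c⁻¹) hSD
  refine h2.mono' ((hf.1.mono_ac ω.absolutelyContinuous).mono_set hSD) ?_
  filter_upwards [ae_restrict_mem hS.measurableSet] with z hz
  rw [norm_smul, Real.norm_of_nonneg (ω.pos z (hSD hz)).le, ← mul_assoc]
  refine le_mul_of_one_le_left (norm_nonneg _) ?_
  rw [inv_mul_eq_div, one_le_div hc]
  exact hcω z hz

theorem setIntegral_disc_eq {f : ℂ → E} (h : ∀ z ∉ Disc, f z = 0) :
    ∫ z in Disc, f z = ∫ z, f z := setIntegral_eq_integral_of_forall_compl_eq_zero h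

theorem norm_sq_toLp {μ : Measure ℂ} {f : ℂ → ℂ} (hf : MemLp f 2 μ) :
    ‖hf.toLp f‖ ^ 2 = ∫ z, ‖f z‖ ^ 2 ∂μ := by
  have h := inner_self_eq_norm_sq_to_K (𝕜 := ℂ) (hf.toLp f)
  rw [L2.inner_def] at h
  have h2 : ∫ z, ‖f z‖ ^ 2 ∂μ = ∫ z, ‖hf.toLp f z‖ ^ 2 ∂μ :=
    integral_congr_ae (by filter_upwards [hf.coeFn_toLp] with z hz; rw [hz])
  rw [h2]
  have h3 : ∀ z, inner ℂ (hf.toLp f z) (hf.toLp f z) = ((‖hf.toLp f z‖ ^ 2 : ℝ) : ℂ) := fun z => by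
    rw [inner_self_eq_norm_sq_to_K]; simp
  simp only [h3] at h
  have h4 : ∫ z, ((‖hf.toLp f z‖ ^ 2 : ℝ) : ℂ) ∂μ = ((∫ z, ‖hf.toLp f z‖ ^ 2 ∂μ : ℝ) : ℂ) :=
    integral_ofReal
  rw [h4] at h
  exact Complex.ofReal_injective ((Complex.ofReal_pow _ _).trans h.symm)

end Area

/-! ### Duality: Hörmander's estimate for minimal solutions -/

section Minimal

/-- The functions `conj (∂̄b) / ω` in `L²(ω dA)`, for test functions `b`. They span a dense
subspace of the orthogonal complement of the Bergman space. -/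
noncomputable def delbarRange (ω : Weight) : Submodule ℂ (L2 ω) where
  carrier := {s | ∃ b : ℂ → ℂ, IsTest 2 b ∧ s =ᵐ[ω.area] fun z => conj (delbar b z) / ω z}
  zero_mem' := by
    refine ⟨fun _ => 0, isTest_of_eq_zero_off_compact contDiffOn_const isCompact_empty
      (empty_subset _) fun _ _ => rfl, (Lp.coeFn_zero _ _ _).trans ?_⟩
    refine Eventually.of_forall fun z => ?_
    simp [delbar]
  add_mem' := by
    rintro s t ⟨b, hb, hs⟩ ⟨b', hb', ht⟩
    refine ⟨fun z => b z + b' z, isTest_of_eq_zero_off_compact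
      (hb.contDiff.add hb'.contDiff).contDiffOn
      (hb.hasCompactSupport.isCompact.union hb'.hasCompactSupport.isCompact)
      (union_subset hb.tsupport_subset hb'.tsupport_subset) fun z hz => ?_, ?_⟩
    · rw [mem_union, not_or] at hz
      rw [hb.eq_zero hz.1, hb'.eq_zero hz.2, add_zero]
    · filter_upwards [Lp.coeFn_add s t, hs, ht] with z h1 h2 h3
      rw [h1, Pi.add_apply, h2, h3, delbar_add (hb.contDiff.differentiable (by norm_num) z)
        (hb'.contDiff.differentiable (by norm_num) z), map_add, add_div]
  smul_mem' := by
    rintro c s ⟨b, hb, hs⟩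
    refine ⟨fun z => conj c * b z, isTest_of_eq_zero_off_compact
      (contDiff_const.mul hb.contDiff).contDiffOn hb.hasCompactSupport
      hb.tsupport_subset fun z hz => by rw [hb.eq_zero hz, mul_zero], ?_⟩
    filter_upwards [Lp.coeFn_smul c s, hs] with z h1 h2
    rw [h1, Pi.smul_apply, h2, delbar_const_mul (hb.contDiff.differentiable (by norm_num) z),
      map_mul, Complex.conj_conj, smul_eq_mul, mul_div_assoc]

theorem Weight.memLp_delbar_div (ω : Weight) (hω : ContinuousOn ω Disc) {b : ℂ → ℂ}
    (hb : IsTest 2 b) : MemLp (fun z => conj (delbar b z) / ω z) 2 ω.area := by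
  refine ω.memLp_of_eq_zero_off_compact ?_ hb.hasCompactSupport hb.tsupport_subset fun z hz => ?_
  · refine ContinuousOn.div ?_ (Complex.continuous_ofReal.comp_continuousOn hω) fun z hz => ?_
    · exact Complex.continuous_conj.comp_continuousOn
        (hb.of_le (m := 1) (by norm_num)).continuousOn_delbar
    · exact_mod_cast (ω.pos z hz).ne'
  · simp [delbar_of_notMem_tsupport hz]

/-- Dividing by `ω` and conjugating in `delbarRange` is designed for this: the inner product becomes
the unweighted distributional pairing of `V` with `∂̄b`. -/
theorem inner_delbarRange {ω : Weight} {s v : L2 ω} {b V : ℂ → ℂ} (hb : IsTest 2 b)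
    (hs : s =ᵐ[ω.area] fun z => conj (delbar b z) / ω z) (hv : v =ᵐ[ω.area] V) :
    inner ℂ s v = ∫ z, V z * delbar b z := by
  rw [L2.inner_def]
  have h1 : ∫ z, inner ℂ (s z) (v z) ∂ω.area = ∫ z, V z * (delbar b z / ω z) ∂ω.area := by
    refine integral_congr_ae ?_
    filter_upwards [hs, hv] with z h1 h2
    rw [h1, h2, RCLike.inner_apply]
    simp
  rw [h1, ω.integral_area, ← setIntegral_disc_eq (f := fun z => V z * delbar b z)]
  · refine setIntegral_congr_fun measurableSet_ball fun z hz => ?_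
    have : (ω z : ℂ) ≠ 0 := by exact_mod_cast (ω.pos z hz).ne'
    simp only [Complex.real_smul]
    field_simp
  · intro z hz
    rw [delbar_of_notMem_tsupport fun h => hz (hb.tsupport_subset h), mul_zero]

theorem norm_sq_delbarRange {ω : Weight} (hω : ContinuousOn ω Disc) {s : L2 ω} {b : ℂ → ℂ}
    (hb : IsTest 2 b) (hs : s =ᵐ[ω.area] fun z => conj (delbar b z) / ω z) :
    ‖s‖ ^ 2 = ∫ z, ‖delbar b z‖ ^ 2 / ω z := by
  have hm := ω.memLp_delbar_div hω hb
  have hst : s = hm.toLp _ := Lp.ext (hs.trans hm.coeFn_toLp.symm)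
  rw [hst, norm_sq_toLp, ω.integral_area,
    ← setIntegral_disc_eq (f := fun z => ‖delbar b z‖ ^ 2 / ω z)]
  · refine setIntegral_congr_fun measurableSet_ball fun z hz => ?_
    have := ω.pos z hz
    simp only [norm_div, RCLike.norm_conj, Complex.norm_real, Real.norm_of_nonneg this.le,
      smul_eq_mul]
    field_simp
  · intro z hz
    rw [delbar_of_notMem_tsupport fun h => hz (hb.tsupport_subset h)]
    simp

/-- Orthogonality to the range says that `∂̄v = 0` in the sense of distributions, so Weyl's lemma
provides a holomorphic representative. -/
theorem delbarRange_orthogonal_le {ω : Weight} (hω : ContinuousOn ω Disc) :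
    (delbarRange ω)ᗮ ≤ bergman ω := by
  intro v hv
  have hw : IsWeaklyHolomorphic v := by
    refine ⟨ω.locallyIntegrableOn_of_memLp (Lp.memLp v), fun b hb => ?_⟩
    have hb2 : IsTest 2 b := hb.of_le (WithTop.coe_le_coe.2 le_top)
    have hm := ω.memLp_delbar_div hω hb2
    rw [← inner_delbarRange hb2 hm.coeFn_toLp (EventuallyEq.refl _ (v : ℂ → ℂ))]
    exact (Submodule.mem_orthogonal _ _).1 hv _ ⟨b, hb2, hm.coeFn_toLp⟩
  refine ⟨weylRep v, hw.differentiableOn_weylRep, ?_⟩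
  exact (withDensity_absolutelyContinuous _ _).ae_le
    ((ae_restrict_iff' measurableSet_ball).2 hw.ae_eq_weylRep)

/-- The function `U` is in `L²(ω dA)` and orthogonal to the Bergman space. -/
structure IsMinimal (ω : Weight) (U : ℂ → ℂ) : Prop where
  memLp : MemLp U 2 ω.area
  integral_eq_zero : ∀ F : ℂ → ℂ, DifferentiableOn ℂ F Disc → MemLp F 2 ω.area →
    ∫ z, U z * conj (F z) ∂ω.area = 0

/-- Hörmander's `L²` estimate for the solution of minimal norm of a `∂̄`-equation. -/
theorem IsMinimal.integral_norm_sq_le {ω : Weight} (hω : ContinuousOn ω Disc) {L : ℂ → ℝ}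
    (hL : ContinuousOn L Disc) (hLpos : ∀ z ∈ Disc, 0 < L z) {C : ℝ} (hC : 0 < C)
    (hest : HasDelbarEstimate ω L C) {U : ℂ → ℂ} (hU : ContDiffOn ℝ 1 U Disc)
    (hmin : IsMinimal ω U) (hJ : Integrable (fun z => ‖delbar U z‖ ^ 2 / L z) ω.area) :
    ∫ z, ‖U z‖ ^ 2 ∂ω.area ≤ C * ∫ z, ‖delbar U z‖ ^ 2 / L z ∂ω.area := by
  set J := ∫ z, ‖delbar U z‖ ^ 2 / L z ∂ω.area with hJdef
  set u : L2 ω := hmin.memLp.toLp U with hu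
  have huU : u =ᵐ[ω.area] U := hmin.memLp.coeFn_toLp
  -- Since `u` is orthogonal to the Bergman space, which contains `(delbarRange ω)ᗮ`, it lies in the
  -- double orthogonal complement, that is, the closure.
  have hmem : u ∈ closure (delbarRange ω : Set (L2 ω)) := by
    rw [← Submodule.topologicalClosure_coe, ← Submodule.orthogonal_orthogonal_eq_closure]
    refine Submodule.orthogonal_le (delbarRange_orthogonal_le hω) ?_
    rw [Submodule.mem_orthogonal]
    rintro f ⟨F, hF, hfF⟩
    rw [L2.inner_def, ← hmin.integral_eq_zero F hF ((memLp_congr_ae hfF).1 (Lp.memLp f))]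
    refine integral_congr_ae ?_
    filter_upwards [hfF, huU] with z h1 h2
    rw [h1, h2, RCLike.inner_apply]
  -- The Cauchy–Schwarz bound is kept in its arithmetic–geometric mean form. It is a closed
  -- condition on `s`, and at `s = u` it reads `‖u‖² ≤ CJ/2 + ‖u‖²/2`, which is the claim.
  have hclosed : IsClosed {s : L2 ω | ‖inner ℂ s u‖ ≤ C / 2 * J + ‖s‖ ^ 2 / 2} :=
    isClosed_le (by fun_prop) (by fun_prop)
  have hsub : (delbarRange ω : Set (L2 ω)) ⊆
      {s : L2 ω | ‖inner ℂ s u‖ ≤ C / 2 * J + ‖s‖ ^ 2 / 2} := by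
    rintro s ⟨b, hb, hs⟩
    have hb1 : IsTest 1 b := hb.of_le (by norm_num)
    have hi1 : Integrable fun z => L z * ‖b z‖ ^ 2 / ω z := hb1.integrable_mul_sq_div hL hω ω.pos
    have hi2 := ω.integrable_area_iff.1 hJ
    rw [mem_ofPred_eq, inner_delbarRange hb hs huU, integral_mul_delbar_test hU hb1, norm_neg]
    have hzero : ∀ z ∉ Disc, ‖delbar U z * b z‖ = 0 := fun z hz => by
      rw [hb.eq_zero fun h => hz (hb.tsupport_subset h)]; simp
    calc ‖∫ z, delbar U z * b z‖ ≤ ∫ z, ‖delbar U z * b z‖ := norm_integral_le_integral_norm _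
      _ = ∫ z in Disc, ‖delbar U z * b z‖ := (setIntegral_disc_eq hzero).symm
      _ ≤ ∫ z in Disc, (C / 2 * (ω z • (‖delbar U z‖ ^ 2 / L z)) +
            1 / (2 * C) * (L z * ‖b z‖ ^ 2 / ω z)) := by
          refine setIntegral_mono_on ?_ ((hi2.const_mul _).add (hi1.integrableOn.const_mul _))
            measurableSet_ball fun z hz => ?_
          · exact (hb.integrable ((continuousOn_delbar hU).mul
              hb.contDiff.continuous.continuousOn) fun z hz => by
                rw [Pi.mul_apply, hb.eq_zero hz, mul_zero]).norm.integrableOn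
          · have h1 := hLpos z hz
            have h2 := ω.pos z hz
            rw [norm_mul, smul_eq_mul, ← sub_nonneg]
            have : C / 2 * (ω z * (‖delbar U z‖ ^ 2 / L z)) + 1 / (2 * C) * (L z * ‖b z‖ ^ 2 / ω z)
                - ‖delbar U z‖ * ‖b z‖ =
                (C * ω z * ‖delbar U z‖ - L z * ‖b z‖) ^ 2 / (2 * C * ω z * L z) := by
              field_simp
              ring
            rw [this]
            positivity
      _ = C / 2 * J + 1 / (2 * C) * ∫ z, L z * ‖b z‖ ^ 2 / ω z := by
          rw [integral_add (hi2.const_mul _) (hi1.integrableOn.const_mul _), integral_const_mul,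
            integral_const_mul, ← ω.integral_area, setIntegral_disc_eq]
          intro z hz
          rw [hb.eq_zero fun h => hz (hb.tsupport_subset h)]
          simp
      _ ≤ C / 2 * J + 1 / (2 * C) * (C * ∫ z, ‖delbar b z‖ ^ 2 / ω z) := by
          gcongr
          exact hest b hb
      _ = C / 2 * J + ‖s‖ ^ 2 / 2 := by
          rw [norm_sq_delbarRange hω hb hs]
          field_simp
  have h := closure_minimal hsub hclosed hmem
  rw [mem_ofPred_eq, inner_self_eq_norm_sq_to_K] at h
  have h2 : ‖((‖u‖ : ℂ)) ^ 2‖ = ‖u‖ ^ 2 := by simp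
  rw [← norm_sq_toLp hmin.memLp, ← hu]
  have h3 : ‖u‖ ^ 2 ≤ C / 2 * J + ‖u‖ ^ 2 / 2 := h2 ▸ h
  linarith

end Minimal

/-! ### Kernels as minimal solutions, and perturbation of the weight -/

section KernelDecay

theorem Weight.memLp_area_iff (ω : Weight) {F : ℂ → ℂ} (hF : ContinuousOn F Disc) :
    MemLp F 2 ω.area ↔ IntegrableOn (fun z => ω z * ‖F z‖ ^ 2) Disc := by
  rw [memLp_two_iff_integrable_sq_norm (ω.aestronglyMeasurable_of_continuousOn hF),
    ω.integrable_area_iff]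
  rfl

theorem Weight.contDiffOn (ω : Weight) {n : WithTop ℕ∞} (h : ContDiffOn ℝ n ω.potential Disc) :
    ContDiffOn ℝ n ω Disc := by
  refine h.neg.exp.congr fun z hz => ?_
  simp only [Weight.potential, neg_neg]
  rw [Real.exp_log (ω.pos z hz)]

theorem inner_bergman_K {ω : Weight} (f : bergman ω) (z : Disc) :
    inner ℂ f (K ω z) = conj (holo f z) := by
  rw [K, RKHS.inner_kerFun, bergman_apply, RCLike.inner_apply, one_mul]

theorem memLp_holo {ω : Weight} (f : bergman ω) : MemLp (holo f) 2 ω.area :=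
  (memLp_congr_ae (holo_ae f)).1 (Lp.memLp _)

theorem integral_K_mul_conj {ω : Weight} (z : Disc) {F : ℂ → ℂ} (hF : DifferentiableOn ℂ F Disc)
    (hF2 : MemLp F 2 ω.area) : ∫ w, holo (K ω z) w * conj (F w) ∂ω.area = conj (F z) := by
  set f : bergman ω := ⟨hF2.toLp F, F, hF, hF2.coeFn_toLp⟩ with hf
  have h1 := inner_bergman_K f z
  have h2 : holo f z = F z :=
    eqOn_disc ((holo_ae f).symm.trans hF2.coeFn_toLp) (holo_differentiableOn f) hF z.2
  rw [← h2, ← h1, Submodule.coe_inner, L2.inner_def]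
  refine integral_congr_ae ?_
  filter_upwards [holo_ae (K ω z), hF2.coeFn_toLp] with w h3 h4
  rw [RCLike.inner_apply, h3]
  simp only [hf, h4]

/-- The difference of a normalized bump at `z` and the kernel `K_z` is orthogonal to the Bergman
space. -/
theorem isMinimal_mol_sub_K {ω : Weight} (hω : ContinuousOn ω Disc) (z : Disc) {ε : ℝ} (hε : 0 < ε)
    (h : ‖(z : ℂ)‖ + ε < 1) :
    IsMinimal ω fun w => ((mol ε (z - w) / ω w : ℝ) : ℂ) - holo (K ω z) w := by
  have hmc : ContinuousOn (fun w => mol ε (z - w)) Disc :=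
    ((contDiff_mol (n := 0) ε).continuous.comp (continuous_const.sub continuous_id)).continuousOn
  have hm0 : ∀ w ∉ Metric.closedBall (z : ℂ) ε, mol ε (z - w) = 0 := fun w hw => by
    rw [Metric.mem_closedBall, dist_eq_norm, norm_sub_rev, not_le] at hw
    exact mol_eq_zero hε hw.le
  have hm : MemLp (fun w => ((mol ε (z - w) / ω w : ℝ) : ℂ)) 2 ω.area :=
    ω.memLp_of_eq_zero_off_compact (Complex.continuous_ofReal.comp_continuousOn
      (hmc.div hω fun w hw => (ω.pos w hw).ne')) (isCompact_closedBall _ _)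
      (closedBall_subset_disc h) fun w hw => by simp [hm0 w hw]
  refine ⟨hm.sub (memLp_holo _), fun F hF hF2 => ?_⟩
  have hi1 := MemLp.integrable_mul hm hF2.star
  have hi2 := MemLp.integrable_mul (memLp_holo (K ω z)) hF2.star
  -- By the mean value property the bump reproduces values at `z`, just as the kernel does.
  have e1 : ∫ w, ((mol ε (z - w) / ω w : ℝ) : ℂ) * conj (F w) ∂ω.area = conj (F z) := by
    rw [ω.integral_area, ← molAvg_eq_of_differentiableOn hF hε h, molAvg, ← integral_conj,
      ← setIntegral_disc_eq]
    · refine setIntegral_congr_fun measurableSet_ball fun w hw => ?_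
      have : (ω w : ℂ) ≠ 0 := by exact_mod_cast (ω.pos w hw).ne'
      simp only [map_mul, Complex.conj_ofReal, Complex.real_smul]
      push_cast
      field_simp
    · intro w hw
      rw [hm0 w fun h' => hw (closedBall_subset_disc h h')]
      simp
  calc _ = ∫ w, (((mol ε (z - w) / ω w : ℝ) : ℂ) * conj (F w) -
        holo (K ω z) w * conj (F w)) ∂ω.area := by
        congr 1; ext w; ring
    _ = 0 := by
        refine (integral_sub hi1 hi2).trans (sub_eq_zero.2 ?_)
        exact e1.trans (integral_K_mul_conj z hF hF2).symm

/-- The weight `ω / W`. -/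
noncomputable def Weight.div (ω : Weight) {W : ℂ → ℝ} (hW : ContinuousOn W Disc) {k : ℝ}
    (h1 : ∀ z ∈ Disc, 1 ≤ W z) (hk : ∀ z ∈ Disc, W z ≤ k) : Weight where
  toFun z := ω z / W z
  pos z hz := div_pos (ω.pos z hz) (by linarith [h1 z hz])
  integrableOn := by
    have hinv : ContinuousOn (fun z => (W z)⁻¹) Disc :=
      hW.inv₀ fun z hz => by linarith [h1 z hz]
    refine Integrable.mono' ω.integrableOn (ω.integrableOn.1.mul
      (hinv.aestronglyMeasurable measurableSet_ball)) ?_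
    filter_upwards [ae_restrict_mem measurableSet_ball] with z hz
    rw [Real.norm_of_nonneg (div_nonneg (ω.pos z hz).le (by linarith [h1 z hz]))]
    exact div_le_self (ω.pos z hz).le (h1 z hz)
  bddBelow S hSD hS := by
    obtain ⟨c, hc, hcω⟩ := ω.bddBelow S hSD hS
    -- Positivity of `k` is read off from a point of `S`, so the empty set is treated apart.
    rcases S.eq_empty_or_nonempty with rfl | ⟨z₀, hz₀⟩
    · exact ⟨1, one_pos, fun z hz => hz.elim⟩
    have hk0 : 0 < k := by linarith [h1 z₀ (hSD hz₀), hk z₀ (hSD hz₀)]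
    refine ⟨c / k, by positivity, fun z hz => ?_⟩
    have := h1 z (hSD hz)
    have h2 := hcω z hz
    have h3 := hk z (hSD hz)
    gcongr
    exact hc.le.trans h2

theorem norm_add_sq_le_two (x y : ℂ) : ‖x + y‖ ^ 2 ≤ 2 * ‖x‖ ^ 2 + 2 * ‖y‖ ^ 2 := by
  have h1 : ‖x + y‖ ^ 2 ≤ (‖x‖ + ‖y‖) ^ 2 := by
    gcongr
    exact norm_add_le x y
  nlinarith [sq_nonneg (‖x‖ - ‖y‖)]

/-- A `∂̄`-estimate survives a change of the weight by a factor with small logarithmic gradient. -/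
theorem HasDelbarEstimate.div {w L W : ℂ → ℝ} {C : ℝ} (hC : 0 < C) (hest : HasDelbarEstimate w L C)
    (hw : ContinuousOn w Disc) (hpos : ∀ z ∈ Disc, 0 < w z) (hL : ContinuousOn L Disc)
    (hL0 : ∀ z ∈ Disc, 0 ≤ L z) (hW : ContDiffOn ℝ 2 W Disc) (hWpos : ∀ z ∈ Disc, 0 < W z)
    (hgrad : ∀ z ∈ Disc,
      ‖delbar (fun v => (W v : ℂ)) z‖ ^ 2 ≤ 1 / (16 * C) * (L z * W z ^ 2)) :
    HasDelbarEstimate (fun z => w z / W z) L (4 * C) := by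
  intro β hβ
  have hβ1 : IsTest 1 β := hβ.of_le (by norm_num)
  -- Multiplying by `√W` turns the left-hand side for the weight `w / W` into that for `w`; the
  -- extra term in `∂̄γ` is controlled by the gradient of `W`.
  set γ : ℂ → ℂ := fun z => (√(W z) : ℂ) * β z with hγ
  have hsc : ContDiffOn ℝ 2 (fun z => √(W z)) Disc := hW.sqrt fun z hz => (hWpos z hz).ne'
  have hγt : IsTest 2 γ := isTest_of_eq_zero_off_compact
    ((contDiffOn_ofReal hsc).mul hβ.contDiff.contDiffOn) hβ.hasCompactSupport hβ.tsupport_subset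
    fun z hz => by simp [hγ, hβ.eq_zero hz]
  have hwW : ContinuousOn (fun z => w z / W z) Disc :=
    hw.div hW.continuousOn fun z hz => (hWpos z hz).ne'
  have hwWpos : ∀ z ∈ Disc, 0 < w z / W z := fun z hz => div_pos (hpos z hz) (hWpos z hz)
  have hX := hβ1.integrable_mul_sq_div hL hwW hwWpos
  have hY := hβ1.integrable_delbar_sq_div hwW hwWpos
  have e1 : ∫ z, L z * ‖γ z‖ ^ 2 / w z = ∫ z, L z * ‖β z‖ ^ 2 / (w z / W z) := by
    refine integral_congr_ae (Eventually.of_forall fun z => ?_)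
    by_cases hz : z ∈ Disc
    · have h1 := hpos z hz
      have h2 := hWpos z hz
      simp only [hγ, norm_mul, Complex.norm_real, Real.norm_of_nonneg (Real.sqrt_nonneg _),
        mul_pow, Real.sq_sqrt h2.le]
      field_simp
    · have : β z = 0 := hβ.eq_zero fun h => hz (hβ.tsupport_subset h)
      simp [hγ, this]
  have e2 : ∫ z, ‖delbar γ z‖ ^ 2 / w z ≤ 2 * (∫ z, ‖delbar β z‖ ^ 2 / (w z / W z)) +
      1 / (32 * C) * ∫ z, L z * ‖β z‖ ^ 2 / (w z / W z) := by
    rw [← integral_const_mul, ← integral_const_mul,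
      ← integral_add (hY.const_mul _) (hX.const_mul _)]
    refine integral_mono ((hγt.of_le (m := 1) (by norm_num)).integrable_delbar_sq_div hw hpos)
      ((hY.const_mul _).add (hX.const_mul _)) fun z => ?_
    by_cases hz : z ∈ Disc
    · have h1 := hpos z hz
      have h2 := hWpos z hz
      have hdW : DifferentiableAt ℝ W z :=
        differentiableAt_of_contDiffOn (hW.of_le (by norm_num)) hz
      have hds : DifferentiableAt ℝ (fun z => (√(W z) : ℂ)) z :=
        differentiableAt_of_contDiffOn ((contDiffOn_ofReal hsc).of_le (by norm_num)) hz
      have e3 : delbar γ z = (√(W z) : ℂ) * delbar β z +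
          ((1 / (2 * √(W z)) : ℝ) : ℂ) * delbar (fun v => (W v : ℂ)) z * β z := by
        rw [hγ, delbar_mul hds (hβ1.contDiff.differentiable one_ne_zero z),
          delbar_ofReal_comp (Real.hasDerivAt_sqrt h2.ne') hdW]
      have h3 : ‖delbar γ z‖ ^ 2 ≤ 2 * (W z * ‖delbar β z‖ ^ 2) +
          1 / (32 * C) * (L z * W z * ‖β z‖ ^ 2) := by
        rw [e3]
        refine (norm_add_sq_le_two _ _).trans ?_
        simp only [norm_mul, Complex.norm_real, mul_pow, Real.norm_eq_abs, sq_abs, div_pow, one_pow,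
          Real.sq_sqrt h2.le]
        have h4 := hgrad z hz
        have h5 : 2 * (1 / (2 ^ 2 * W z) * ‖delbar (fun v => (W v : ℂ)) z‖ ^ 2 * ‖β z‖ ^ 2) ≤
            2 * (1 / (2 ^ 2 * W z) * (1 / (16 * C) * (L z * W z ^ 2)) * ‖β z‖ ^ 2) := by gcongr
        refine (add_le_add_right h5 _).trans (le_of_eq ?_)
        field_simp
        ring
      calc ‖delbar γ z‖ ^ 2 / w z ≤ (2 * (W z * ‖delbar β z‖ ^ 2) +
          1 / (32 * C) * (L z * W z * ‖β z‖ ^ 2)) / w z := by gcongr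
        _ = _ := by field_simp
    · have hz1 : z ∉ tsupport β := fun h => hz (hβ.tsupport_subset h)
      have hz2 : z ∉ tsupport γ := fun h => hz (hγt.tsupport_subset h)
      simp [delbar_of_notMem_tsupport hz1, delbar_of_notMem_tsupport hz2, hβ.eq_zero hz1]
  have hX0 : 0 ≤ ∫ z, L z * ‖β z‖ ^ 2 / (w z / W z) := by
    refine integral_nonneg fun z => ?_
    by_cases hz : z ∈ Disc
    · have := hL0 z hz
      have := hwWpos z hz
      simp only [Pi.zero_apply]
      positivity
    · have : β z = 0 := hβ.eq_zero fun h => hz (hβ.tsupport_subset h)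
      simp [this]
  have h := hest γ hγt
  rw [e1] at h
  -- With `X`, `Y` the two integrals for `w / W`, this is `X ≤ 2CY + X/32`, which gives `X ≤ 4CY`
  -- with room to spare.
  have h4 := h.trans (mul_le_mul_of_nonneg_left e2 hC.le)
  have h5 : C * (1 / (32 * C) * ∫ z, L z * ‖β z‖ ^ 2 / (w z / W z)) =
      1 / 32 * ∫ z, L z * ‖β z‖ ^ 2 / (w z / W z) := by field_simp
  rw [mul_add, h5] at h4
  beta_reduce
  linarith

/-- Weighted bounds for the solution of minimal norm of a `∂̄`-equation, with respect to a weight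
`ω W` where `W` has a small logarithmic gradient. -/
theorem IsMinimal.integral_mul_norm_sq_le {ω : Weight} (hω : ContinuousOn ω Disc) {L W : ℂ → ℝ}
    (hL : ContinuousOn L Disc) (hLpos : ∀ z ∈ Disc, 0 < L z) {C : ℝ} (hC : 0 < C)
    (hest : HasDelbarEstimate ω L C) {U : ℂ → ℂ} (hU : ContDiffOn ℝ 1 U Disc)
    (hmin : IsMinimal ω U) (hW : ContDiffOn ℝ 2 W Disc) (h1 : ∀ z ∈ Disc, 1 ≤ W z) {k : ℝ}
    (hk : ∀ z ∈ Disc, W z ≤ k)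
    (hgrad : ∀ z ∈ Disc,
      ‖delbar (fun v => (W v : ℂ)) z‖ ^ 2 ≤ 1 / (16 * C) * (L z * W z ^ 2))
    (hJ : Integrable (fun z => W z * (‖delbar U z‖ ^ 2 / L z)) ω.area) :
    Integrable (fun z => W z * ‖U z‖ ^ 2) ω.area ∧
    ∫ z, W z * ‖U z‖ ^ 2 ∂ω.area ≤ 16 * C * ∫ z, W z * (‖delbar U z‖ ^ 2 / L z) ∂ω.area := by
  set ω' := ω.div hW.continuousOn h1 hk with hω'
  have hω'z : ∀ z, ω' z = ω z / W z := fun z => rfl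
  have hWpos : ∀ z ∈ Disc, 0 < W z := fun z hz => by linarith [h1 z hz]
  -- Orthogonality passes from `ω` to `ω / W` on multiplying by `W`, and `|V|² ω / W = |U|² W ω`; so
  -- the unperturbed estimate is applied to `V` in the weight `ω / W`.
  set V : ℂ → ℂ := fun z => U z * (W z : ℂ) with hV
  have hVc : ContDiffOn ℝ 1 V Disc := hU.mul ((contDiffOn_ofReal hW).of_le (by norm_num))
  have hdV : ∀ z ∈ Disc, delbar V z = U z * delbar (fun v => (W v : ℂ)) z + delbar U z * W z :=
    fun z hz => delbar_mul (differentiableAt_of_contDiffOn hU hz)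
      (differentiableAt_of_contDiffOn ((contDiffOn_ofReal hW).of_le (by norm_num)) hz)
  have hUi := (ω.memLp_area_iff hU.continuousOn).1 hmin.memLp
  -- Finiteness of this integral, due to `W ≤ k`, is what makes the final absorption legitimate. The
  -- constant `k` does not enter the resulting bound.
  have hXi : Integrable (fun z => W z * ‖U z‖ ^ 2) ω.area := by
    rw [ω.integrable_area_iff]
    refine Integrable.mono' (hUi.const_mul k) (((hω.smul
      (hW.continuousOn.mul (hU.continuousOn.norm.pow 2))).aestronglyMeasurable
        measurableSet_ball)) ?_
    filter_upwards [ae_restrict_mem measurableSet_ball] with z hz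
    have := ω.pos z hz
    have h2 := hWpos z hz
    rw [smul_eq_mul, Real.norm_of_nonneg (by positivity)]
    calc ω z * (W z * ‖U z‖ ^ 2) = W z * (ω z * ‖U z‖ ^ 2) := by ring
      _ ≤ _ := by gcongr; exact hk z hz
  refine ⟨hXi, ?_⟩
  have hVmin : IsMinimal ω' V := by
    refine ⟨(ω'.memLp_area_iff hVc.continuousOn).2 ?_, fun F hF hF2 => ?_⟩
    · refine IntegrableOn.congr_fun (ω.integrable_area_iff.1 hXi) (fun z hz => ?_)
        measurableSet_ball
      have := hWpos z hz
      simp only [hω'z, hV, norm_mul, Complex.norm_real, Real.norm_of_nonneg this.le, smul_eq_mul]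
      field_simp
    · have hF' : MemLp F 2 ω.area := by
        rw [ω.memLp_area_iff hF.continuousOn]
        have h2 := (ω'.memLp_area_iff hF.continuousOn).1 hF2
        refine Integrable.mono' (h2.const_mul k) ((hω.mul
          (hF.continuousOn.norm.pow 2)).aestronglyMeasurable measurableSet_ball) ?_
        filter_upwards [ae_restrict_mem measurableSet_ball] with z hz
        have h3 := ω.pos z hz
        have h4 := hWpos z hz
        rw [Real.norm_of_nonneg (by positivity), hω'z]
        calc ω z * ‖F z‖ ^ 2 = W z * (ω z / W z * ‖F z‖ ^ 2) := by field_simp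
          _ ≤ _ := by gcongr; exact hk z hz
      rw [← hmin.integral_eq_zero F hF hF', ω.integral_area, ω'.integral_area]
      refine setIntegral_congr_fun measurableSet_ball fun z hz => ?_
      have h4 : (W z : ℂ) ≠ 0 := by exact_mod_cast (hWpos z hz).ne'
      simp only [hω'z, hV, Complex.real_smul]
      push_cast
      field_simp
  have hω'c : ContinuousOn ω' Disc := hω.div hW.continuousOn fun z hz => (hWpos z hz).ne'
  have hest' : HasDelbarEstimate ω' L (4 * C) :=
    hest.div hC hω ω.pos hL (fun z hz => (hLpos z hz).le) hW hWpos hgrad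
  have hpt : ∀ z ∈ Disc, ω' z * (‖delbar V z‖ ^ 2 / L z) ≤
      2 * (ω z • (W z * (‖delbar U z‖ ^ 2 / L z))) +
        1 / (8 * C) * (ω z • (W z * ‖U z‖ ^ 2)) := by
    intro z hz
    have h2 := ω.pos z hz
    have h3 := hWpos z hz
    have h4 := hLpos z hz
    have h5 : ‖delbar V z‖ ^ 2 ≤ 2 * (‖U z‖ ^ 2 * (1 / (16 * C) * (L z * W z ^ 2))) +
        2 * (‖delbar U z‖ ^ 2 * W z ^ 2) := by
      rw [hdV z hz]
      refine (norm_add_sq_le_two _ _).trans ?_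
      rw [norm_mul, norm_mul, mul_pow, mul_pow, Complex.norm_real, Real.norm_eq_abs, sq_abs]
      have := hgrad z hz
      gcongr
    calc ω' z * (‖delbar V z‖ ^ 2 / L z) ≤
        ω z / W z * ((2 * (‖U z‖ ^ 2 * (1 / (16 * C) * (L z * W z ^ 2))) +
        2 * (‖delbar U z‖ ^ 2 * W z ^ 2)) / L z) := by rw [hω'z]; gcongr
      _ = _ := by
        simp only [smul_eq_mul]
        field_simp
        ring
  have hR : IntegrableOn (fun z => 2 * (ω z • (W z * (‖delbar U z‖ ^ 2 / L z))) +
        1 / (8 * C) * (ω z • (W z * ‖U z‖ ^ 2))) Disc :=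
    ((ω.integrable_area_iff.1 hJ).const_mul _).add ((ω.integrable_area_iff.1 hXi).const_mul _)
  have hJ' : IntegrableOn (fun z => ω' z • (‖delbar V z‖ ^ 2 / L z)) Disc := by
    refine Integrable.mono' hR ((hω'c.smul (((continuousOn_delbar hVc).norm.pow 2).div hL
      fun z hz => (hLpos z hz).ne')).aestronglyMeasurable measurableSet_ball) ?_
    filter_upwards [ae_restrict_mem measurableSet_ball] with z hz
    have h2 := ω'.pos z hz
    have h4 := hLpos z hz
    rw [smul_eq_mul, Real.norm_of_nonneg (by positivity)]
    exact hpt z hz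
  have hH := hVmin.integral_norm_sq_le hω'c hL hLpos (by positivity : 0 < 4 * C) hest' hVc
    (ω'.integrable_area_iff.2 hJ')
  have e1 : ∫ z, ‖V z‖ ^ 2 ∂ω'.area = ∫ z, W z * ‖U z‖ ^ 2 ∂ω.area := by
    rw [ω.integral_area, ω'.integral_area]
    refine setIntegral_congr_fun measurableSet_ball fun z hz => ?_
    have := hWpos z hz
    simp only [hω'z, hV, norm_mul, Complex.norm_real, Real.norm_of_nonneg this.le, smul_eq_mul]
    field_simp
  have e2 : ∫ z, ‖delbar V z‖ ^ 2 / L z ∂ω'.area ≤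
      2 * (∫ z, W z * (‖delbar U z‖ ^ 2 / L z) ∂ω.area) +
        1 / (8 * C) * ∫ z, W z * ‖U z‖ ^ 2 ∂ω.area := by
    rw [ω.integral_area, ω.integral_area, ω'.integral_area, ← integral_const_mul,
      ← integral_const_mul, ← integral_add ((ω.integrable_area_iff.1 hJ).const_mul _)
        ((ω.integrable_area_iff.1 hXi).const_mul _)]
    exact setIntegral_mono_on hJ' hR measurableSet_ball hpt
  rw [e1] at hH
  -- With `X`, `J` the integrals of `W|U|²` and `W|∂̄U|²/L`, this is `X ≤ 4C(2J + X/(8C)) = 8CJ +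
  -- X/2`, hence `X ≤ 16CJ`.
  have h6 := hH.trans (mul_le_mul_of_nonneg_left e2 (by positivity))
  have h7 : 4 * C * (1 / (8 * C) * ∫ z, W z * ‖U z‖ ^ 2 ∂ω.area) =
      1 / 2 * ∫ z, W z * ‖U z‖ ^ 2 ∂ω.area := by field_simp; ring
  rw [mul_add, h7] at h6
  linarith

end KernelDecay

/-! ### Definition and upper bound of the Hankel operator -/

section UpperBound

theorem mem_conjMulDomain_iff {ω : Weight} {φ : ℂ → ℂ} {f : bergman ω} :
    f ∈ conjMulDomain ω φ ↔ MemLp (fun z => conj (φ z) * holo f z) 2 ω.area := by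
  refine memLp_congr_ae ?_
  filter_upwards [holo_ae f] with z hz
  rw [hz]

theorem norm_sq_of_ae_eq {μ : Measure ℂ} {v : Lp ℂ 2 μ} {V : ℂ → ℂ} (h : v =ᵐ[μ] V) :
    ‖v‖ ^ 2 = ∫ z, ‖V z‖ ^ 2 ∂μ := by
  have hm : MemLp V 2 μ := (memLp_congr_ae h).1 (Lp.memLp v)
  rw [← norm_sq_toLp hm]
  congr 2
  exact Lp.ext (h.trans hm.coeFn_toLp.symm)

theorem hasDerivAt_truncation {A k s : ℝ} (h : k + s ≠ 0) :
    HasDerivAt (fun s => k * (A + s) / (k + s)) (k * (k - A) / (k + s) ^ 2) s := by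
  have h1 : HasDerivAt (fun s => k * (A + s)) k s := by
    simpa using ((hasDerivAt_id s).const_add A).const_mul k
  have h2 : HasDerivAt (fun s => k + s) 1 s := (hasDerivAt_id s).const_add k
  convert! h1.div h2 h using 1
  congr 1
  ring

/-- The bounded weight `k (A + |φ|²) / (k + |φ|²)`, which increases to `A + |φ|²` as `k → ∞`, has
a small logarithmic gradient if `A` is large. -/
theorem norm_delbar_truncation_sq_le {φ : ℂ → ℂ} {z : ℂ} (hφ : DifferentiableAt ℂ φ z) {A k : ℝ}
    (hA : 0 < A) (hAk : A ≤ k) :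
    ‖delbar (fun w => ((k * (A + Complex.normSq (φ w)) / (k + Complex.normSq (φ w)) : ℝ) : ℂ)) z‖ ^ 2
      ≤ 1 / (4 * A) * (‖deriv φ z‖ ^ 2 *
        (k * (A + Complex.normSq (φ z)) / (k + Complex.normSq (φ z))) ^ 2) := by
  have hs0 : 0 ≤ Complex.normSq (φ z) := Complex.normSq_nonneg _
  have hk : 0 < k := hA.trans_le hAk
  have hdφ : DifferentiableAt ℝ φ z := hφ.restrictScalars ℝ
  have hds : DifferentiableAt ℝ (fun w => Complex.normSq (φ w)) z :=
    ((contDiff_normSq (n := 1)).differentiable one_ne_zero (φ z)).comp z hdφ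
  have e1 : delbar (fun w => (Complex.normSq (φ w) : ℂ)) z = φ z * conj (deriv φ z) := by
    simp only [← Complex.mul_conj]
    rw [delbar_mul (g := fun w => conj (φ w)) hdφ
      (Complex.conjCLE.differentiableAt.comp z hdφ), delbar_conj hφ, delbar_eq_zero hφ]
    ring
  rw [delbar_ofReal_comp (hasDerivAt_truncation (A := A) (by positivity)) hds, e1, norm_mul,
    norm_mul, RCLike.norm_conj, Complex.norm_real, Real.norm_eq_abs, mul_pow, sq_abs, mul_pow,
    Complex.sq_norm (φ z)]
  generalize Complex.normSq (φ z) = s at *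
  have hks : 0 < k + s := by positivity
  have hAs : 0 < A + s := by positivity
  rw [show (k * (k - A) / (k + s) ^ 2) ^ 2 * (s * ‖deriv φ z‖ ^ 2) =
    (k ^ 2 * ‖deriv φ z‖ ^ 2 / (k + s) ^ 4) * (s * (k - A) ^ 2) by field_simp,
    show 1 / (4 * A) * (‖deriv φ z‖ ^ 2 * (k * (A + s) / (k + s)) ^ 2) =
    (k ^ 2 * ‖deriv φ z‖ ^ 2 / (k + s) ^ 4) * ((A + s) ^ 2 * (k + s) ^ 2 / (4 * A)) by
      field_simp]
  refine mul_le_mul_of_nonneg_left ?_ (by positivity)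
  rw [le_div_iff₀ (by positivity)]
  -- This inequality, with `s = |φ|²`, is the source of the factor `1/(4A)`, which becomes small for
  -- large `A`.
  have h1 : 4 * A * s ≤ (A + s) ^ 2 := by nlinarith [sq_nonneg (A - s)]
  have h2 : (k - A) ^ 2 ≤ (k + s) ^ 2 := by
    apply pow_le_pow_left₀ <;> linarith
  calc s * (k - A) ^ 2 * (4 * A) = 4 * A * s * (k - A) ^ 2 := by ring
    _ ≤ (A + s) ^ 2 * (k + s) ^ 2 := by gcongr

/-- Functions of minimal norm with compactly supported `∂̄` are square integrable against
`|φ|²`, for `φ` with `|φ'|²` controlled by the density of the `∂̄`-estimate. -/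
theorem IsMinimal.memLp_conj_mul {ω : Weight} (hω : ContinuousOn ω Disc) {L : ℂ → ℝ}
    (hL : ContinuousOn L Disc) (hLpos : ∀ z ∈ Disc, 0 < L z) {C : ℝ} (hC : 0 < C)
    (hest : HasDelbarEstimate ω L C) {U : ℂ → ℂ} (hU : ContDiffOn ℝ 1 U Disc)
    (hmin : IsMinimal ω U) {S : Set ℂ} (hS : IsCompact S) (hSD : S ⊆ Disc)
    (hdU : ∀ z ∈ Disc, z ∉ S → delbar U z = 0) {φ : ℂ → ℂ}
    (hφ : DifferentiableOn ℂ φ Disc) {M : ℝ} (hM0 : 0 ≤ M)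
    (hM : ∀ z ∈ Disc, ‖deriv φ z‖ ^ 2 ≤ M * L z) :
    MemLp (fun z => conj (φ z) * U z) 2 ω.area := by
  -- The summand `1` makes the truncations at least `1`; the summand `4CM` makes `M/(4A) ≤ 1/(16C)`,
  -- the gradient condition for perturbing the weight.
  set A : ℝ := 1 + 4 * C * M with hA
  have hA1 : 1 ≤ A := by rw [hA]; linarith [mul_nonneg hC.le hM0]
  have hsn : ∀ z, 0 ≤ Complex.normSq (φ z) := fun z => Complex.normSq_nonneg _
  have hsc : ContDiffOn ℝ 2 (fun z => Complex.normSq (φ z)) Disc :=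
    contDiff_normSq.comp_contDiffOn (contDiffOn_of_differentiableOn hφ)
  have hGc : ∀ W : ℂ → ℝ, ContinuousOn W Disc →
      Integrable (fun z => W z * (‖delbar U z‖ ^ 2 / L z)) ω.area := by
    intro W hW
    have hc : ContinuousOn (fun z => W z * (‖delbar U z‖ ^ 2 / L z)) Disc :=
      hW.mul (((continuousOn_delbar hU).norm.pow 2).div hL fun z hz => (hLpos z hz).ne')
    rw [ω.integrable_area_iff]
    refine (((hω.smul hc).mono hSD).integrableOn_compact hS).of_forall_sdiff_eq_zero
      measurableSet_ball fun z hz => ?_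
    simp [hdU z hz.1 hz.2]
  set W : ℝ → ℂ → ℝ := fun k z => k * (A + Complex.normSq (φ z)) / (k + Complex.normSq (φ z)) with hW
  -- This bound does not depend on `k`, since every truncation is at most `A + |φ|²`; the integrand
  -- is integrable because `∂̄U` is supported in `S`.
  set B := 16 * C * ∫ z, (A + Complex.normSq (φ z)) * (‖delbar U z‖ ^ 2 / L z) ∂ω.area with hB
  have hWc : ∀ k, A ≤ k → ContDiffOn ℝ 2 (W k) Disc := fun k hk =>
    (contDiffOn_const.mul (contDiffOn_const.add hsc)).div (contDiffOn_const.add hsc)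
      fun z _ => by linarith [hsn z]
  have hWB : ∀ k, A ≤ k → Integrable (fun z => W k z * ‖U z‖ ^ 2) ω.area ∧
      ∫ z, W k z * ‖U z‖ ^ 2 ∂ω.area ≤ B := by
    intro k hk
    have hk0 : 0 < k := by linarith
    have h1 : ∀ z ∈ Disc, 1 ≤ W k z := fun z _ => by
      have := hsn z
      rw [hW, le_div_iff₀ (by positivity)]
      nlinarith
    have h2 : ∀ z ∈ Disc, W k z ≤ k := fun z _ => by
      have := hsn z
      rw [hW, div_le_iff₀ (by positivity)]
      nlinarith
    have h3 : ∀ z, W k z ≤ A + Complex.normSq (φ z) := fun z => by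
      have := hsn z
      rw [hW, div_le_iff₀ (by positivity)]
      nlinarith
    have hgrad : ∀ z ∈ Disc,
        ‖delbar (fun v => (W k v : ℂ)) z‖ ^ 2 ≤ 1 / (16 * C) * (L z * W k z ^ 2) := by
      intro z hz
      refine (norm_delbar_truncation_sq_le (hφ.differentiableAt (disc_mem_nhds hz))
        (by linarith) hk).trans ?_
      have h4 := hM z hz
      have hLz := hLpos z hz
      have h5 : 1 / (4 * A) * M ≤ 1 / (16 * C) := by
        rw [one_div_mul_eq_div, div_le_div_iff₀ (by positivity) (by positivity)]
        rw [hA]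
        linarith
      calc 1 / (4 * A) * (‖deriv φ z‖ ^ 2 * W k z ^ 2)
          ≤ 1 / (4 * A) * (M * L z * W k z ^ 2) := by gcongr
        _ = 1 / (4 * A) * M * (L z * W k z ^ 2) := by ring
        _ ≤ _ := by gcongr
    have h := hmin.integral_mul_norm_sq_le hω hL hLpos hC hest hU (hWc k hk) h1 h2 hgrad
      (hGc _ (hWc k hk).continuousOn)
    refine ⟨h.1, h.2.trans ?_⟩
    rw [hB]
    refine mul_le_mul_of_nonneg_left ?_ (by positivity)
    refine integral_mono_ae (hGc _ (hWc k hk).continuousOn)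
      (hGc _ (continuousOn_const.add hsc.continuousOn)) ?_
    filter_upwards [ω.ae_mem_disc] with z hz
    have hLz := hLpos z hz
    have := h3 z
    gcongr
  have hfc : ContinuousOn (fun z => conj (φ z) * U z) Disc :=
    (Complex.continuous_conj.comp_continuousOn hφ.continuousOn).mul hU.continuousOn
  rw [memLp_two_iff_integrable_sq_norm (ω.aestronglyMeasurable_of_continuousOn hfc)]
  have hball : ∀ n : ℕ, Metric.closedBall (0 : ℂ) (1 - 1 / (n + 1)) ⊆ Disc := fun n =>
    Metric.closedBall_subset_ball (by have : (0 : ℝ) < 1 / (n + 1) := by positivity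
                                      linarith)
  have hcover : AECover ω.area atTop fun n : ℕ => Metric.closedBall (0 : ℂ) (1 - 1 / (n + 1)) := by
    refine ⟨?_, fun n => measurableSet_closedBall⟩
    filter_upwards [ω.ae_mem_disc] with z hz
    rw [Metric.mem_ball, dist_zero_right] at hz
    filter_upwards [tendsto_one_div_add_atTop_nhds_zero_nat.eventually_lt_const
      (by linarith : 0 < 1 - ‖z‖)] with n hn
    rw [Metric.mem_closedBall, dist_zero_right]
    linarith
  -- Once `k` exceeds `|φ|²` on the disc in question, the denominator `k + |φ|²` is at most `2k`, so
  -- `|φ|² ≤ 2 W k` there. Exhausting by such discs then gives integrability with total at most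
  -- `2B`.
  have hloc : ∀ n : ℕ, ∃ k, A ≤ k ∧ ∀ z ∈ Metric.closedBall (0 : ℂ) (1 - 1 / (n + 1)),
      ‖conj (φ z) * U z‖ ^ 2 ≤ 2 * (W k z * ‖U z‖ ^ 2) := by
    intro n
    obtain ⟨D, hD⟩ := (isCompact_closedBall (0 : ℂ) (1 - 1 / (n + 1))).exists_bound_of_continuousOn
      (hsc.continuousOn.mono (hball n))
    refine ⟨max A D, le_max_left _ _, fun z hz => ?_⟩
    have h1 := hsn z
    have h2 := (Real.norm_of_nonneg h1 ▸ hD z hz).trans (le_max_right A D)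
    have h3 : A ≤ max A D := le_max_left _ _
    have h4 : Complex.normSq (φ z) ≤ 2 * W (max A D) z := by
      rw [hW, ← mul_div_assoc, le_div_iff₀ (by linarith)]
      nlinarith
    rw [norm_mul, RCLike.norm_conj, mul_pow, Complex.sq_norm (φ z), ← mul_assoc]
    gcongr
  have hmono : ∀ n : ℕ, IntegrableOn (fun z => ‖conj (φ z) * U z‖ ^ 2)
      (Metric.closedBall (0 : ℂ) (1 - 1 / (n + 1))) ω.area := by
    intro n
    obtain ⟨k, hk, hkz⟩ := hloc n
    refine Integrable.mono' (((hWB k hk).1.const_mul 2).integrableOn)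
      ((ω.aestronglyMeasurable_of_continuousOn (hfc.norm.pow 2)).restrict) ?_
    filter_upwards [ae_restrict_mem measurableSet_closedBall] with z hz
    rw [Real.norm_of_nonneg (by positivity)]
    exact hkz z hz
  refine hcover.integrable_of_integral_norm_bounded (2 * B) hmono (Eventually.of_forall fun n => ?_)
  obtain ⟨k, hk, hkz⟩ := hloc n
  have hi := (hWB k hk).1.const_mul 2
  calc ∫ z in Metric.closedBall (0 : ℂ) (1 - 1 / (n + 1)), ‖‖conj (φ z) * U z‖ ^ 2‖ ∂ω.area
      ≤ ∫ z in Metric.closedBall (0 : ℂ) (1 - 1 / (n + 1)), 2 * (W k z * ‖U z‖ ^ 2) ∂ω.area := by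
        refine setIntegral_mono_on (hmono n).norm hi.integrableOn measurableSet_closedBall
          fun z hz => ?_
        rw [Real.norm_of_nonneg (by positivity)]
        exact hkz z hz
    _ ≤ ∫ z, 2 * (W k z * ‖U z‖ ^ 2) ∂ω.area := by
        refine setIntegral_le_integral hi (Eventually.of_forall fun z => ?_)
        have := hsn z
        have hk0 : 0 < k := by linarith
        simp only [hW, Pi.zero_apply]
        positivity
    _ ≤ 2 * B := by
        rw [integral_const_mul]
        linarith [(hWB k hk).2]

/-- The kernel is a compactly supported bump `X` minus the minimal function `X - K_z`.
Multiplication by `conj φ` keeps the bump in `L²` by compactness, and the minimal function by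
`IsMinimal.memLp_conj_mul`. -/
theorem hankelDefined_of_deriv_sq_le {ω : Weight} (hω : ContDiffOn ℝ 2 ω Disc) {L : ℂ → ℝ}
    (hL : ContinuousOn L Disc) (hLpos : ∀ z ∈ Disc, 0 < L z) {C : ℝ} (hC : 0 < C)
    (hest : HasDelbarEstimate ω L C) {φ : ℂ → ℂ}
    (hφ : DifferentiableOn ℂ φ Disc) {M : ℝ} (hM0 : 0 ≤ M)
    (hM : ∀ z ∈ Disc, ‖deriv φ z‖ ^ 2 ≤ M * L z) : HankelDefined ω φ := by
  intro z
  rw [mem_conjMulDomain_iff]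
  have hz := z.2
  rw [Metric.mem_ball, dist_zero_right] at hz
  set ε := (1 - ‖(z : ℂ)‖) / 2 with hε
  have hε0 : 0 < ε := by rw [hε]; linarith
  have hsum : ‖(z : ℂ)‖ + ε < 1 := by rw [hε]; linarith
  set S := Metric.closedBall (z : ℂ) ε with hS
  have hSD : S ⊆ Disc := closedBall_subset_disc hsum
  set X : ℂ → ℂ := fun w => ((mol ε (z - w) / ω w : ℝ) : ℂ) with hX
  have hXc : ContDiffOn ℝ 1 X Disc :=
    contDiffOn_ofReal (((contDiff_mol (n := 1) ε).comp
      (contDiff_const.sub contDiff_id)).contDiffOn.div (hω.of_le (by norm_num))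
        fun w hw => (ω.pos w hw).ne')
  have hX0 : ∀ w ∉ S, X w = 0 := fun w hw => by
    rw [hS, Metric.mem_closedBall, dist_eq_norm, norm_sub_rev, not_le] at hw
    simp [hX, mol_eq_zero hε0 hw.le]
  have hUc : ContDiffOn ℝ 1 (fun w => X w - holo (K ω z) w) Disc :=
    hXc.sub (contDiffOn_of_differentiableOn (holo_differentiableOn _))
  have hdU : ∀ w ∈ Disc, w ∉ S → delbar (fun w => X w - holo (K ω z) w) w = 0 := by
    intro w hw hwS
    have hK : DifferentiableAt ℂ (holo (K ω z)) w :=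
      (holo_differentiableOn _).differentiableAt (disc_mem_nhds hw)
    have h0 : X =ᶠ[𝓝 w] fun _ => 0 := by
      filter_upwards [Metric.isClosed_closedBall.isOpen_compl.mem_nhds hwS] with v hv using hX0 v hv
    rw [delbar_sub (differentiableAt_of_contDiffOn hXc hw) (hK.restrictScalars ℝ),
      delbar_eq_zero hK, delbar_congr h0, delbar_eq_zero (differentiableAt_const _), sub_zero]
  have h1 := (isMinimal_mol_sub_K hω.continuousOn z hε0 hsum).memLp_conj_mul hω.continuousOn hL
    hLpos hC hest hUc (isCompact_closedBall _ _) hSD hdU hφ hM0 hM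
  have h2 : MemLp (fun w => conj (φ w) * X w) 2 ω.area :=
    ω.memLp_of_eq_zero_off_compact ((Complex.continuous_conj.comp_continuousOn
      hφ.continuousOn).mul hXc.continuousOn) (isCompact_closedBall _ _) hSD
      fun w hw => by rw [hX0 w hw, mul_zero]
  refine (memLp_congr_ae (Eventually.of_forall fun w => ?_)).1 (h2.sub h1)
  simp only [Pi.sub_apply, hX]
  ring

/-- A continuous representative of `H f` that is orthogonal to the Bergman space. -/
theorem exists_hankel_ae_eq {ω : Weight} {φ : ℂ → ℂ} (f : (hankel ω φ).domain) :
    ∃ p : bergman ω, hankel ω φ f =ᵐ[ω.area] (fun z => conj (φ z) * holo (f : bergman ω) z - holo p z) ∧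
      IsMinimal ω fun z => conj (φ z) * holo (f : bergman ω) z - holo p z := by
  set h : L2 ω := conjMul ω φ ⟨f, f.2.2⟩ with hh
  set p : bergman ω := ⟨(bergman ω).starProjection h, Submodule.starProjection_apply_mem _ _⟩ with hp
  have hdef : hankel ω φ f = h - (p : L2 ω) := rfl
  have hhae : h =ᵐ[ω.area] fun z => conj (φ z) * holo (f : bergman ω) z := by
    refine (MemLp.coeFn_toLp f.2.2).trans ?_
    filter_upwards [holo_ae (f : bergman ω)] with z hz
    rw [hz]
  have hae : hankel ω φ f =ᵐ[ω.area]
      fun z => conj (φ z) * holo (f : bergman ω) z - holo p z := by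
    rw [hdef]
    filter_upwards [Lp.coeFn_sub h (p : L2 ω), hhae, holo_ae p] with z h1 h2 h3
    rw [h1, Pi.sub_apply, h2, h3]
  refine ⟨p, hae, (memLp_congr_ae hae).1 (Lp.memLp _), fun F hF hF2 => ?_⟩
  have hmem : hankel ω φ f ∈ (bergman ω)ᗮ := by
    rw [hdef]; exact Submodule.sub_starProjection_mem_orthogonal _
  have h0 := (Submodule.mem_orthogonal _ _).1 hmem (hF2.toLp F) ⟨F, hF, hF2.coeFn_toLp⟩
  rw [← h0, L2.inner_def]
  refine integral_congr_ae ?_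
  filter_upwards [hF2.coeFn_toLp, hae] with z h1 h2
  rw [h1, h2, RCLike.inner_apply]

/-- Hörmander's estimate applies to `H f`, whose `∂̄` is `conj φ' * F`; the bound on `|φ'|²` cancels
the density `L`. -/
theorem norm_hankel_le {ω : Weight} (hω : ContinuousOn ω Disc) {L : ℂ → ℝ}
    (hL : ContinuousOn L Disc) (hLpos : ∀ z ∈ Disc, 0 < L z) {C : ℝ} (hC : 0 < C)
    (hest : HasDelbarEstimate ω L C) {φ : ℂ → ℂ}
    (hφ : DifferentiableOn ℂ φ Disc) {M : ℝ}
    (hM : ∀ z ∈ Disc, ‖deriv φ z‖ ^ 2 ≤ M * L z) (f : (hankel ω φ).domain) :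
    ‖hankel ω φ f‖ ^ 2 ≤ C * M * ‖(f : bergman ω)‖ ^ 2 := by
  obtain ⟨p, hae, hmin⟩ := exists_hankel_ae_eq f
  set F := holo (f : bergman ω) with hF
  have hFd : DifferentiableOn ℂ F Disc := holo_differentiableOn _
  set U : ℂ → ℂ := fun z => conj (φ z) * F z - holo p z with hU
  have hUc : ContDiffOn ℝ 1 U Disc :=
    ((contDiffOn_conj (contDiffOn_of_differentiableOn hφ)).mul
      (contDiffOn_of_differentiableOn hFd)).sub
      (contDiffOn_of_differentiableOn (holo_differentiableOn p))
  have hdU : ∀ z ∈ Disc, delbar U z = conj (deriv φ z) * F z := by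
    intro z hz
    have h1 := hφ.differentiableAt (disc_mem_nhds hz)
    have h2 := hFd.differentiableAt (disc_mem_nhds hz)
    have h3 := (holo_differentiableOn p).differentiableAt (disc_mem_nhds hz)
    have h4 : DifferentiableAt ℝ (fun w => conj (φ w)) z :=
      Complex.conjCLE.differentiableAt.comp z (h1.restrictScalars ℝ)
    rw [hU, delbar_sub (f := fun w => conj (φ w) * F w) (h4.mul (h2.restrictScalars ℝ)) (h3.restrictScalars ℝ), delbar_eq_zero h3,
      delbar_mul h4 (h2.restrictScalars ℝ), delbar_eq_zero h2, delbar_conj h1]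
    ring
  have hFn : Integrable (fun z => ‖F z‖ ^ 2) ω.area :=
    (memLp_two_iff_integrable_sq_norm (memLp_holo _).1).1 (memLp_holo _)
  have hpt : ∀ z ∈ Disc, ‖delbar U z‖ ^ 2 / L z ≤ M * ‖F z‖ ^ 2 := by
    intro z hz
    have := hLpos z hz
    rw [hdU z hz, norm_mul, RCLike.norm_conj, mul_pow, div_le_iff₀ this]
    calc _ ≤ M * L z * ‖F z‖ ^ 2 := by gcongr; exact hM z hz
      _ = _ := by ring
  have hJ : Integrable (fun z => ‖delbar U z‖ ^ 2 / L z) ω.area := by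
    refine Integrable.mono' (hFn.const_mul M) (ω.aestronglyMeasurable_of_continuousOn
      (((continuousOn_delbar hUc).norm.pow 2).div hL fun z hz => (hLpos z hz).ne')) ?_
    filter_upwards [ω.ae_mem_disc] with z hz
    have := hLpos z hz
    rw [Real.norm_of_nonneg (by positivity)]
    exact hpt z hz
  have e1 : ‖(f : bergman ω)‖ ^ 2 = ∫ z, ‖F z‖ ^ 2 ∂ω.area :=
    norm_sq_of_ae_eq (holo_ae (f : bergman ω))
  rw [norm_sq_of_ae_eq hae, e1]
  calc _ ≤ C * ∫ z, ‖delbar U z‖ ^ 2 / L z ∂ω.area :=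
        hmin.integral_norm_sq_le hω hL hLpos hC hest hUc hJ
    _ ≤ C * ∫ z, M * ‖F z‖ ^ 2 ∂ω.area := by
        refine mul_le_mul_of_nonneg_left ?_ hC.le
        refine integral_mono_ae hJ (hFn.const_mul M) ?_
        filter_upwards [ω.ae_mem_disc] with z hz using hpt z hz
    _ = _ := by rw [integral_const_mul]; ring

end UpperBound

/-! ### Lower bound by testing on kernels -/

section LowerBound

/-- Scaling: the mollifier has height of order `ε⁻²` and varies at scale `ε`, so one derivative
costs another `ε⁻¹`. -/
theorem exists_norm_delbar_mol_le : ∃ B : ℝ, 0 < B ∧ ∀ ε : ℝ, 0 < ε → ∀ z : ℂ,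
    ‖delbar (fun w => (mol ε w : ℂ)) z‖ ≤ B / ε ^ 3 := by
  have h2 : ContDiff ℝ 0 (deriv (deriv cutoff)) := by
    have h : ContDiff ℝ ((⊤ : ℕ∞) : WithTop ℕ∞) (deriv cutoff) := contDiff_deriv_cutoff (n := ⊤)
    exact (contDiff_infty_iff_deriv.1 h).2.of_le (by simp)
  have hzero : ∀ s, 2 / 3 < s → deriv (deriv cutoff) s = 0 := by
    intro s hs
    have : deriv cutoff =ᶠ[𝓝 s] fun _ => 0 := by
      filter_upwards [Ioi_mem_nhds hs] with t ht using deriv_cutoff_of_gt ht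
    rw [this.deriv_eq, deriv_const]
  obtain ⟨B, hB⟩ := (isCompact_Icc (a := (0 : ℝ)) (b := 2 / 3)).exists_bound_of_continuousOn
    h2.continuous.continuousOn
  refine ⟨max B 1 / Real.pi, by positivity, fun ε hε z => ?_⟩
  have hn : DifferentiableAt ℝ (fun w : ℂ => Complex.normSq w) z :=
    (contDiff_normSq (n := 1)).differentiable one_ne_zero z
  have hd : HasDerivAt (fun s => -deriv cutoff (s / ε ^ 2) / (Real.pi * ε ^ 2))
      (-(deriv (deriv cutoff) (Complex.normSq z / ε ^ 2) * (1 / ε ^ 2)) / (Real.pi * ε ^ 2))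
      (Complex.normSq z) := by
    have h1 : HasDerivAt (deriv cutoff) (deriv (deriv cutoff) (Complex.normSq z / ε ^ 2))
        (Complex.normSq z / ε ^ 2) :=
      ((contDiff_deriv_cutoff (n := 1)).differentiable one_ne_zero _).hasDerivAt
    exact ((HasDerivAt.comp (h₂ := deriv cutoff) (h := fun s => s / ε ^ 2) (Complex.normSq z) h1
      ((hasDerivAt_id (Complex.normSq z)).div_const (ε ^ 2))).neg).div_const _
  have e := delbar_ofReal_comp hd hn
  rw [delbar_normSq] at e
  unfold mol
  rw [e]
  by_cases hs : 2 / 3 < Complex.normSq z / ε ^ 2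
  · rw [hzero _ hs]
    simp only [zero_mul, neg_zero, zero_div, Complex.ofReal_zero, norm_zero]
    positivity
  · have hs0 : 0 ≤ Complex.normSq z / ε ^ 2 := div_nonneg (Complex.normSq_nonneg _) (by positivity)
    have h3 := (hB _ ⟨hs0, not_lt.1 hs⟩).trans (le_max_left B 1)
    have hzε : ‖z‖ ≤ ε := by
      rw [not_lt, div_le_iff₀ (by positivity), Complex.normSq_eq_norm_sq] at hs
      refine (sq_le_sq₀ (norm_nonneg z) hε.le).1 ?_
      nlinarith
    rw [norm_mul, Complex.norm_real, norm_div, norm_neg, norm_mul,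
      Real.norm_of_nonneg (by positivity : (0 : ℝ) ≤ 1 / ε ^ 2),
      Real.norm_of_nonneg (by positivity : (0 : ℝ) ≤ Real.pi * ε ^ 2)]
    calc _ ≤ max B 1 * (1 / ε ^ 2) / (Real.pi * ε ^ 2) * ε := by gcongr
      _ = _ := by field_simp

theorem tau_nonneg (ω : Weight) (z : Disc) : 0 ≤ tau ω z := by
  rw [tau]; positivity

theorem tau_sq_mul {ω : Weight} {z : Disc} (h : 0 < tau ω z) :
    0 < ‖K ω z‖ ∧ ω z * ‖K ω z‖ ^ 2 * tau ω z ^ 2 = 1 := by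
  have hK : 0 < ‖K ω z‖ := by
    refine (norm_nonneg _).lt_of_ne fun h0 => ?_
    rw [tau, ← h0] at h
    simp at h
  have hω := ω.pos z z.2
  refine ⟨hK, ?_⟩
  rw [tau, div_pow, mul_pow, Real.sq_sqrt hω.le]
  field_simp

/-- The Bloch seminorm is controlled by the bound of the Hankel operator on kernels. -/
theorem Weight.IsW.exists_tau_mul_norm_deriv_le {ω : Weight} (hW : ω.IsW)
    (hω : ContinuousOn ω Disc) : ∃ c : ℝ, 0 < c ∧ ∀ φ : ℂ → ℂ, DifferentiableOn ℂ φ Disc →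
      HankelDefined ω φ → ∀ M : ℝ, 0 ≤ M →
      (∀ f : (hankel ω φ).domain, ‖hankel ω φ f‖ ≤ M * ‖(f : bergman ω)‖) →
      ∀ z : Disc, tau ω z * ‖deriv φ z‖ ≤ c * M := by
  obtain ⟨η, hη, C, hC, hloc⟩ := hW.local_estimates
  obtain ⟨C₀, hC₀⟩ := hW.tau_le
  obtain ⟨B, hB0, hB⟩ := exists_norm_delbar_mol_le
  -- The first entry keeps the disc of radius `κτ` inside the range of the local estimates; the
  -- second makes `κτ ≤ (1 - |z|)/2`, so that the closed disc stays in the unit disc.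
  set κ := min η (1 / (2 * (|C₀| + 1))) with hκ
  have hκ0 : 0 < κ := lt_min hη (by positivity)
  set D := B ^ 2 * C ^ 4 * Real.pi / κ ^ 4 with hD
  have hD0 : 0 < D := by positivity
  refine ⟨√D, Real.sqrt_pos.2 hD0, fun φ hφ hdef M hM hHM z => ?_⟩
  -- If `K_z = 0` then `tau` takes the value `1 / 0 = 0` and the claim is trivial.
  rcases (tau_nonneg ω z).eq_or_lt with h0 | hτ
  · rw [← h0, zero_mul]; positivity
  have hzD := z.2
  rw [Metric.mem_ball, dist_zero_right] at hzD
  set τ := tau ω z with hτdef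
  set r := κ * τ with hr
  have hr0 : 0 < r := by positivity
  have hrη : r ≤ η * τ := by rw [hr]; gcongr; exact min_le_left _ _
  have hr1 : ‖(z : ℂ)‖ + r < 1 := by
    have h1 : r ≤ 1 / (2 * (|C₀| + 1)) * τ := by rw [hr]; gcongr; exact min_le_right _ _
    have h2 : τ ≤ (|C₀| + 1) * (1 - ‖(z : ℂ)‖) := by
      refine (hC₀ z).trans ?_
      have := le_abs_self C₀
      have : 0 ≤ 1 - ‖(z : ℂ)‖ := by linarith
      gcongr
      linarith
    have h3 : 1 / (2 * (|C₀| + 1)) * τ ≤ (1 - ‖(z : ℂ)‖) / 2 := by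
      calc _ ≤ 1 / (2 * (|C₀| + 1)) * ((|C₀| + 1) * (1 - ‖(z : ℂ)‖)) := by gcongr
        _ = _ := by field_simp
    linarith
  set S := Metric.closedBall (z : ℂ) r with hS
  have hSD : S ⊆ Disc := closedBall_subset_disc hr1
  obtain ⟨hKz, -⟩ := tau_sq_mul hτ
  set k := holo (K ω z) with hk
  have hkd : DifferentiableOn ℂ k Disc := holo_differentiableOn _
  -- Near `z` the kernel is comparable to `‖K_z‖ ‖K_w‖`. Writing `ω(w) ‖K_w‖² = τ(w)⁻²` and
  -- comparing `τ(w)` with `τ(z)` bounds `|K_z|² ω` below on `S` by a multiple of `‖K_z‖² τ(z)⁻²`.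
  have hlower : ∀ w ∈ S, k w ≠ 0 ∧ ‖K ω z‖ ^ 2 ≤ C ^ 4 * τ ^ 2 * (‖k w‖ ^ 2 * ω w) := by
    intro w hw
    rw [hS, Metric.mem_closedBall, dist_eq_norm, norm_sub_rev] at hw
    have hwD : w ∈ Disc := hSD (by rwa [hS, Metric.mem_closedBall, dist_eq_norm, norm_sub_rev])
    obtain ⟨h1, h2, h3⟩ := hloc z ⟨w, hwD⟩ (hw.trans hrη)
    rw [bergman_apply] at h3
    have hτw : 0 < tau ω ⟨w, hwD⟩ := by
      by_contra h
      have : tau ω ⟨w, hwD⟩ = 0 := le_antisymm (not_lt.1 h) (tau_nonneg _ _)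
      rw [this, mul_zero] at h1
      linarith
    obtain ⟨hKw, h4⟩ := tau_sq_mul hτw
    have hωw := ω.pos w hwD
    refine ⟨fun h => ?_, ?_⟩
    · change k w = 0 at h
      have h5 : C * ‖holo (K ω z) w‖ = 0 := by rw [← hk, h]; simp
      have : 0 < ‖K ω z‖ * ‖K ω ⟨w, hwD⟩‖ := by positivity
      linarith
    · have h5 : (‖K ω z‖ * ‖K ω ⟨w, hwD⟩‖) ^ 2 ≤ (C * ‖k w‖) ^ 2 := by gcongr
      have h6 : tau ω ⟨w, hwD⟩ ^ 2 ≤ (C * τ) ^ 2 := by gcongr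
      calc ‖K ω z‖ ^ 2 = ‖K ω z‖ ^ 2 *
            (ω w * ‖K ω ⟨w, hwD⟩‖ ^ 2 * tau ω ⟨w, hwD⟩ ^ 2) := by rw [h4, mul_one]
        _ = (‖K ω z‖ * ‖K ω ⟨w, hwD⟩‖) ^ 2 * ω w * tau ω ⟨w, hwD⟩ ^ 2 := by ring
        _ ≤ (C * ‖k w‖) ^ 2 * ω w * (C * τ) ^ 2 := by gcongr
        _ = _ := by ring
  set m : ℂ → ℂ := fun w => (mol r (z - w) : ℂ) with hm
  have hmc : ContDiff ℝ 2 m := Complex.ofRealCLM.contDiff.comp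
    ((contDiff_mol (n := 2) r).comp (contDiff_const.sub contDiff_id))
  have hm0 : ∀ w ∉ S, m w = 0 := fun w hw => by
    rw [hS, Metric.mem_closedBall, dist_eq_norm, norm_sub_rev, not_le] at hw
    simp [hm, mol_eq_zero hr0 hw.le]
  have hkc : ∀ w ∈ Disc, ContDiffAt ℝ 2 k w := fun w hw =>
    (contDiffOn_of_differentiableOn hkd).contDiffAt (disc_mem_nhds hw)
  set β : ℂ → ℂ := fun w => m w / k w with hβ
  have hβ0 : ∀ w ∉ S, β w = 0 := fun w hw => by simp only [hβ, hm0 w hw, zero_div]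
  have hβt : IsTest 2 β := by
    refine isTest_of_eq_zero_off_compact (fun w hw => ContDiffAt.contDiffWithinAt ?_)
      (isCompact_closedBall _ _) hSD hβ0
    by_cases hwS : w ∈ S
    · simp only [hβ, div_eq_mul_inv]
      exact hmc.contDiffAt.mul ((hkc w hw).inv (hlower w hwS).1)
    · refine (contDiffAt_const (c := (0 : ℂ))).congr_of_eventuallyEq ?_
      filter_upwards [Metric.isClosed_closedBall.isOpen_compl.mem_nhds hwS] with v hv using hβ0 v hv
  have hβ1 : IsTest 1 β := hβt.of_le (by norm_num)
  have hdβ0 : ∀ w ∉ S, delbar β w = 0 := fun w hw => by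
    refine delbar_of_notMem_tsupport fun h => hw ?_
    refine closure_minimal (fun v hv => ?_) Metric.isClosed_closedBall h
    by_contra h'
    exact hv (hβ0 v h')
  have hdβ : ∀ w ∈ S, ‖k w‖ * ‖delbar β w‖ ≤ B / r ^ 3 := by
    intro w hw
    have hwD := hSD hw
    have hkw : DifferentiableAt ℂ k w := hkd.differentiableAt (disc_mem_nhds hwD)
    have hev : m =ᶠ[𝓝 w] fun v => k v * β v := by
      filter_upwards [hkw.continuousAt.eventually_ne (hlower w hw).1] with v hv
      simp only [hβ]
      field_simp
    have h1 : delbar m w = k w * delbar β w := by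
      rw [delbar_congr hev, delbar_mul (hkw.restrictScalars ℝ)
        (hβ1.contDiff.differentiable one_ne_zero w), delbar_eq_zero hkw]
      ring
    have hmd : Differentiable ℝ fun w => (mol r w : ℂ) :=
      (Complex.ofRealCLM.contDiff.comp (contDiff_mol (n := 1) r)).differentiable one_ne_zero
    have h2 : delbar m w = -delbar (fun w => (mol r w : ℂ)) (z - w) := delbar_comp_sub hmd z w
    rw [← norm_mul, ← h1, h2, norm_neg]
    exact hB r hr0 _
  set f : (hankel ω φ).domain :=
    ⟨K ω z, Submodule.subset_span ⟨z, rfl⟩, hdef z⟩ with hf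
  obtain ⟨p, hae, -⟩ := exists_hankel_ae_eq f
  set U : ℂ → ℂ := fun w => conj (φ w) * k w - holo p w with hU
  have hUc : ContDiffOn ℝ 1 U Disc :=
    ((contDiffOn_conj (contDiffOn_of_differentiableOn hφ)).mul
      (contDiffOn_of_differentiableOn hkd)).sub
      (contDiffOn_of_differentiableOn (holo_differentiableOn p))
  have hms := ω.memLp_delbar_div hω hβt
  set s := hms.toLp _ with hs
  have hinner : inner ℂ s (hankel ω φ f) = -conj (deriv φ z) := by
    rw [inner_delbarRange hβt hms.coeFn_toLp hae, integral_mul_delbar_test hUc hβ1,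
      ← molAvg_eq_of_differentiableOn (hφ.deriv isOpen_disc) hr0 hr1, molAvg, ← integral_conj]
    congr 1
    refine integral_congr_ae (Eventually.of_forall fun w => ?_)
    by_cases hw : w ∈ S
    · have h1 := hφ.differentiableAt (disc_mem_nhds (hSD hw))
      have h2 := hkd.differentiableAt (disc_mem_nhds (hSD hw))
      have h3 := (holo_differentiableOn p).differentiableAt (disc_mem_nhds (hSD hw))
      have h4 : DifferentiableAt ℝ (fun w => conj (φ w)) w :=
        Complex.conjCLE.differentiableAt.comp w (h1.restrictScalars ℝ)
      have h5 := (hlower w hw).1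
      simp only [hU]
      rw [delbar_sub (f := fun w => conj (φ w) * k w) (h4.mul (h2.restrictScalars ℝ))
        (h3.restrictScalars ℝ), delbar_eq_zero h3,
        delbar_mul h4 (h2.restrictScalars ℝ), delbar_eq_zero h2, delbar_conj h1]
      simp only [hβ, hm, map_mul, Complex.conj_ofReal]
      field_simp
      ring
    · have h1 : (mol r (z - w) : ℂ) = 0 := hm0 w hw
      simp [hβ0 w hw, h1]
  -- The integrand is at most `(B/r³)² C⁴ τ² / ‖K_z‖²` on a disc of area `πr²`; with `r = κτ` this
  -- gives `D = B²C⁴π/κ⁴`.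
  have hsn : ‖s‖ ^ 2 ≤ D / (τ ^ 2 * ‖K ω z‖ ^ 2) := by
    rw [norm_sq_delbarRange hω hβt hms.coeFn_toLp]
    have hc : ∀ w ∈ S, ‖‖delbar β w‖ ^ 2 / ω w‖ ≤
        (B / r ^ 3) ^ 2 * (C ^ 4 * τ ^ 2) / ‖K ω z‖ ^ 2 := by
      intro w hw
      have hωw := ω.pos w (hSD hw)
      obtain ⟨h1, h2⟩ := hlower w hw
      have h3 : (‖k w‖ * ‖delbar β w‖) ^ 2 ≤ (B / r ^ 3) ^ 2 := by gcongr; exact hdβ w hw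
      rw [Real.norm_of_nonneg (by positivity), div_le_div_iff₀ hωw (by positivity)]
      calc ‖delbar β w‖ ^ 2 * ‖K ω z‖ ^ 2
          ≤ ‖delbar β w‖ ^ 2 * (C ^ 4 * τ ^ 2 * (‖k w‖ ^ 2 * ω w)) := by gcongr
        _ = (‖k w‖ * ‖delbar β w‖) ^ 2 * (C ^ 4 * τ ^ 2) * ω w := by ring
        _ ≤ _ := by gcongr
    have h4 : ∫ w, ‖delbar β w‖ ^ 2 / ω w = ∫ w in S, ‖delbar β w‖ ^ 2 / ω w :=
      (setIntegral_eq_integral_of_forall_compl_eq_zero fun w hw => by simp [hdβ0 w hw]).symm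
    have h5 := norm_setIntegral_le_of_norm_le_const (μ := volume)
      (measure_closedBall_lt_top (x := (z : ℂ)) (r := r)) hc
    have hvol : volume.real S = Real.pi * r ^ 2 := by
      rw [Measure.real, hS, Complex.volume_closedBall]
      simp [ENNReal.toReal_ofReal hr0.le, mul_comm]
    rw [h4]
    refine (le_abs_self _).trans (h5.trans (le_of_eq ?_))
    rw [hvol, hD, hr]
    field_simp
  have hCS : ‖deriv φ z‖ ≤ ‖s‖ * (M * ‖K ω z‖) := by
    have h1 := norm_inner_le_norm (𝕜 := ℂ) s (hankel ω φ f)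
    rw [hinner, norm_neg, RCLike.norm_conj] at h1
    exact h1.trans (by gcongr; exact hHM f)
  refine (sq_le_sq₀ (by positivity) (by positivity)).1 ?_
  calc (τ * ‖deriv φ z‖) ^ 2 ≤ (τ * (‖s‖ * (M * ‖K ω z‖))) ^ 2 := by gcongr
    _ = τ ^ 2 * ‖s‖ ^ 2 * (M ^ 2 * ‖K ω z‖ ^ 2) := by ring
    _ ≤ τ ^ 2 * (D / (τ ^ 2 * ‖K ω z‖ ^ 2)) * (M ^ 2 * ‖K ω z‖ ^ 2) := by gcongr
    _ = (√D * M) ^ 2 := by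
      rw [mul_pow, Real.sq_sqrt hD0.le]
      field_simp

end LowerBound

end WeightedBergman

/-! ### The characterization and the norm equivalence -/

open WeightedBergman in
theorem mainTheorem4 (ω : WeightedBergman.Weight) (hω : ω.IsWStar) :
    ∃ c C : ℝ, 0 < c ∧ 0 < C ∧ ∀ φ : ℂ → ℂ, DifferentiableOn ℂ φ WeightedBergman.Disc →
      (WeightedBergman.HankelBounded ω φ ↔ φ ∈ WeightedBergman.bloch ω) ∧
      (WeightedBergman.HankelBounded ω φ →
        c * WeightedBergman.blochNorm ω φ ≤ WeightedBergman.hankelNorm ω φ ∧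
        WeightedBergman.hankelNorm ω φ ≤ C * WeightedBergman.blochNorm ω φ) := by
  have hωc : ContDiffOn ℝ 2 ω Disc := ω.contDiffOn hω.contDiffOn
  obtain ⟨L, hL, ⟨c, hc, hcL⟩, C, hC, hest⟩ := hω.exists_hasDelbarEstimate
  obtain ⟨c₀, hc₀, hlow⟩ := hω.isW.exists_tau_mul_norm_deriv_le hωc.continuousOn
  have hLpos : ∀ z ∈ Disc, 0 < L z := fun z hz =>
    pos_of_mul_pos_right (hc.trans_le (hcL ⟨z, hz⟩)) (sq_nonneg _)
  have : Nonempty Disc := ⟨⟨0, by simp⟩⟩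
  have hN0 : ∀ φ, 0 ≤ blochNorm ω φ := fun φ =>
    Real.iSup_nonneg fun z => mul_nonneg (tau_nonneg ω z) (norm_nonneg _)
  have hup : ∀ φ ∈ bloch ω, HankelDefined ω φ ∧ ∀ f : (hankel ω φ).domain,
      ‖hankel ω φ f‖ ≤ √(C / c) * blochNorm ω φ * ‖(f : bergman ω)‖ := by
    rintro φ ⟨hφ, hb⟩
    -- The lower bound `c ≤ τ² L` turns the Bloch condition into `|φ'|² ≤ (N²/c) L`, with `N` the
    -- Bloch seminorm; hence the operator bound `√(C/c) N`.
    have hM : ∀ z ∈ Disc, ‖deriv φ z‖ ^ 2 ≤ blochNorm ω φ ^ 2 / c * L z := by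
      intro z hz
      have h1 : tau ω ⟨z, hz⟩ * ‖deriv φ z‖ ≤ blochNorm ω φ := le_ciSup hb ⟨z, hz⟩
      have h2 := hcL ⟨z, hz⟩
      have h3 := hLpos z hz
      have h4 := tau_nonneg ω ⟨z, hz⟩
      rw [div_mul_eq_mul_div, le_div_iff₀ hc]
      calc ‖deriv φ z‖ ^ 2 * c ≤ ‖deriv φ z‖ ^ 2 * (tau ω ⟨z, hz⟩ ^ 2 * L z) := by gcongr
        _ = (tau ω ⟨z, hz⟩ * ‖deriv φ z‖) ^ 2 * L z := by ring
        _ ≤ _ := by gcongr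
    refine ⟨hankelDefined_of_deriv_sq_le hωc hL hLpos hC hest hφ
      (div_nonneg (sq_nonneg _) hc.le) hM, fun f => ?_⟩
    have h0 := hN0 φ
    refine (sq_le_sq₀ (by positivity) (by positivity)).1 ?_
    refine (norm_hankel_le hωc.continuousOn hL hLpos hC hest hφ hM f).trans (le_of_eq ?_)
    rw [mul_pow, mul_pow, Real.sq_sqrt (by positivity)]
    ring
  have hdown : ∀ φ, DifferentiableOn ℂ φ Disc → HankelBounded ω φ → φ ∈ bloch ω := by
    rintro φ hφ ⟨hdef, M, hM⟩
    refine ⟨hφ, c₀ * max M 0, ?_⟩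
    rintro _ ⟨z, rfl⟩
    exact hlow φ hφ hdef (max M 0) (le_max_right _ _)
      (fun f => (hM f).trans (by gcongr; exact le_max_left _ _)) z
  refine ⟨1 / c₀, √(C / c), by positivity, by positivity, fun φ hφ =>
    ⟨⟨hdown φ hφ, fun hb => ⟨(hup φ hb).1, _, (hup φ hb).2⟩⟩, fun hH => ⟨?_, ?_⟩⟩⟩
  · obtain ⟨hdef, M, hM⟩ := hH
    -- The constant in `HankelBounded` may be negative while the infimum defining the norm runs over
    -- nonnegative ones, hence the maximum with `0`.
    refine le_csInf ⟨max M 0, le_max_right _ _, fun f =>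
      (hM f).trans (by gcongr; exact le_max_left _ _)⟩ ?_
    rintro M' ⟨hM'0, hM'⟩
    rw [one_div_mul_eq_div, div_le_iff₀ hc₀, mul_comm]
    exact ciSup_le fun z => hlow φ hφ hdef M' hM'0 hM' z
  · have h0 := hN0 φ
    exact csInf_le ⟨0, fun M hM => hM.1⟩ ⟨by positivity, (hup φ (hdown φ hφ hH)).2⟩
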